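/- **Setting.** Fix $\eta>0$, $\mu>\max\{1,1/\eta\}$, $\gamma_0\in(0,1/2)$. For finitely supported $\ell=(\ell_i)_{i\ge1}\in\mathbb Z^\infty_*$ put $|\ell|_\eta=\sum_i i^\eta|\ell_i|$ and $\mathtt d(\ell)=\prod_i(1+|\ell_i|^5i^5)$, and let $\mathtt D_\gamma$ be the set of $\omega\in[1,2]^{\mathbb N}$ with $|\omega\cdot\ell|>\gamma\prod_i(1+|\ell_i|^2i^2)^{-1}$ for all $\ell\ne0$. For a $\varphi$-dependent operator $T$ with matrix coefficients $T_j^{j'}(\ell)$, $j,j'\in\mathbb Z\setminus\{0\}$, let $$\|T\|_\sigma=\sum_\ell e^{\sigma|\ell|_\eta}\sup_{j'}\sum_j e^{\sigma|j-j'|}|T_j^{j'}(\ell)| .$$ For $f$ depending on $\omega\in\Omega$ let $|f|^\Omega=\sup_\Omega|f|+\gamma|f|^{\rm lip}$, with the Lipschitz seminorm taken with respect to $|\omega_1-\omega_2|_\infty$; $\|T\|^\Omega_\sigma$ is defined in the same way. The weight $\gamma$ is the one fixed below, in all norms. $\Pi_N$ is the projection on $|\ell|_\eta\le N$, $\Pi_N^\perp=1-\Pi_N$,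 and ${\rm Ad}_A(B)=BA-AB$. An operator is Hamiltonian if it is $\partial_x A(\varphi)$ with $A(\varphi)$ real and symmetric. **The scheme.** Let $O\subseteq\mathtt D_\gamma$, let $\mathcal L_0=\omega\cdot\partial_\varphi+\lambda_3\partial_x^3+\lambda_1\partial_x+\mathcal P_0$ with $\mathcal P_0=\sum_i\mathcal P_0^{(i)}$ a finite sum of Hamiltonian components (all other components are $0$), and let $\Omega_0(j)=-\lambda_3j^3+\lambda_1j$. Given $N_0,N_1,\dots$, put $r_0=0$, $\Omega_k=\Omega_0+r_k$, $\mathcal E_0=O$, and let $\mathcal E_{k+1}$ be the set of $\omega\in\mathcal E_k$ such that $$|\omega\cdot\ell+\Omega_k(j)-\Omega_k(j')|\ge\frac{\gamma|j^3-j'^3|}{\mathtt d(\ell)}\qquad\forall(\ell,j,j')\ne(0,j,j),\ |\ell|_\eta\le N_k .$$ For $\omega\in\mathcal E_{k+1}$ let $\Psi_k$ be the solution of $$\omega\cdot\partial_\varphi\Psi_k+[\mathrm i\,{\rm diag}_j\,\Omega_k(j),\Psi_k]+\Pi_{N_k}\mathcal P_k^{(k)}=\mathcal Z_k:={\rm diag}_j\,(\mathcal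 P_k^{(k)})_j^j(0)$$ whose coefficients vanish for $(\ell,j,j')=(0,j,j)$ and for $|\ell|_\eta>N_k$. Set $\mathcal P_{k+1}^{(i)}=e^{-\Psi_k}\mathcal P_k^{(i)}e^{\Psi_k}$ for $i\ge k+2$, $$\mathcal P_{k+1}^{(k+1)}=\Pi_{N_k}^\perp\mathcal P_k^{(k)}+\sum_{p\ge2}\frac{{\rm Ad}_{\Psi_k}^{p-1}(\mathcal Z_k-\Pi_{N_k}\mathcal P_k^{(k)})}{p!}+e^{-\Psi_k}\mathcal P_k^{(k+1)}e^{\Psi_k}+\sum_{p\ge1}\frac{{\rm Ad}_{\Psi_k}^p(\mathcal P_k^{(k)})}{p!},$$ $\mathcal P_{k+1}=\sum_{i\ge k+1}\mathcal P_{k+1}^{(i)}$, and $\mathrm i\,(r_{k+1}-r_k)(j)=(\mathcal P_k^{(k)})_j^j(0)$ for $\omega\in\mathcal E_k$. (So $e^{-\Psi_k}$ and $e^{\Psi_k}$ conjugate $\omega\cdot\partial_\varphi+\mathrm i\,{\rm diag}\,\Omega_k+\mathcal P_k$ to $\omega\cdot\partial_\varphi+\mathrm i\,{\rm diag}\,\Omega_{k+1}+\mathcal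 P_{k+1}$.) Thus $r_{k+1}$ is determined on $\mathcal E_k$. Given $M\ge 1$ and a constant $K$, "an extension of the corrections to $O$" means functions $r_k(j):O\to\mathbb R$, $0\le k\le M$, with $r_0=0$, equal to the above $r_k(j)$ on $\mathcal E_{k-1}$ for $1\le k\le M$, and with $|r_{k+1}(j)-r_k(j)|^{O}\le K\delta_k$ for all $j$ and all $k<M$. **Lemma.** There are constants $C,\varepsilon,K>0$, depending only on $\eta,\mu,\gamma_0$, with the following property. Let $(\rho_k)_{k\ge0}$ be positive and strictly decreasing, $(\delta_k)_{k\ge0}$ positive and non-increasing, $N_k>0$, and, with $\Delta_k=\rho_k-\rho_{k+1}$, $$e^{-N_k\Delta_k}\delta_k+e^{C\Delta_k^{-\mu}}\delta_k^2\le\varepsilon\,2^{-k}\delta_{k+1}\qquad\forall k\ge0 .$$ Let $\gamma_0/2\le\gamma_+<\gamma\le2\gamma_0$, $O^+\subseteq O\subseteq\mathtt D_\gamma$, $m\ge0$. Let $\mathcal L_0$ be as above on $O$ with $\mathcal P_0=\sum_{i=0}^m\mathcal P_0^{(i)}$ and $$|\lambda_3-1|^O,\ |\lambda_1|^O\le\delta_0,\qquad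 \|\mathcal P_0^{(i)}\|_{\rho_i}^O\le\delta_i\quad(0\le i\le m),$$ and let $\mathcal L_0^+=\omega\cdot\partial_\varphi+\lambda_3^+\partial_x^3+\lambda_1^+\partial_x+\mathcal P_0^+$ be such an operator on $O^+$, with $\mathcal P_0^+=\sum_{i=0}^{m+1}\mathcal P_0^{+,(i)}$ (Hamiltonian components) and $$|\lambda_1^+-\lambda_1|^{O^+},\ |\lambda_3^+-\lambda_3|^{O^+},\ \|\mathcal P_0^+-\mathcal P_0\|^{O^+}_{\rho_{m+1}}\le\delta_{m+1},$$ where the two decompositions are matched: $\|\mathcal P_0^{+,(i)}-\mathcal P_0^{(i)}\|_{\rho_i}^{O^+}\le\delta_i\delta_{m+1}$ for $0\le i\le m$ (for instance $\mathcal P_0^{+,(i)}=\mathcal P_0^{(i)}$ for $i\le m$ and $\mathcal P_0^{+,(m+1)}=\mathcal P_0^+-\mathcal P_0$). Denote by $\mathcal E_k,\mathcal P_k,\Psi_k,r_k$ the objects of the scheme for $\mathcal L_0$ with the constant $\gamma$, and by $\mathcal E_k^+,\mathcal P_k^+,\Psi_k^+,r_k^+$ those for $\mathcal L_0^+$ on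 $O^+$ with the constant $\gamma_+$, with the same $N_k$. Then for all $k=1,\dots,m+1$: $$\|\mathcal P_k^{+,(i)}-\mathcal P_k^{(i)}\|_{\rho_i}^{\mathcal E_k\cap\mathcal E_k^+}\le K\delta_{m+1}\quad(k\le i\le m+1),\qquad \|\mathcal P_k^+-\mathcal P_k\|_{\rho_{m+1}}^{\mathcal E_k\cap\mathcal E_k^+}\le K\delta_{m+1},$$ $$\|\Psi_{k-1}^+-\Psi_{k-1}\|_{\rho_k}^{\mathcal E_k\cap\mathcal E_k^+}\le K\delta_{m+1},$$ and there are extensions of the corrections $r_k$ to $O$ and $r_k^+$ to $O^+$ (with $M=m+1$) such that, for all $j\in\mathbb Z\setminus\{0\}$ and $k=1,\dots,m+1$, $$|r_k^+(j)-r_k(j)|^{O\cap O^+}\le\delta_{m+1}.$$ -/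

import Mathlib

open scoped ENNReal

noncomputable section

namespace AiryKAM

/-- Finitely supported integer vectors `ℓ = (ℓ_i)_{i ≥ 1}`, the Fourier indices on the
infinite-dimensional torus. -/
abbrev Idx := ℕ+ →₀ ℤ

/-- Nonzero space frequencies. -/
abbrev Mode := {j : ℤ // j ≠ 0}

/-- Frequency vectors `ω = (ω_i)_{i ≥ 1}`. -/
abbrev Freq := ℕ+ → ℝ

/-- `φ`-dependent linear operators acting on zero-average functions of `x`, through their
Fourier matrix coefficients: `T ℓ j j'` is the entry `T_j^{j'}(ℓ)` (row `j`, column `j'`). -/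
abbrev TOp := Idx → Mode → Mode → ℂ

/-- `|ℓ|_η = ∑ i^η |ℓ_i|`. -/
def wt (η : ℝ) (ℓ : Idx) : ℝ := ℓ.sum fun i n => ((i : ℕ) : ℝ) ^ η * |(n : ℝ)|

/-- `𝚍(ℓ) = ∏ (1 + |ℓ_i|^5 i^5)`. -/
def dd (ℓ : Idx) : ℝ := ℓ.prod fun i n => 1 + |(n : ℝ)| ^ 5 * ((i : ℕ) : ℝ) ^ 5

/-- `ω · ℓ`. -/
def dot (ω : Freq) (ℓ : Idx) : ℝ := ℓ.sum fun i n => ω i * (n : ℝ)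

/-- The Diophantine frequencies `𝙳_γ ⊆ [1,2]^ℕ`. -/
def Dioph (γ : ℝ) : Set Freq :=
  {ω | (∀ i, ω i ∈ Set.Icc (1 : ℝ) 2) ∧
    ∀ ℓ : Idx, ℓ ≠ 0 →
      γ * ℓ.prod (fun i n => 1 / (1 + |(n : ℝ)| ^ 2 * ((i : ℕ) : ℝ) ^ 2)) < |dot ω ℓ|}

/-! ### Norms -/

/-- The decay norm of a matrix: `sup_{j'} ∑_j e^{σ|j-j'|} |R_j^{j'}|`. -/
def matNorm (σ : ℝ) (R : Mode → Mode → ℂ) : ℝ≥0∞ :=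
  ⨆ j' : Mode, ∑' j : Mode,
    ENNReal.ofReal (Real.exp (σ * |((j : ℤ) : ℝ) - ((j' : ℤ) : ℝ)|)) * ‖R j j'‖ₑ

/-- `‖T‖_σ = ∑_ℓ e^{σ|ℓ|_η} ‖T(ℓ)‖`; an operator belongs to the analytic class of width `σ`
iff this is finite. -/
def opNorm (η σ : ℝ) (T : TOp) : ℝ≥0∞ :=
  ∑' ℓ : Idx, ENNReal.ofReal (Real.exp (σ * wt η ℓ)) * matNorm σ (T ℓ)

/-- The distance `|ω₁ - ω₂|_∞`. -/
def supDist (ω₁ ω₂ : Freq) : ℝ≥0∞ := ⨆ i, ‖ω₁ i - ω₂ i‖ₑ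

/-- The weighted Lipschitz norm `|f|^Ω = |f|^sup + γ |f|^lip` of a function `f` on `Ω` with values
in a space with norm `nrm`. -/
def lipNorm {Y : Type} [Sub Y] (γ : ℝ) (Ω : Set Freq) (nrm : Y → ℝ≥0∞) (f : Freq → Y) : ℝ≥0∞ :=
  (⨆ ω ∈ Ω, nrm (f ω)) +
    ENNReal.ofReal γ *
      ⨆ ω₁ ∈ Ω, ⨆ ω₂ ∈ Ω, ⨆ (_ : ω₁ ≠ ω₂), nrm (f ω₁ - f ω₂) / supDist ω₁ ω₂

/-- `|f|^Ω` for real-valued `f`. -/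
def scalarLip (γ : ℝ) (Ω : Set Freq) (f : Freq → ℝ) : ℝ≥0∞ :=
  lipNorm γ Ω (fun x : ℝ => ‖x‖ₑ) f

/-- `‖T‖_σ^Ω` for operator-valued `T`. -/
def opLip (η γ σ : ℝ) (Ω : Set Freq) (T : Freq → TOp) : ℝ≥0∞ :=
  lipNorm γ Ω (opNorm η σ) T

/-! ### Algebra of operators -/

/-- Composition of operators. -/
def opMul (R Q : TOp) : TOp := fun ℓ j j' =>
  ∑' q : Idx × Mode, R (ℓ - q.1) j q.2 * Q q.1 q.2 j'

/-- The identity operator. -/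
def opOne : TOp := fun ℓ j j' => if ℓ = 0 ∧ j = j' then 1 else 0

/-- Powers of an operator. -/
def opPow (A : TOp) : ℕ → TOp
  | 0 => opOne
  | p + 1 => opMul (opPow A p) A

/-- `exp A = ∑_p A^p / p!`. -/
def opExp (A : TOp) : TOp := fun ℓ j j' => ∑' p : ℕ, opPow A p ℓ j j' / (p.factorial : ℂ)

/-- `Ad_A(B) = [B, A] = B A - A B`. -/
def opAd (A B : TOp) : TOp := opMul B A - opMul A B

/-- The conjugated operator `e^{-A} B e^{A}`. -/
def opConj (A B : TOp) : TOp := opMul (opExp (-A)) (opMul B (opExp A))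

/-- The projector `Π_N` on the Fourier indices `|ℓ|_η ≤ N`. -/
def proj (η N : ℝ) (T : TOp) : TOp := fun ℓ j j' =>
  open Classical in if wt η ℓ ≤ N then T ℓ j j' else 0

/-- The `φ`-independent diagonal operator `diag_j T_j^j(0)`. -/
def diagMean (T : TOp) : TOp := fun ℓ j j' => if ℓ = 0 ∧ j = j' then T 0 j j else 0

/-- The mode `-j`. -/
def Mode.neg (j : Mode) : Mode := ⟨-j.1, neg_ne_zero.mpr j.2⟩

/-- Linear Hamiltonian operators `T(φ) = ∂_x A(φ)`, with `A(φ)` symmetric and real (it maps real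
functions to real functions). On coefficients, `A_j^{j'}(ℓ) = T_j^{j'}(ℓ) / (i j)`; the first
condition is reality, the second one is `A_j^{j'}(ℓ) = conj (A_{j'}^j(-ℓ))`. -/
def IsHamiltonian (T : TOp) : Prop :=
  (∀ ℓ j j', T (-ℓ) j.neg j'.neg = starRingEnd ℂ (T ℓ j j')) ∧
  (∀ ℓ (j j' : Mode),
    ((j' : ℤ) : ℂ) * T ℓ j j' = -((j : ℤ) : ℂ) * starRingEnd ℂ (T (-ℓ) j' j))

/-! ### The operators and the reducibility scheme -/

/-- The data of an operator `ω·∂_φ + λ₃ ∂_x^3 + λ₁ ∂_x + P`, depending on `ω`, whose bounded part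
is given as a sum `P = ∑_{i=0}^m P^{(i)}`. -/
structure AiryOp (m : ℕ) where
  lam1 : Freq → ℝ
  lam3 : Freq → ℝ
  comp : Fin (m + 1) → Freq → TOp

/-- The unperturbed eigenvalues `Ω₀(j) = -λ₃ j³ + λ₁ j`. -/
def AiryOp.Om0 {m : ℕ} (L : AiryOp m) (ω : Freq) (j : Mode) : ℝ :=
  -L.lam3 ω * ((j : ℤ) : ℝ) ^ 3 + L.lam1 ω * ((j : ℤ) : ℝ)

/-- The components of the bounded part, continued by zero for `i > m`. -/
def AiryOp.comp0 {m : ℕ} (L : AiryOp m) (ω : Freq) (i : ℕ) : TOp :=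
  if h : i < m + 1 then L.comp ⟨i, h⟩ ω else 0

/-- The bounded part `P = ∑_{i=0}^m P^{(i)}`. -/
def AiryOp.total {m : ℕ} (L : AiryOp m) (ω : Freq) : TOp := ∑ i, L.comp i ω

/-- The solution `Ψ` of the homological equation
`ω·∂_φ Ψ + [i diag Ω(j), Ψ] + Π_N P = diag_j P_j^j(0)`, normalised to vanish at
`(ℓ, j, j') = (0, j, j)` and for `|ℓ|_η > N`. -/
def homSol (η N : ℝ) (ω : Freq) (Om : Mode → ℝ) (P : TOp) : TOp := fun ℓ j j' =>
  open Classical in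
  if (ℓ = 0 ∧ j = j') ∨ N < wt η ℓ then 0
  else -P ℓ j j' / (Complex.I * ((dot ω ℓ + Om j - Om j' : ℝ) : ℂ))

/-- The part of the new remainder produced by the component `P` that the generator `Ψ` removes:
`Π_N^⊥ P + ∑_{p ≥ 2} Ad_Ψ^{p-1}(Z - Π_N P) / p! + ∑_{p ≥ 1} Ad_Ψ^p(P) / p!`, where
`Z = diag_j P_j^j(0)`. -/
def newRemainder (η N : ℝ) (Ψ P : TOp) : TOp := fun ℓ j j' =>
  (P - proj η N P) ℓ j j'
    + ∑' p : ℕ, ((opAd Ψ)^[p + 1] (diagMean P - proj η N P)) ℓ j j' / ((p + 2).factorial : ℂ)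
    + ∑' p : ℕ, ((opAd Ψ)^[p + 1] P) ℓ j j' / ((p + 1).factorial : ℂ)

/-- The reducibility scheme at a fixed `ω`, started from the eigenvalues `Om0` and from the
components `P0 i` of the bounded part. The state after `k` steps consists of the eigenvalue
corrections `r_k(j)` (so `Ω_k = Ω₀ + r_k`) and of the components `P_k^{(i)}` of the remainder
(zero for `i < k`). The `k`-th step conjugates by `exp Ψ_k`, where `Ψ_k` solves the homological
equation for `P_k^{(k)}`; it sets `i (r_{k+1} - r_k)(j) = (P_k^{(k)})_j^j(0)` (this entry is purely
imaginary for Hamiltonian operators). -/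
def scheme (η : ℝ) (N : ℕ → ℝ) (ω : Freq) (Om0 : Mode → ℝ) (P0 : ℕ → TOp) :
    ℕ → (Mode → ℝ) × (ℕ → TOp)
  | 0 => (0, P0)
  | k + 1 =>
    let s := scheme η N ω Om0 P0 k
    let Ψ := homSol η (N k) ω (Om0 + s.1) (s.2 k)
    (fun j => s.1 j + (s.2 k 0 j j).im,
     fun i =>
      if i = k + 1 then newRemainder η (N k) Ψ (s.2 k) + opConj Ψ (s.2 (k + 1))
      else if k + 1 < i then opConj Ψ (s.2 i)
      else 0)

variable {m : ℕ}

/-- `r_k(j)` at `ω`, as computed by the scheme (meaningful for `ω ∈ E_{k-1}`). -/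
def AiryOp.r (L : AiryOp m) (η : ℝ) (N : ℕ → ℝ) (k : ℕ) (ω : Freq) : Mode → ℝ :=
  (scheme η N ω (L.Om0 ω) (L.comp0 ω) k).1

/-- `P_k^{(i)}` at `ω` (meaningful for `ω ∈ E_k`). -/
def AiryOp.P (L : AiryOp m) (η : ℝ) (N : ℕ → ℝ) (k i : ℕ) (ω : Freq) : TOp :=
  (scheme η N ω (L.Om0 ω) (L.comp0 ω) k).2 i

/-- The eigenvalues `Ω_k(j) = Ω₀(j) + r_k(j)`. -/
def AiryOp.Om (L : AiryOp m) (η : ℝ) (N : ℕ → ℝ) (k : ℕ) (ω : Freq) : Mode → ℝ :=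
  L.Om0 ω + L.r η N k ω

/-- The generator `Ψ_k` at `ω` (meaningful for `ω ∈ E_{k+1}`). -/
def AiryOp.Psi (L : AiryOp m) (η : ℝ) (N : ℕ → ℝ) (k : ℕ) (ω : Freq) : TOp :=
  homSol η (N k) ω (L.Om η N k ω) (L.P η N k k ω)

/-- The remainder `P_k = ∑_{i=k}^{M} P_k^{(i)}`, where `M` is at least the index of the last
nonzero component. -/
def AiryOp.remainder (L : AiryOp m) (η : ℝ) (N : ℕ → ℝ) (M k : ℕ) (ω : Freq) : TOp :=
  ∑ i ∈ Finset.Icc k M, L.P η N k i ω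

/-- The Cantor sets `E_k`, with `E_0 = O`. -/
def AiryOp.E (L : AiryOp m) (η γ : ℝ) (N : ℕ → ℝ) (O : Set Freq) : ℕ → Set Freq
  | 0 => O
  | k + 1 => {ω ∈ L.E η γ N O k |
      ∀ (ℓ : Idx) (j j' : Mode), ¬ (ℓ = 0 ∧ j = j') → wt η ℓ ≤ N k →
        γ * |((j : ℤ) : ℝ) ^ 3 - ((j' : ℤ) : ℝ) ^ 3| / dd ℓ
          ≤ |dot ω ℓ + L.Om η N k ω j - L.Om η N k ω j'|}

/-- `R k j` (`k ≤ M`) are eigenvalue corrections of `L` defined on the whole of `O`: `R 0 = 0`, for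
`k ≥ 1` the function `R k j` is a Lipschitz extension to `O` of `r_k(j)`, which the scheme
determines on `E_{k-1}`, and the increments satisfy `|R_{k+1}(j) - R_k(j)|^O ≤ K δ_k`. Here `γ` is
the constant of the sets `E_k` and `w` is the weight of the Lipschitz norm. -/
def AiryOp.IsCorrection (L : AiryOp m) (η γ w : ℝ) (N : ℕ → ℝ) (O : Set Freq) (K : ℝ)
    (δ : ℕ → ℝ) (M : ℕ) (R : ℕ → Mode → Freq → ℝ) : Prop :=
  (∀ j, ∀ ω ∈ O, R 0 j ω = 0) ∧
  (∀ k < M, ∀ j, ∀ ω ∈ L.E η γ N O k, R (k + 1) j ω = L.r η N (k + 1) ω j) ∧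
  (∀ k < M, ∀ j,
    scalarLip w O (fun ω => R (k + 1) j ω - R k j ω) ≤ ENNReal.ofReal (K * δ k))

/-- The conditions on the analyticity widths `ρ_k`, the sizes `δ_k` and the truncations `N_k`,
with `Δ_k = ρ_k - ρ_{k+1}`:
`e^{-N_k Δ_k} δ_k + e^{C Δ_k^{-μ}} δ_k² ≤ ε 2^{-k} δ_{k+1}`. -/
structure Scales (μ C ε : ℝ) (ρ δ N : ℕ → ℝ) : Prop where
  rho_pos : ∀ k, 0 < ρ k
  rho_anti : StrictAnti ρ
  delta_pos : ∀ k, 0 < δ k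
  delta_anti : Antitone δ
  N_pos : ∀ k, 0 < N k
  small : ∀ k,
    Real.exp (-(N k * (ρ k - ρ (k + 1)))) * δ k
      + Real.exp (C * (ρ k - ρ (k + 1)) ^ (-μ)) * δ k ^ 2 ≤ ε * (1 / 2) ^ k * δ (k + 1)

/-- The assumptions on the unperturbed operator: it is Hamiltonian, `|λ₃ - 1|^O, |λ₁|^O ≤ δ₀` and
`‖P^{(i)}‖_{ρ_i}^O ≤ δ_i`. -/
structure AiryOp.Small (L : AiryOp m) (η γ : ℝ) (O : Set Freq) (ρ δ : ℕ → ℝ) : Prop where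
  ham : ∀ i, ∀ ω ∈ O, IsHamiltonian (L.comp i ω)
  lam3 : scalarLip γ O (fun ω => L.lam3 ω - 1) ≤ ENNReal.ofReal (δ 0)
  lam1 : scalarLip γ O L.lam1 ≤ ENNReal.ofReal (δ 0)
  comp : ∀ i : Fin (m + 1), opLip η γ (ρ i) O (L.comp i) ≤ ENNReal.ofReal (δ i)

/-- `L'` is a variation of `L` of size `δ_{m+1}` on `O'`, with one more component:
`|λ₁' - λ₁|`, `|λ₃' - λ₃|`, `‖P' - P‖_{ρ_{m+1}}` are at most `δ_{m+1}`, and the components with the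
same index `i ≤ m` match up to `δ_i δ_{m+1}` (this is trivially so when they are equal and the last
component of `P'` is `P' - P`). -/
structure AiryOp.IsVariation (L : AiryOp m) (L' : AiryOp (m + 1)) (η γ : ℝ) (O' : Set Freq)
    (ρ δ : ℕ → ℝ) : Prop where
  ham : ∀ i, ∀ ω ∈ O', IsHamiltonian (L'.comp i ω)
  lam1 : scalarLip γ O' (fun ω => L'.lam1 ω - L.lam1 ω) ≤ ENNReal.ofReal (δ (m + 1))
  lam3 : scalarLip γ O' (fun ω => L'.lam3 ω - L.lam3 ω) ≤ ENNReal.ofReal (δ (m + 1))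
  total : opLip η γ (ρ (m + 1)) O' (fun ω => L'.total ω - L.total ω)
    ≤ ENNReal.ofReal (δ (m + 1))
  comp : ∀ i : Fin (m + 1), opLip η γ (ρ i) O' (fun ω => L'.comp i.castSucc ω - L.comp i ω)
    ≤ ENNReal.ofReal (δ i * δ (m + 1))

end AiryKAM

end

/-!
The small divisors of the two schemes are under control only on the Cantor sets `E_k` and `E_k⁺`,
which need not be related to one another, whereas the eigenvalue corrections have to be extended to
the whole parameter sets in such a way that the extensions stay close. The reciprocals `1/x` of the
small divisors are therefore replaced by a function `cutInv a x` of class `C^{1,1}` that equals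
`1/x` for `|x| ≥ a`, where the threshold `a` (`divThreshold`) lies below the divisors met on the
Cantor sets. The resulting scheme `AiryOp.cut` is defined for all frequencies, agrees with the given
one on the Cantor sets (`cut_eq_scheme`, `cutGen_eq_Psi`), and its eigenvalue corrections are the
extensions (`isCorrection_cut`). All estimates are proved for it on the whole of `O` or `O⁺`.

Sizes, Lipschitz variations in `ω` and differences of the two schemes are treated at the same time.
For a family `f` put `famNorm f = sup |f x| + w · sup |f x - f y| / d(x, y)`. By the Leibniz rule
this norm is again submultiplicative. It gives the weighted Lipschitz norm when `x` is the
frequency, and, over a two-point index set with `d = δ_{m+1}`, it gives a norm on pairs of operators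
that measures both members and their difference divided by `δ_{m+1}` (`pairScale`). The properties
that the iteration needs are collected in the structure `OpScale`, which is stable under this
construction (`OpScale.fam`). One induction, `OpScale.multScheme_bounds`, carried out in an
arbitrary `OpScale`, then yields all the bounds: the components of index `i ≤ m` have pair norm
`O(δ_i)`, so that their differences are `O(δ_i δ_{m+1})`; these add up to less than `δ_{m+1}`
because `δ_k ≤ ε 2^{-k}`. The component of index `m + 1` has pair norm `O(1)`.

The induction is fed by a bound on the solution of the homological equation
(`pairScale_mlt_cutMult_le`). It combines the second-difference estimate for `cutInv`, where the
factor `|j³ - j'³|` in the threshold compensates the growth of the eigenvalues, with the estimate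
`e^{-Δ|ℓ|_η} 𝚍(ℓ)^4 ≤ e^{C Δ^{-μ}}` (`exists_dd_pow_le`).
-/

noncomputable section

namespace AiryKAM

/-! ### The weighted operator norm -/

/-- The Fourier weight `e^{σ|ℓ|_η}`. -/
def expWt (η σ : ℝ) (ℓ : Idx) : ℝ≥0∞ := ENNReal.ofReal (Real.exp (σ * wt η ℓ))

/-- The off-diagonal weight `e^{σ|j-j'|}`. -/
def expDist (σ : ℝ) (j j' : Mode) : ℝ≥0∞ :=
  ENNReal.ofReal (Real.exp (σ * |((j : ℤ) : ℝ) - ((j' : ℤ) : ℝ)|))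

/-- The operator norm as a functional of the moduli of the coefficients. -/
def modNorm (η σ : ℝ) (a : Idx → Mode → Mode → ℝ≥0∞) : ℝ≥0∞ :=
  ∑' ℓ, expWt η σ ℓ * ⨆ j', ∑' j, expDist σ j j' * a ℓ j j'

lemma opNorm_eq_modNorm (η σ : ℝ) (T : TOp) :
    opNorm η σ T = modNorm η σ fun ℓ j j' => ‖T ℓ j j'‖ₑ := rfl

lemma modNorm_mono {η σ : ℝ} {a b : Idx → Mode → Mode → ℝ≥0∞}
    (h : ∀ ℓ j j', a ℓ j j' ≤ b ℓ j j') : modNorm η σ a ≤ modNorm η σ b := by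
  refine ENNReal.tsum_le_tsum fun ℓ => ?_
  gcongr with j' j
  exact h ℓ j j'

lemma wt_nonneg (η : ℝ) (ℓ : Idx) : 0 ≤ wt η ℓ :=
  Finset.sum_nonneg fun _ _ => by positivity

lemma wt_zero (η : ℝ) : wt η 0 = 0 := by simp [wt]

lemma wt_le_add (η : ℝ) (ℓ q : Idx) : wt η ℓ ≤ wt η (ℓ - q) + wt η q := by
  classical
  let S := ℓ.support ∪ q.support ∪ (ℓ - q).support
  have key : ∀ a : Idx, a.support ⊆ S →
      wt η a = ∑ i ∈ S, ((i : ℕ) : ℝ) ^ η * |((a i : ℤ) : ℝ)| := fun a ha =>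
    Finsupp.sum_of_support_subset a ha _ (by simp)
  rw [key ℓ (by intro x; simp only [S, Finset.mem_union]; tauto),
    key q (by intro x; simp only [S, Finset.mem_union]; tauto),
    key (ℓ - q) (by intro x; simp only [S, Finset.mem_union]; tauto), ← Finset.sum_add_distrib]
  refine Finset.sum_le_sum fun i _ => ?_
  rw [← mul_add]
  refine mul_le_mul_of_nonneg_left ?_ (by positivity)
  have := abs_add_le (((ℓ - q) i : ℤ) : ℝ) ((q i : ℤ) : ℝ)
  simpa using this

lemma one_le_expWt {η σ : ℝ} (hσ : 0 ≤ σ) (ℓ : Idx) : 1 ≤ expWt η σ ℓ := by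
  rw [expWt, ENNReal.one_le_ofReal, Real.one_le_exp_iff]
  exact mul_nonneg hσ (wt_nonneg η ℓ)

lemma one_le_expDist {σ : ℝ} (hσ : 0 ≤ σ) (j j' : Mode) : 1 ≤ expDist σ j j' := by
  rw [expDist, ENNReal.one_le_ofReal, Real.one_le_exp_iff]
  positivity

lemma expWt_le_mul {η σ : ℝ} (hσ : 0 ≤ σ) (ℓ q : Idx) :
    expWt η σ ℓ ≤ expWt η σ (ℓ - q) * expWt η σ q := by
  rw [expWt, expWt, expWt, ← ENNReal.ofReal_mul (Real.exp_pos _).le, ← Real.exp_add, ← mul_add]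
  gcongr
  exact wt_le_add η ℓ q

lemma expDist_le_mul {σ : ℝ} (hσ : 0 ≤ σ) (j k j' : Mode) :
    expDist σ j j' ≤ expDist σ j k * expDist σ k j' := by
  rw [expDist, expDist, expDist, ← ENNReal.ofReal_mul (Real.exp_pos _).le, ← Real.exp_add,
    ← mul_add]
  gcongr
  exact abs_sub_le _ _ _

lemma le_modNorm {η σ : ℝ} (hσ : 0 ≤ σ) (a : Idx → Mode → Mode → ℝ≥0∞) (ℓ : Idx) (j j' : Mode) :
    a ℓ j j' ≤ modNorm η σ a :=
  calc a ℓ j j' ≤ expDist σ j j' * a ℓ j j' := le_mul_of_one_le_left' (one_le_expDist hσ _ _)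
    _ ≤ ∑' j, expDist σ j j' * a ℓ j j' :=
      ENNReal.le_tsum (f := fun j => expDist σ j j' * a ℓ j j') j
    _ ≤ ⨆ j', ∑' j, expDist σ j j' * a ℓ j j' :=
      le_iSup (fun j' => ∑' j, expDist σ j j' * a ℓ j j') j'
    _ ≤ expWt η σ ℓ * ⨆ j', ∑' j, expDist σ j j' * a ℓ j j' :=
      le_mul_of_one_le_left' (one_le_expWt hσ _)
    _ ≤ _ := ENNReal.le_tsum (f := fun ℓ => expWt η σ ℓ * ⨆ j', ∑' j, expDist σ j j' * a ℓ j j') ℓ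

/-- The composition of the moduli of the coefficients. -/
def modMul (a b : Idx → Mode → Mode → ℝ≥0∞) : Idx → Mode → Mode → ℝ≥0∞ := fun ℓ j j' =>
  ∑' q : Idx × Mode, a (ℓ - q.1) j q.2 * b q.1 q.2 j'

lemma modNorm_modMul {η σ : ℝ} (hσ : 0 ≤ σ) (a b : Idx → Mode → Mode → ℝ≥0∞) :
    modNorm η σ (modMul a b) ≤ modNorm η σ a * modNorm η σ b := by
  set A : Idx → ℝ≥0∞ := fun ℓ => ⨆ j', ∑' j, expDist σ j j' * a ℓ j j' with hA
  set B : Idx → ℝ≥0∞ := fun ℓ => ⨆ j', ∑' j, expDist σ j j' * b ℓ j j' with hB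
  -- the decay norm of matrices is submultiplicative
  have mat : ∀ ℓ j', ∑' j, expDist σ j j' * modMul a b ℓ j j' ≤ ∑' q, A (ℓ - q) * B q := by
    intro ℓ j'
    calc ∑' j, expDist σ j j' * modMul a b ℓ j j'
        = ∑' j, ∑' q, ∑' k, expDist σ j j' * (a (ℓ - q) j k * b q k j') := by
          simp only [modMul, ENNReal.tsum_prod', ← ENNReal.tsum_mul_left]
      _ ≤ ∑' j, ∑' q, ∑' k, (expDist σ j k * a (ℓ - q) j k) * (expDist σ k j' * b q k j') := by
          refine ENNReal.tsum_le_tsum fun j => ENNReal.tsum_le_tsum fun q =>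
            ENNReal.tsum_le_tsum fun k => ?_
          rw [mul_mul_mul_comm]
          gcongr
          exact expDist_le_mul hσ j k j'
      _ = ∑' q, ∑' k, (∑' j, expDist σ j k * a (ℓ - q) j k) * (expDist σ k j' * b q k j') := by
          rw [ENNReal.tsum_comm]
          refine tsum_congr fun q => ?_
          rw [ENNReal.tsum_comm]
          simp only [ENNReal.tsum_mul_right]
      _ ≤ ∑' q, ∑' k, A (ℓ - q) * (expDist σ k j' * b q k j') := by
          refine ENNReal.tsum_le_tsum fun q => ENNReal.tsum_le_tsum fun k => ?_
          gcongr
          exact le_iSup (fun k => ∑' j, expDist σ j k * a (ℓ - q) j k) k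
      _ ≤ ∑' q, A (ℓ - q) * B q := by
          refine ENNReal.tsum_le_tsum fun q => ?_
          rw [ENNReal.tsum_mul_left]
          gcongr
          exact le_iSup (fun j' => ∑' k, expDist σ k j' * b q k j') j'
  calc modNorm η σ (modMul a b) ≤ ∑' ℓ, expWt η σ ℓ * ∑' q, A (ℓ - q) * B q := by
        refine ENNReal.tsum_le_tsum fun ℓ => ?_
        gcongr
        exact iSup_le fun j' => mat ℓ j'
    _ ≤ ∑' ℓ, ∑' q, (expWt η σ (ℓ - q) * A (ℓ - q)) * (expWt η σ q * B q) := by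
        refine ENNReal.tsum_le_tsum fun ℓ => ?_
        rw [← ENNReal.tsum_mul_left]
        refine ENNReal.tsum_le_tsum fun q => ?_
        rw [mul_mul_mul_comm]
        gcongr
        exact expWt_le_mul hσ ℓ q
    _ = ∑' q, ∑' ℓ, (expWt η σ (ℓ - q) * A (ℓ - q)) * (expWt η σ q * B q) := ENNReal.tsum_comm
    _ = ∑' q, modNorm η σ a * (expWt η σ q * B q) := by
        refine tsum_congr fun q => ?_
        rw [ENNReal.tsum_mul_right]
        congr 1
        exact (Equiv.subRight q).tsum_eq fun ℓ => expWt η σ ℓ * A ℓ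
    _ = modNorm η σ a * modNorm η σ b := ENNReal.tsum_mul_left

lemma enorm_le_opNorm {η σ : ℝ} (hσ : 0 ≤ σ) (T : TOp) (ℓ : Idx) (j j' : Mode) :
    ‖T ℓ j j'‖ₑ ≤ opNorm η σ T :=
  le_modNorm hσ (fun ℓ j j' => ‖T ℓ j j'‖ₑ) ℓ j j'

lemma opNorm_zero (η σ : ℝ) : opNorm η σ 0 = 0 := by
  simp [opNorm_eq_modNorm, modNorm]

lemma opNorm_neg (η σ : ℝ) (T : TOp) : opNorm η σ (-T) = opNorm η σ T := by
  simp [opNorm_eq_modNorm, modNorm]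

/-- Subadditivity of the operator norm for infinite sums of the coefficients. -/
lemma opNorm_tsum_le {ι : Type*} (η σ : ℝ) (T : ι → TOp) :
    opNorm η σ (fun ℓ j j' => ∑' p, T p ℓ j j') ≤ ∑' p, opNorm η σ (T p) := by
  calc opNorm η σ (fun ℓ j j' => ∑' p, T p ℓ j j')
      ≤ modNorm η σ (fun ℓ j j' => ∑' p, ‖T p ℓ j j'‖ₑ) :=
        modNorm_mono fun ℓ j j' => enorm_tsum_le_tsum_enorm
    _ ≤ ∑' ℓ, expWt η σ ℓ * ∑' p, ⨆ j', ∑' j, expDist σ j j' * ‖T p ℓ j j'‖ₑ := by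
        refine ENNReal.tsum_le_tsum fun ℓ => ?_
        gcongr
        refine iSup_le fun j' => ?_
        simp only [← ENNReal.tsum_mul_left]
        rw [ENNReal.tsum_comm]
        refine ENNReal.tsum_le_tsum fun p => ?_
        exact le_iSup (fun j' => ∑' j, expDist σ j j' * ‖T p ℓ j j'‖ₑ) j'
    _ = ∑' p, opNorm η σ (T p) := by
        simp only [← ENNReal.tsum_mul_left]
        rw [ENNReal.tsum_comm]
        rfl

lemma opNorm_add_le (η σ : ℝ) (S T : TOp) : opNorm η σ (S + T) ≤ opNorm η σ S + opNorm η σ T := by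
  have h := opNorm_tsum_le η σ (fun b : Bool => bif b then S else T)
  simp only [tsum_bool, cond_true, cond_false] at h
  rw [add_comm S, add_comm (opNorm η σ S)]
  exact h

lemma opNorm_opMul_le {η σ : ℝ} (hσ : 0 ≤ σ) (R Q : TOp) :
    opNorm η σ (opMul R Q) ≤ opNorm η σ R * opNorm η σ Q := by
  refine le_trans (modNorm_mono fun ℓ j j' => ?_)
    (modNorm_modMul hσ (fun ℓ j j' => ‖R ℓ j j'‖ₑ) fun ℓ j j' => ‖Q ℓ j j'‖ₑ)
  refine enorm_tsum_le_tsum_enorm.trans (le_of_eq ?_)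
  simp only [modMul, enorm_mul]

lemma opMul_summable {η σ : ℝ} (hσ : 0 ≤ σ) {R Q : TOp} (hR : opNorm η σ R ≠ ⊤)
    (hQ : opNorm η σ Q ≠ ⊤) (ℓ : Idx) (j j' : Mode) :
    Summable fun q : Idx × Mode => R (ℓ - q.1) j q.2 * Q q.1 q.2 j' := by
  refine Summable.of_enorm (ne_top_of_le_ne_top (ENNReal.mul_ne_top hR hQ) ?_)
  simp only [enorm_mul]
  exact (le_modNorm hσ _ ℓ j j').trans
    (modNorm_modMul hσ (fun ℓ j j' => ‖R ℓ j j'‖ₑ) fun ℓ j j' => ‖Q ℓ j j'‖ₑ)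

lemma opMul_sub_left {η σ : ℝ} (hσ : 0 ≤ σ) {R R' Q : TOp} (hR : opNorm η σ R ≠ ⊤)
    (hR' : opNorm η σ R' ≠ ⊤) (hQ : opNorm η σ Q ≠ ⊤) :
    opMul (R - R') Q = opMul R Q - opMul R' Q := by
  funext ℓ j j'
  have := (opMul_summable hσ hR hQ ℓ j j').tsum_sub (opMul_summable hσ hR' hQ ℓ j j')
  simpa [opMul, sub_mul] using this

lemma opMul_sub_right {η σ : ℝ} (hσ : 0 ≤ σ) {R Q Q' : TOp} (hR : opNorm η σ R ≠ ⊤)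
    (hQ : opNorm η σ Q ≠ ⊤) (hQ' : opNorm η σ Q' ≠ ⊤) :
    opMul R (Q - Q') = opMul R Q - opMul R Q' := by
  funext ℓ j j'
  have := (opMul_summable hσ hR hQ ℓ j j').tsum_sub (opMul_summable hσ hR hQ' ℓ j j')
  simpa [opMul, mul_sub] using this

lemma opNorm_opOne_le (η σ : ℝ) : opNorm η σ opOne ≤ 1 := by
  have h : ∀ (ℓ : Idx) (j' : Mode), ∑' j, expDist σ j j' * ‖opOne ℓ j j'‖ₑ
      = if ℓ = 0 then 1 else 0 := by
    intro ℓ j'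
    rw [tsum_eq_single j' (fun j hj => by simp [opOne, hj])]
    by_cases hl : ℓ = 0 <;> simp [opOne, hl, expDist]
  rw [opNorm_eq_modNorm, modNorm, tsum_eq_single 0 (fun ℓ hl => by simp [h, hl])]
  simp only [h]
  simp [expWt, wt_zero]

/-- The norm of a Fourier multiplier acting coefficientwise with a loss `Δ` of analyticity:
`sup e^{-Δ|ℓ|_η} |g_j^{j'}(ℓ)|`. -/
def multNorm (η Δ : ℝ) (g : TOp) : ℝ≥0∞ := ⨆ ℓ, ⨆ j, ⨆ j', expWt η (-Δ) ℓ * ‖g ℓ j j'‖ₑ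

lemma multNorm_le_iff {η Δ : ℝ} {g : TOp} {b : ℝ≥0∞} :
    multNorm η Δ g ≤ b ↔ ∀ ℓ j j', expWt η (-Δ) ℓ * ‖g ℓ j j'‖ₑ ≤ b := by
  simp [multNorm]

lemma le_multNorm (η Δ : ℝ) (g : TOp) (ℓ : Idx) (j j' : Mode) :
    expWt η (-Δ) ℓ * ‖g ℓ j j'‖ₑ ≤ multNorm η Δ g :=
  multNorm_le_iff.1 le_rfl ℓ j j'

lemma opNorm_mul_le {η σ Δ : ℝ} (hΔ : 0 ≤ Δ) (g T : TOp) :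
    opNorm η σ (g * T) ≤ multNorm η Δ g * opNorm η (σ + Δ) T := by
  rw [opNorm_eq_modNorm, opNorm_eq_modNorm, modNorm, modNorm, ← ENNReal.tsum_mul_left]
  refine ENNReal.tsum_le_tsum fun ℓ => ?_
  have hw : expWt η σ ℓ = expWt η (-Δ) ℓ * expWt η (σ + Δ) ℓ := by
    rw [expWt, expWt, expWt, ← ENNReal.ofReal_mul (Real.exp_pos _).le, ← Real.exp_add]
    ring_nf
  rw [hw, mul_comm (expWt η (-Δ) ℓ), mul_assoc, mul_left_comm (multNorm η Δ g)]
  refine mul_le_mul' le_rfl ?_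
  rw [ENNReal.mul_iSup, ENNReal.mul_iSup]
  refine iSup_mono fun j' => ?_
  rw [← ENNReal.tsum_mul_left, ← ENNReal.tsum_mul_left]
  refine ENNReal.tsum_le_tsum fun j => ?_
  have hd : expDist σ j j' ≤ expDist (σ + Δ) j j' := by
    rw [expDist, expDist]
    gcongr
    linarith
  calc expWt η (-Δ) ℓ * (expDist σ j j' * ‖(g * T) ℓ j j'‖ₑ)
      = (expWt η (-Δ) ℓ * ‖g ℓ j j'‖ₑ) * (expDist σ j j' * ‖T ℓ j j'‖ₑ) := by
        rw [Pi.mul_apply, Pi.mul_apply, Pi.mul_apply, enorm_mul]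
        ring
    _ ≤ multNorm η Δ g * (expDist (σ + Δ) j j' * ‖T ℓ j j'‖ₑ) :=
        mul_le_mul' (le_multNorm η Δ g ℓ j j') (mul_le_mul' hd le_rfl)

/-! ### Norms on families of operators -/

/-- The norm `sup_x |f(x)| + w · sup_{x ≠ y} |f(x) - f(y)| / d(x, y)` of a family `f`. With the
distance of frequencies it is the weighted Lipschitz norm; with a two-point index set it measures
both values of `f` and their difference. -/
def famNorm {X Y : Type} [Sub Y] (w : ℝ≥0∞) (d : X → X → ℝ≥0∞) (n : Y → ℝ≥0∞) (f : X → Y) :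
    ℝ≥0∞ :=
  (⨆ x, n (f x)) + w * ⨆ x, ⨆ y, ⨆ (_ : x ≠ y), n (f x - f y) / d x y

section famNorm

variable {X Y Z V : Type} {w : ℝ≥0∞} {d : X → X → ℝ≥0∞}

lemma le_famNorm [Sub Y] (n : Y → ℝ≥0∞) (f : X → Y) (x : X) : n (f x) ≤ famNorm w d n f :=
  (le_iSup (fun x => n (f x)) x).trans le_self_add

lemma le_famNorm_diff [Sub Y] (n : Y → ℝ≥0∞) (f : X → Y) {x y : X} (h : x ≠ y) :
    w * (n (f x - f y) / d x y) ≤ famNorm w d n f := by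
  refine le_trans ?_ le_add_self
  gcongr
  exact le_iSup_of_le x (le_iSup_of_le y (le_iSup_of_le h le_rfl))

lemma famNorm_le [Sub Y] {n : Y → ℝ≥0∞} {f : X → Y} {a b : ℝ≥0∞} (ha : ∀ x, n (f x) ≤ a)
    (hb : ∀ x y, x ≠ y → w * (n (f x - f y) / d x y) ≤ b) : famNorm w d n f ≤ a + b := by
  refine add_le_add (iSup_le ha) ?_
  simp only [ENNReal.mul_iSup]
  exact iSup_le fun x => iSup_le fun y => iSup_le fun h => hb x y h

lemma famNorm_const [AddGroup Y] {n : Y → ℝ≥0∞} (h0 : n 0 = 0) (y : Y) :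
    famNorm w d n (fun _ : X => y) ≤ n y := by
  refine (famNorm_le (a := n y) (b := 0) (fun _ => le_rfl) fun _ _ _ => ?_).trans (by simp)
  simp [h0]

lemma famNorm_map [Sub Y] [Sub Z] {n : Y → ℝ≥0∞} {n' : Z → ℝ≥0∞} (φ : Y → Z)
    (hsub : ∀ y y', φ (y - y') = φ y - φ y') {c : ℝ≥0∞} (hφ : ∀ y, n' (φ y) ≤ c * n y)
    (f : X → Y) : famNorm w d n' (fun x => φ (f x)) ≤ c * famNorm w d n f := by
  rw [famNorm, famNorm, mul_add, mul_left_comm]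
  simp only [ENNReal.mul_iSup]
  refine add_le_add (iSup_mono fun x => hφ _) (iSup_mono fun x => iSup_mono fun y =>
    iSup_mono fun _ => ?_)
  rw [← hsub]
  exact mul_le_mul' le_rfl
    ((ENNReal.div_le_div_right (hφ _) _).trans (mul_div_assoc _ _ _).le)

lemma famNorm_add_le [AddCommGroup Y] {n : Y → ℝ≥0∞} (hn : ∀ a b, n (a + b) ≤ n a + n b)
    (f g : X → Y) : famNorm w d n (f + g) ≤ famNorm w d n f + famNorm w d n g := by
  rw [famNorm, famNorm, famNorm, add_add_add_comm, ← mul_add]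
  gcongr ?_ + w * ?_
  · exact iSup_le fun x => (hn _ _).trans
      (add_le_add (le_iSup (fun x => n (f x)) x) (le_iSup (fun x => n (g x)) x))
  · refine iSup_le fun x => iSup_le fun y => iSup_le fun h => ?_
    have e : (f + g) x - (f + g) y = (f x - f y) + (g x - g y) := by
      simp only [Pi.add_apply]; abel
    rw [e]
    refine (ENNReal.div_le_div_right (hn _ _) _).trans ?_
    rw [ENNReal.add_div]
    exact add_le_add (le_iSup_of_le x (le_iSup_of_le y (le_iSup_of_le h le_rfl)))
      (le_iSup_of_le x (le_iSup_of_le y (le_iSup_of_le h le_rfl)))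

/-- Leibniz rule: a product that is submultiplicative for the norms of the values is
submultiplicative for the norms of the families. -/
lemma famNorm_bilin_le [Sub Y] [Sub Z] [Sub V] {n₁ : Y → ℝ≥0∞} {n₂ : Z → ℝ≥0∞} {n₃ : V → ℝ≥0∞}
    (B : Y → Z → V) (f : X → Y) (g : X → Z)
    (hB : ∀ x, n₃ (B (f x) (g x)) ≤ n₁ (f x) * n₂ (g x))
    (hsub : ∀ x y, n₃ (B (f x) (g x) - B (f y) (g y))
      ≤ n₁ (f x - f y) * n₂ (g x) + n₁ (f y) * n₂ (g x - g y)) :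
    famNorm w d n₃ (fun x => B (f x) (g x)) ≤ famNorm w d n₁ f * famNorm w d n₂ g := by
  rw [famNorm, famNorm, famNorm]
  set F := ⨆ x, n₁ (f x)
  set G := ⨆ x, n₂ (g x)
  set F' := ⨆ x, ⨆ y, ⨆ (_ : x ≠ y), n₁ (f x - f y) / d x y
  set G' := ⨆ x, ⨆ y, ⨆ (_ : x ≠ y), n₂ (g x - g y) / d x y
  have hF : ∀ x, n₁ (f x) ≤ F := le_iSup (fun x => n₁ (f x))
  have hG : ∀ x, n₂ (g x) ≤ G := le_iSup (fun x => n₂ (g x))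
  calc _ ≤ F * G + w * (F' * G + F * G') := by
        gcongr ?_ + w * ?_
        · exact iSup_le fun x => (hB x).trans (mul_le_mul' (hF x) (hG x))
        · refine iSup_le fun x => iSup_le fun y => iSup_le fun h => ?_
          have h1 : n₁ (f x - f y) / d x y ≤ F' :=
            le_iSup_of_le x (le_iSup_of_le y (le_iSup_of_le h le_rfl))
          have h2 : n₂ (g x - g y) / d x y ≤ G' :=
            le_iSup_of_le x (le_iSup_of_le y (le_iSup_of_le h le_rfl))
          refine (ENNReal.div_le_div_right (hsub x y) _).trans ?_
          rw [ENNReal.add_div, mul_comm (n₁ (f x - f y)), mul_div_assoc, mul_div_assoc,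
            mul_comm F']
          exact add_le_add (mul_le_mul' (hG x) h1) (mul_le_mul' (hF y) h2)
    _ ≤ F * G + w * (F' * G + F * G') + (w * F') * (w * G') := le_self_add
    _ = (F + w * F') * (G + w * G') := by ring

end famNorm

/-- A system of norms on families of operators indexed by `I`, with the properties on which the
iteration relies: `nrm σ` is an algebra norm dominating the norms of width `σ` of the members,
`mlt Δ` controls families of Fourier multipliers that lose `Δ` of analyticity, and `scl` is the
corresponding norm of families of numbers. -/
structure OpScale (η : ℝ) (I : Type) where
  nrm : ℝ → (I → TOp) → ℝ≥0∞
  mlt : ℝ → (I → TOp) → ℝ≥0∞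
  scl : (I → ℝ) → ℝ≥0∞
  nrm_zero : ∀ σ, nrm σ 0 = 0
  nrm_neg : ∀ σ f, nrm σ (-f) ≤ nrm σ f
  nrm_add : ∀ σ f g, nrm σ (f + g) ≤ nrm σ f + nrm σ g
  nrm_one : ∀ σ, nrm σ (fun _ => opOne) ≤ 1
  opNorm_le_nrm : ∀ σ f i, opNorm η σ (f i) ≤ nrm σ f
  nrm_opMul : ∀ σ, 0 ≤ σ → ∀ f g, nrm σ f ≠ ⊤ → nrm σ g ≠ ⊤ →
    nrm σ (fun i => opMul (f i) (g i)) ≤ nrm σ f * nrm σ g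
  nrm_tsum : ∀ σ, 0 ≤ σ → ∀ f : ℕ → I → TOp, ∑' p, nrm σ (f p) ≠ ⊤ →
    nrm σ (fun i ℓ j j' => ∑' p, f p i ℓ j j') ≤ ∑' p, nrm σ (f p)
  nrm_mul : ∀ σ Δ, 0 ≤ Δ → ∀ g f, nrm σ (g * f) ≤ mlt Δ g * nrm (σ + Δ) f
  mlt_const : ∀ Δ g, mlt Δ (fun _ => g) ≤ multNorm η Δ g
  scl_zero : scl 0 = 0
  scl_add : ∀ u v, scl (u + v) ≤ scl u + scl v
  scl_smul : ∀ (c : ℝ) u, scl (fun i => c * u i) ≤ ‖c‖ₑ * scl u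
  scl_im : ∀ σ, 0 ≤ σ → ∀ f ℓ j j', scl (fun i => (f i ℓ j j').im) ≤ nrm σ f

namespace OpScale

variable {η : ℝ} {I X : Type}

/-- The norms of a single operator. -/
def point (η : ℝ) : OpScale η Unit where
  nrm σ f := opNorm η σ (f ())
  mlt Δ g := multNorm η Δ (g ())
  scl u := ‖u ()‖ₑ
  nrm_zero σ := opNorm_zero η σ
  nrm_neg σ f := (opNorm_neg η σ _).le
  nrm_add σ f g := opNorm_add_le η σ _ _
  nrm_one σ := opNorm_opOne_le η σ
  opNorm_le_nrm σ f i := le_rfl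
  nrm_opMul σ hσ f g _ _ := opNorm_opMul_le hσ _ _
  nrm_tsum σ _ f _ := opNorm_tsum_le η σ fun p => f p ()
  nrm_mul σ Δ hΔ g f := opNorm_mul_le hΔ _ _
  mlt_const Δ g := le_rfl
  scl_zero := by simp
  scl_add u v := enorm_add_le _ _
  scl_smul c u := (enorm_mul _ _).le
  scl_im σ hσ f ℓ j j' := by
    refine le_trans ?_ (enorm_le_opNorm hσ (f ()) ℓ j j')
    rw [enorm_le_iff_norm_le]
    exact Complex.abs_im_le_norm _

lemma nrm_sub_ne_top (S : OpScale η I) {σ : ℝ} {f g : I → TOp} (hf : S.nrm σ f ≠ ⊤)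
    (hg : S.nrm σ g ≠ ⊤) : S.nrm σ (f - g) ≠ ⊤ := by
  rw [sub_eq_add_neg]
  exact ne_top_of_le_ne_top (ENNReal.add_ne_top.2 ⟨hf, hg⟩)
    ((S.nrm_add _ _ _).trans (add_le_add le_rfl (S.nrm_neg _ _)))

lemma opNorm_ne_top (S : OpScale η I) {σ : ℝ} {f : I → TOp} (hf : S.nrm σ f ≠ ⊤) (i : I) :
    opNorm η σ (f i) ≠ ⊤ :=
  ne_top_of_le_ne_top hf (S.opNorm_le_nrm σ f i)

/-- Coefficientwise summability of a series of families with summable norms. -/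
lemma summable_coeff (S : OpScale η I) {σ : ℝ} (hσ : 0 ≤ σ) {f : ℕ → I → TOp}
    (hf : ∑' p, S.nrm σ (f p) ≠ ⊤) (i : I) (ℓ : Idx) (j j' : Mode) :
    Summable fun p => f p i ℓ j j' :=
  Summable.of_enorm (ne_top_of_le_ne_top hf (ENNReal.tsum_le_tsum fun p =>
    (enorm_le_opNorm hσ (f p i) ℓ j j').trans (S.opNorm_le_nrm σ (f p) i)))

/-- The scale of families depending on an additional variable `x`, controlled together with their
difference quotients in `x`. -/
def fam (S : OpScale η I) (w : ℝ≥0∞) (d : X → X → ℝ≥0∞) : OpScale η (X × I) where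
  nrm σ f := famNorm w d (S.nrm σ) (fun x i => f (x, i))
  mlt Δ g := famNorm w d (S.mlt Δ) (fun x i => g (x, i))
  scl u := famNorm w d S.scl (fun x i => u (x, i))
  nrm_zero σ := le_antisymm ((famNorm_const (S.nrm_zero σ) (0 : I → TOp)).trans
    (S.nrm_zero σ).le) bot_le
  nrm_neg σ f := by
    have := famNorm_map (w := w) (d := d) (n := S.nrm σ) (n' := S.nrm σ) (c := 1)
      (fun y : I → TOp => -y) (fun y y' => by abel) (fun y => by simpa using S.nrm_neg σ y)
      (fun x i => f (x, i))
    rwa [one_mul] at this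
  nrm_add σ f g := famNorm_add_le (S.nrm_add σ) _ _
  nrm_one σ := (famNorm_const (S.nrm_zero σ) _).trans (S.nrm_one σ)
  opNorm_le_nrm σ f i := (S.opNorm_le_nrm σ (fun k => f (i.1, k)) i.2).trans
    (le_famNorm (S.nrm σ) (fun x i => f (x, i)) i.1)
  nrm_opMul σ hσ f g hf hg := by
    have hf' : ∀ x, S.nrm σ (fun i => f (x, i)) ≠ ⊤ := fun x =>
      ne_top_of_le_ne_top hf (le_famNorm (S.nrm σ) (fun x i => f (x, i)) x)
    have hg' : ∀ x, S.nrm σ (fun i => g (x, i)) ≠ ⊤ := fun x =>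
      ne_top_of_le_ne_top hg (le_famNorm (S.nrm σ) (fun x i => g (x, i)) x)
    refine famNorm_bilin_le (n₁ := S.nrm σ) (n₂ := S.nrm σ)
      (fun a b : I → TOp => fun i => opMul (a i) (b i)) (fun x i => f (x, i))
      (fun x i => g (x, i)) (fun x => S.nrm_opMul σ hσ _ _ (hf' x) (hg' x)) fun x y => ?_
    have e : (fun i => opMul (f (x, i)) (g (x, i))) - (fun i => opMul (f (y, i)) (g (y, i)))
        = (fun i => opMul (((fun i => f (x, i)) - fun i => f (y, i)) i) (g (x, i)))
          + fun i => opMul (f (y, i)) (((fun i => g (x, i)) - fun i => g (y, i)) i) := by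
      funext i
      simp only [Pi.sub_apply, Pi.add_apply]
      rw [opMul_sub_left hσ (S.opNorm_ne_top (hf' x) i) (S.opNorm_ne_top (hf' y) i)
        (S.opNorm_ne_top (hg' x) i), opMul_sub_right hσ (S.opNorm_ne_top (hf' y) i)
        (S.opNorm_ne_top (hg' x) i) (S.opNorm_ne_top (hg' y) i)]
      abel
    rw [e]
    exact (S.nrm_add _ _ _).trans (add_le_add
      (S.nrm_opMul σ hσ _ _ (S.nrm_sub_ne_top (hf' x) (hf' y)) (hg' x))
      (S.nrm_opMul σ hσ _ _ (hf' y) (S.nrm_sub_ne_top (hg' x) (hg' y))))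
  nrm_tsum σ hσ f hf := by
    have hf' : ∀ x, ∑' p, S.nrm σ (fun i => f p (x, i)) ≠ ⊤ := fun x =>
      ne_top_of_le_ne_top hf (ENNReal.tsum_le_tsum fun p =>
        le_famNorm (S.nrm σ) (fun x i => f p (x, i)) x)
    have hs : ∀ x y, ∑' p, S.nrm σ ((fun i => f p (x, i)) - fun i => f p (y, i)) ≠ ⊤ := by
      intro x y
      refine ne_top_of_le_ne_top (ENNReal.add_ne_top.2 ⟨hf' x, hf' y⟩) ?_
      rw [← ENNReal.tsum_add]
      refine ENNReal.tsum_le_tsum fun p => ?_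
      rw [sub_eq_add_neg]
      exact (S.nrm_add _ _ _).trans (add_le_add le_rfl (S.nrm_neg _ _))
    simp only [famNorm] at hf ⊢
    rw [ENNReal.tsum_add, ENNReal.tsum_mul_left]
    gcongr ?_ + w * ?_
    · refine iSup_le fun x => (S.nrm_tsum σ hσ _ (hf' x)).trans
        (ENNReal.tsum_le_tsum fun p => le_iSup (fun x => S.nrm σ fun i => f p (x, i)) x)
    · refine iSup_le fun x => iSup_le fun y => iSup_le fun h => ?_
      have e : (fun (i : I) (ℓ : Idx) (j j' : Mode) => ∑' p, f p (x, i) ℓ j j')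
            - (fun i ℓ j j' => ∑' p, f p (y, i) ℓ j j')
          = fun i ℓ j j' => ∑' p, ((fun i => f p (x, i)) - fun i => f p (y, i)) i ℓ j j' := by
        funext i ℓ j j'
        exact ((S.summable_coeff hσ (hf' x) i ℓ j j').tsum_sub
          (S.summable_coeff hσ (hf' y) i ℓ j j')).symm
      rw [e]
      refine (ENNReal.div_le_div_right (S.nrm_tsum σ hσ _ (hs x y)) _).trans ?_
      rw [div_eq_mul_inv, ← ENNReal.tsum_mul_right]
      refine ENNReal.tsum_le_tsum fun p => ?_
      rw [← div_eq_mul_inv]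
      exact le_iSup_of_le x (le_iSup_of_le y (le_iSup_of_le h le_rfl))
  nrm_mul σ Δ hΔ g f := by
    refine famNorm_bilin_le (n₁ := S.mlt Δ) (n₂ := S.nrm (σ + Δ))
      (fun a b : I → TOp => a * b) (fun x i => g (x, i))
      (fun x i => f (x, i)) (fun x => S.nrm_mul σ Δ hΔ _ _) fun x y => ?_
    have e : (fun i => g (x, i)) * (fun i => f (x, i)) - (fun i => g (y, i)) * (fun i => f (y, i))
        = ((fun i => g (x, i)) - fun i => g (y, i)) * (fun i => f (x, i))
          + (fun i => g (y, i)) * ((fun i => f (x, i)) - fun i => f (y, i)) := by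
      rw [sub_mul, mul_sub]; abel
    simp only [e]
    exact (S.nrm_add _ _ _).trans (add_le_add (S.nrm_mul σ Δ hΔ _ _) (S.nrm_mul σ Δ hΔ _ _))
  mlt_const Δ g := by
    have h0 : S.mlt Δ 0 = 0 := le_antisymm
      ((S.mlt_const Δ 0).trans (multNorm_le_iff.2 (by simp))) bot_le
    exact (famNorm_const h0 _).trans (S.mlt_const Δ g)
  scl_zero := le_antisymm ((famNorm_const S.scl_zero (0 : I → ℝ)).trans S.scl_zero.le) bot_le
  scl_add u v := famNorm_add_le S.scl_add _ _
  scl_smul c u := famNorm_map (n := S.scl) (n' := S.scl) (fun y : I → ℝ => fun i => c * y i)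
    (fun y y' => by funext i; simp [mul_sub]) (fun y => S.scl_smul c y) _
  scl_im σ hσ f ℓ j j' := by
    have := famNorm_map (w := w) (d := d) (n := S.nrm σ) (n' := S.scl) (c := 1)
      (fun y : I → TOp => fun i => (y i ℓ j j').im) (fun y y' => by funext i; simp)
      (fun y => by simpa using S.scl_im σ hσ y ℓ j j') (fun x i => f (x, i))
    rwa [one_mul] at this

end OpScale

/-! ### Exponentials, conjugations and the new remainder -/

lemma enorm_inv_factorial_le (p : ℕ) : ‖(((p + 1).factorial : ℂ))⁻¹‖ₑ ≤ (2⁻¹ : ℝ≥0∞) ^ p := by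
  have h : 2 ^ p ≤ (p + 1).factorial := by
    induction p with
    | zero => simp
    | succ p ih =>
      rw [Nat.factorial_succ, pow_succ, mul_comm]
      exact Nat.mul_le_mul (by omega) ih
  rw [enorm_inv (by exact_mod_cast (p + 1).factorial_ne_zero), ← ENNReal.inv_pow,
    ENNReal.inv_le_inv]
  have e : ‖((p + 1).factorial : ℂ)‖ₑ = ((p + 1).factorial : ℝ≥0∞) := by
    rw [← ofReal_norm, Complex.norm_natCast, ENNReal.ofReal_natCast]
  rw [e]
  exact_mod_cast h

lemma tsum_half_pow_mul (c : ℝ≥0∞) : ∑' p : ℕ, (2⁻¹ : ℝ≥0∞) ^ p * c = 2 * c := by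
  rw [ENNReal.tsum_mul_right, ENNReal.tsum_geometric, ENNReal.one_sub_inv_two, inv_inv]

namespace OpScale

variable {η : ℝ} {I : Type} (S : OpScale η I)

lemma nrm_const_mul_le {σ Δ : ℝ} (hΔ : 0 ≤ Δ) {g : TOp} {b : ℝ≥0∞}
    (hg : ∀ ℓ j j', expWt η (-Δ) ℓ * ‖g ℓ j j'‖ₑ ≤ b) (f : I → TOp) :
    S.nrm σ (fun i => g * f i) ≤ b * S.nrm (σ + Δ) f :=
  (S.nrm_mul σ Δ hΔ (fun _ => g) f).trans
    (mul_le_mul' ((S.mlt_const Δ g).trans (multNorm_le_iff.2 hg)) le_rfl)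

lemma expWt_neg_le_one {Δ : ℝ} (hΔ : 0 ≤ Δ) (ℓ : Idx) : expWt η (-Δ) ℓ ≤ 1 := by
  rw [expWt, ENNReal.ofReal_le_one, Real.exp_le_one_iff]
  nlinarith [wt_nonneg η ℓ]

lemma nrm_const_mul_le_of_le_one {σ Δ : ℝ} (hΔ : 0 ≤ Δ) {g : TOp} (hg : ∀ ℓ j j', ‖g ℓ j j'‖ₑ ≤ 1)
    (f : I → TOp) : S.nrm σ (fun i => g * f i) ≤ S.nrm (σ + Δ) f := by
  refine (S.nrm_const_mul_le hΔ (b := 1) (fun ℓ j j' => ?_) f).trans (one_mul _).le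
  exact mul_le_one' (expWt_neg_le_one hΔ ℓ) (hg ℓ j j')

lemma nrm_mono {σ σ' : ℝ} (h : σ ≤ σ') (f : I → TOp) : S.nrm σ f ≤ S.nrm σ' f := by
  have := S.nrm_const_mul_le_of_le_one (σ := σ) (sub_nonneg.2 h) (g := 1) (by simp) f
  simpa using this

lemma nrm_smul_le {σ : ℝ} (c : ℂ) (f : I → TOp) :
    S.nrm σ (fun i ℓ j j' => c * f i ℓ j j') ≤ ‖c‖ₑ * S.nrm σ f := by
  have := S.nrm_const_mul_le (σ := σ) le_rfl (g := fun _ _ _ => c) (b := ‖c‖ₑ)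
    (fun ℓ j j' => by simp [expWt]) f
  rw [add_zero] at this
  exact this

lemma nrm_sub_proj_le {σ Δ N : ℝ} (hΔ : 0 ≤ Δ) (f : I → TOp) :
    S.nrm σ (fun i => f i - proj η N (f i))
      ≤ ENNReal.ofReal (Real.exp (-(N * Δ))) * S.nrm (σ + Δ) f := by
  classical
  have := S.nrm_const_mul_le (σ := σ) hΔ (g := fun ℓ _ _ => if wt η ℓ ≤ N then 0 else 1)
    (b := ENNReal.ofReal (Real.exp (-(N * Δ)))) (fun ℓ j j' => ?_) f
  · convert this using 2
    funext i ℓ j j'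
    by_cases h : wt η ℓ ≤ N <;> simp [proj, h]
  · by_cases h : wt η ℓ ≤ N
    · simp [h]
    · simp only [h, if_false, enorm_one, mul_one, expWt]
      gcongr
      nlinarith

lemma nrm_diagMean_sub_proj_le {σ N : ℝ} (f : I → TOp) :
    S.nrm σ (fun i => diagMean (f i) - proj η N (f i)) ≤ S.nrm σ f := by
  classical
  have := S.nrm_const_mul_le_of_le_one (σ := σ) (Δ := 0) le_rfl
    (g := fun ℓ j j' => (if ℓ = 0 ∧ j = j' then 1 else 0) - if wt η ℓ ≤ N then 1 else 0)
    (fun ℓ j j' => ?_) f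
  · rw [add_zero] at this
    convert this using 2
    funext i ℓ j j'
    simp only [Pi.sub_apply, Pi.mul_apply, sub_mul, diagMean, proj, ite_mul, one_mul, zero_mul]
    congr 1
    by_cases h : ℓ = 0 ∧ j = j'
    · obtain ⟨rfl, rfl⟩ := h; simp
    · simp [h]
  · split_ifs <;> simp

variable {S}

lemma nrm_opPow_le {σ : ℝ} (hσ : 0 ≤ σ) {A : I → TOp} (hA : S.nrm σ A ≠ ⊤) (p : ℕ) :
    S.nrm σ (fun i => opPow (A i) p) ≤ S.nrm σ A ^ p := by
  induction p with
  | zero => simpa [opPow] using S.nrm_one σ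
  | succ p ih =>
    rw [pow_succ]
    exact (S.nrm_opMul σ hσ (fun i => opPow (A i) p) A
      (ne_top_of_le_ne_top (ENNReal.pow_ne_top hA) ih) hA).trans (mul_le_mul' ih le_rfl)

lemma nrm_opExp_le {σ : ℝ} (hσ : 0 ≤ σ) {A : I → TOp} (hA : S.nrm σ A ≤ 1) :
    S.nrm σ (fun i => opExp (A i)) ≤ 1 + 2 * S.nrm σ A := by
  have hA' : S.nrm σ A ≠ ⊤ := ne_top_of_le_ne_top ENNReal.one_ne_top hA
  have term : ∀ p : ℕ, S.nrm σ
      (fun i ℓ j j' => opPow (A i) (p + 1) ℓ j j' / ((p + 1).factorial : ℂ))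
      ≤ 2⁻¹ ^ p * S.nrm σ A := by
    intro p
    simp only [div_eq_inv_mul]
    refine (S.nrm_smul_le _ _).trans (mul_le_mul' (enorm_inv_factorial_le p) ?_)
    refine (nrm_opPow_le hσ hA' _).trans ?_
    rw [pow_succ]
    exact mul_le_of_le_one_left' (pow_le_one' hA p)
  have sum : ∑' p : ℕ, S.nrm σ (fun i ℓ j j' => opPow (A i) p ℓ j j' / (p.factorial : ℂ))
      ≤ 1 + 2 * S.nrm σ A := by
    rw [tsum_eq_zero_add' ENNReal.summable]
    refine add_le_add ?_ ((ENNReal.tsum_le_tsum term).trans (tsum_half_pow_mul _).le)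
    simpa [opPow] using S.nrm_one σ
  refine (S.nrm_tsum σ hσ (fun p i ℓ j j' => opPow (A i) p ℓ j j' / (p.factorial : ℂ))
    (ne_top_of_le_ne_top ?_ sum)).trans sum
  exact ENNReal.add_ne_top.2 ⟨ENNReal.one_ne_top, ENNReal.mul_ne_top (by simp) hA'⟩

lemma nrm_opConj_le {σ a b : ℝ} (hσ : 0 ≤ σ) {A B : I → TOp} (ha : 0 ≤ a) (ha' : a ≤ 1 / 2)
    (hb : 0 ≤ b) (hA : S.nrm σ A ≤ ENNReal.ofReal a) (hB : S.nrm σ B ≤ ENNReal.ofReal b) :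
    S.nrm σ (fun i => opConj (A i) (B i)) ≤ ENNReal.ofReal ((1 + 8 * a) * b) := by
  have h1 : S.nrm σ A ≤ 1 := hA.trans (ENNReal.ofReal_le_one.2 (by linarith))
  have hE : ∀ {A' : I → TOp}, S.nrm σ A' ≤ S.nrm σ A →
      S.nrm σ (fun i => opExp (A' i)) ≤ ENNReal.ofReal (1 + 2 * a) := by
    intro A' hA'
    refine (nrm_opExp_le hσ (hA'.trans h1)).trans ?_
    rw [ENNReal.ofReal_add (by norm_num) (by positivity), ENNReal.ofReal_mul (by norm_num)]
    simp only [ENNReal.ofReal_one, ENNReal.ofReal_ofNat]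
    gcongr
    exact hA'.trans hA
  have e1 := hE le_rfl
  have e2 := hE (S.nrm_neg σ A)
  have hB' : S.nrm σ B ≠ ⊤ := ne_top_of_le_ne_top ENNReal.ofReal_ne_top hB
  have m1 : S.nrm σ (fun i => opMul (B i) (opExp (A i))) ≤ ENNReal.ofReal (b * (1 + 2 * a)) := by
    rw [ENNReal.ofReal_mul hb]
    exact (S.nrm_opMul σ hσ B _ hB' (ne_top_of_le_ne_top ENNReal.ofReal_ne_top e1)).trans
      (mul_le_mul' hB e1)
  refine (S.nrm_opMul σ hσ _ _ (ne_top_of_le_ne_top ENNReal.ofReal_ne_top e2)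
    (ne_top_of_le_ne_top ENNReal.ofReal_ne_top m1)).trans ((mul_le_mul' e2 m1).trans ?_)
  rw [← ENNReal.ofReal_mul (by positivity)]
  refine ENNReal.ofReal_le_ofReal ?_
  nlinarith [mul_nonneg ha hb, mul_nonneg (mul_nonneg ha hb) (sub_nonneg.2 ha')]

lemma nrm_opAd_le {σ : ℝ} (hσ : 0 ≤ σ) {A B : I → TOp} (hA : S.nrm σ A ≠ ⊤)
    (hB : S.nrm σ B ≠ ⊤) :
    S.nrm σ (fun i => opAd (A i) (B i)) ≤ 2 * S.nrm σ A * S.nrm σ B := by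
  have e : (fun i => opAd (A i) (B i))
      = (fun i => opMul (B i) (A i)) + -fun i => opMul (A i) (B i) := by
    funext i; simp [opAd, sub_eq_add_neg]
  rw [e]
  refine (S.nrm_add _ _ _).trans ((add_le_add (S.nrm_opMul σ hσ _ _ hB hA)
    ((S.nrm_neg _ _).trans (S.nrm_opMul σ hσ _ _ hA hB))).trans (le_of_eq ?_))
  ring

lemma nrm_iterate_opAd_le {σ : ℝ} (hσ : 0 ≤ σ) {A B : I → TOp} (hA : 2 * S.nrm σ A ≤ 1)
    (hB : S.nrm σ B ≠ ⊤) (p : ℕ) :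
    S.nrm σ (fun i => (opAd (A i))^[p + 1] (B i)) ≤ 2 * S.nrm σ A * S.nrm σ B := by
  have hA' : S.nrm σ A ≠ ⊤ := by
    intro h
    simp [h] at hA
  have fin : 2 * S.nrm σ A * S.nrm σ B ≠ ⊤ :=
    ENNReal.mul_ne_top (ENNReal.mul_ne_top (by simp) hA') hB
  induction p with
  | zero => simpa using nrm_opAd_le hσ hA' hB
  | succ p ih =>
    simp only [Function.iterate_succ_apply' _ (p + 1)]
    refine (nrm_opAd_le hσ hA' (ne_top_of_le_ne_top fin ih)).trans ?_
    exact (mul_le_of_le_one_left' hA).trans ih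

/-- The series of iterated commutators in the new remainder are controlled by their first term. -/
lemma nrm_tsum_opAd_le {σ a b : ℝ} (hσ : 0 ≤ σ) {A B : I → TOp} (ha : 0 ≤ a) (ha' : a ≤ 1 / 2)
    (hA : S.nrm σ A ≤ ENNReal.ofReal a) (hB : S.nrm σ B ≤ ENNReal.ofReal b)
    (n : ℕ → ℕ) (hn : ∀ p, p ≤ n p) :
    S.nrm σ (fun i ℓ j j' => ∑' p : ℕ,
      ((opAd (A i))^[p + 1] (B i)) ℓ j j' / ((n p + 1).factorial : ℂ))
      ≤ ENNReal.ofReal (4 * a * b) := by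
  have h2 : 2 * S.nrm σ A ≤ 1 := by
    calc 2 * S.nrm σ A ≤ ENNReal.ofReal 2 * ENNReal.ofReal a := by
          rw [ENNReal.ofReal_ofNat]; gcongr
      _ ≤ 1 := by
          rw [← ENNReal.ofReal_mul (by norm_num)]
          exact ENNReal.ofReal_le_one.2 (by linarith)
  have term : ∀ p : ℕ, S.nrm σ (fun i ℓ j j' =>
      ((opAd (A i))^[p + 1] (B i)) ℓ j j' / ((n p + 1).factorial : ℂ))
      ≤ 2⁻¹ ^ p * ENNReal.ofReal (2 * a * b) := by
    intro p
    simp only [div_eq_inv_mul]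
    refine (S.nrm_smul_le _ fun i => (opAd (A i))^[p + 1] (B i)).trans (mul_le_mul' ?_ ?_)
    · exact (enorm_inv_factorial_le _).trans
        (pow_le_pow_right_of_le_one' (ENNReal.inv_le_one.2 (by norm_num)) (hn p))
    · refine (nrm_iterate_opAd_le hσ h2 (ne_top_of_le_ne_top ENNReal.ofReal_ne_top hB) p).trans ?_
      rw [ENNReal.ofReal_mul (by positivity), ENNReal.ofReal_mul (by positivity),
        ENNReal.ofReal_ofNat]
      gcongr
  have sum := (ENNReal.tsum_le_tsum term).trans (tsum_half_pow_mul _).le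
  refine (S.nrm_tsum σ hσ (fun p i ℓ j j' =>
      ((opAd (A i))^[p + 1] (B i)) ℓ j j' / ((n p + 1).factorial : ℂ))
    (ne_top_of_le_ne_top (ENNReal.mul_ne_top (by simp) ENNReal.ofReal_ne_top) sum)).trans
      (sum.trans (le_of_eq ?_))
  rw [← ENNReal.ofReal_ofNat 2, ← ENNReal.ofReal_mul (by norm_num)]
  ring_nf

lemma nrm_newRemainder_le {σ Δ N a b : ℝ} (hσ : 0 ≤ σ) (hΔ : 0 ≤ Δ) {A P : I → TOp} (ha : 0 ≤ a)
    (ha' : a ≤ 1 / 2) (hb : 0 ≤ b) (hA : S.nrm σ A ≤ ENNReal.ofReal a)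
    (hP : S.nrm (σ + Δ) P ≤ ENNReal.ofReal b) :
    S.nrm σ (fun i => newRemainder η N (A i) (P i))
      ≤ ENNReal.ofReal (Real.exp (-(N * Δ)) * b + 8 * a * b) := by
  have hP' : S.nrm σ P ≤ ENNReal.ofReal b := (S.nrm_mono (by linarith) P).trans hP
  have t1 : S.nrm σ (fun i => P i - proj η N (P i))
      ≤ ENNReal.ofReal (Real.exp (-(N * Δ)) * b) := by
    rw [ENNReal.ofReal_mul (Real.exp_pos _).le]
    exact (S.nrm_sub_proj_le hΔ P).trans (mul_le_mul' le_rfl hP)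
  have t2 := nrm_tsum_opAd_le hσ ha ha' hA ((S.nrm_diagMean_sub_proj_le (N := N) P).trans hP')
    (fun p => p + 1) (fun p => by omega)
  have t3 := nrm_tsum_opAd_le hσ ha ha' hA hP' (fun p => p) (fun p => le_rfl)
  have e : Real.exp (-(N * Δ)) * b + 8 * a * b
      = Real.exp (-(N * Δ)) * b + 4 * a * b + 4 * a * b := by ring
  rw [e, ENNReal.ofReal_add (by positivity) (by positivity),
    ENNReal.ofReal_add (by positivity) (by positivity)]
  exact (S.nrm_add _ _ _).trans (add_le_add ((S.nrm_add _ _ _).trans (add_le_add t1 t2)) t3)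

end OpScale

/-! ### The iteration -/

/-- The reducibility scheme in which the generator is `Ψ_k = g_k(r_k) · P_k^{(k)}` for prescribed
Fourier multipliers `g_k`, depending on the eigenvalue corrections `r_k`. -/
def multScheme (η : ℝ) (N : ℕ → ℝ) (g : ℕ → (Mode → ℝ) → TOp) (P0 : ℕ → TOp) :
    ℕ → (Mode → ℝ) × (ℕ → TOp)
  | 0 => (0, P0)
  | k + 1 =>
    let s := multScheme η N g P0 k
    let Ψ := g k s.1 * s.2 k
    (fun j => s.1 j + (s.2 k 0 j j).im,
     fun i =>
      if i = k + 1 then newRemainder η (N k) Ψ (s.2 k) + opConj Ψ (s.2 (k + 1))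
      else if k + 1 < i then opConj Ψ (s.2 i)
      else 0)

namespace Scales

variable {μ C ε : ℝ} {ρ δ N : ℕ → ℝ}

lemma gap_pos (h : Scales μ C ε ρ δ N) (k : ℕ) : 0 < ρ k - ρ (k + 1) :=
  sub_pos.2 (h.rho_anti (Nat.lt_succ_self k))

/-- The quadratic condition on the scales makes the homological equation contracting. -/
lemma exp_mul_le (h : Scales μ C ε ρ δ N) (hε : 0 ≤ ε) (k : ℕ) :
    Real.exp (C * (ρ k - ρ (k + 1)) ^ (-μ)) * δ k ≤ ε * (1 / 2) ^ k := by
  have h1 := h.small k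
  have h2 := h.delta_anti (Nat.le_succ k)
  have h3 := h.delta_pos k
  have h4 : 0 ≤ Real.exp (-(N k * (ρ k - ρ (k + 1)))) * δ k := by positivity
  have h5 : ε * (1 / 2) ^ k * δ (k + 1) ≤ ε * (1 / 2) ^ k * δ k := by gcongr
  refine le_of_mul_le_mul_right ?_ h3
  nlinarith

lemma delta_le (h : Scales μ C ε ρ δ N) (hC : 0 ≤ C) (hε : 0 ≤ ε) (k : ℕ) :
    δ k ≤ ε * (1 / 2) ^ k := by
  refine le_trans ?_ (h.exp_mul_le hε k)
  refine le_mul_of_one_le_left (h.delta_pos k).le ?_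
  rw [Real.one_le_exp_iff]
  exact mul_nonneg hC (Real.rpow_nonneg (h.gap_pos k).le _)

end Scales

/-- The bounds on the remainders, on the eigenvalue corrections and on the generators along the
iteration, in any scale of norms in which the multipliers solving the homological equations are
bounded by `A e^{C Δ_k^{-μ}}`. The remainders satisfy `‖P_k^{(i)}‖ ≤ 4 (2 - 2^{-k}) β_i` inductively:
the constant grows at each step by a factor at most `1 + 2^{-k} / 4`. -/
theorem OpScale.multScheme_bounds {η : ℝ} {I : Type} (S : OpScale η I) {μ C ε A : ℝ}
    {ρ δ N β : ℕ → ℝ} (hS : Scales μ C ε ρ δ N) (hC : 0 ≤ C) (hA : 1 ≤ A)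
    (hε : 0 < ε) (hεA : 516 * A * ε ≤ 1) {m : ℕ} (hβ : ∀ i, δ i ≤ β i) (hβ' : ∀ i ≤ m, β i = δ i)
    (g : I → ℕ → (Mode → ℝ) → TOp) (P0 : I → ℕ → TOp)
    (hP0 : ∀ i, S.nrm (ρ i) (fun x => P0 x i) ≤ ENNReal.ofReal (4 * β i))
    (hg : ∀ k (r : I → Mode → ℝ), (∀ j, S.scl (fun x => r x j) ≤ 1) →
      S.mlt (ρ k - ρ (k + 1)) (fun x => g x k (r x))
        ≤ ENNReal.ofReal (A * Real.exp (C * (ρ k - ρ (k + 1)) ^ (-μ)))) :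
    (∀ k ≤ m + 1, ∀ j, S.scl (fun x => (multScheme η N (g x) (P0 x) k).1 j) ≤ 1) ∧
    (∀ k ≤ m + 1, ∀ i ≥ k,
      S.nrm (ρ i) (fun x => (multScheme η N (g x) (P0 x) k).2 i) ≤ ENNReal.ofReal (8 * β i)) ∧
    (∀ k ≤ m, S.nrm (ρ (k + 1)) (fun x => g x k (multScheme η N (g x) (P0 x) k).1 *
      (multScheme η N (g x) (P0 x) k).2 k) ≤ 1) := by
  set s := fun k x => multScheme η N (g x) (P0 x) k with hs
  set E := fun k => Real.exp (C * (ρ k - ρ (k + 1)) ^ (-μ)) with hE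
  have hAε : ε ≤ 1 / 516 := by nlinarith
  have hβ0 : ∀ i, 0 ≤ β i := fun i => (hS.delta_pos i).le.trans (hβ i)
  have hx : ∀ k : ℕ, 0 < (1 / 2 : ℝ) ^ k ∧ (1 / 2 : ℝ) ^ k ≤ 1 := fun k =>
    ⟨by positivity, pow_le_one₀ (by norm_num) (by norm_num)⟩
  -- the generator at a step where the correction and the remainder are under control
  have gen : ∀ k ≤ m, (∀ j, S.scl (fun x => (s k x).1 j) ≤ 1) →
      S.nrm (ρ k) (fun x => (s k x).2 k) ≤ ENNReal.ofReal (4 * (2 - (1 / 2) ^ k) * β k) →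
      S.nrm (ρ (k + 1)) (fun x => g x k (s k x).1 * (s k x).2 k)
        ≤ ENNReal.ofReal (A * E k * (8 * δ k)) := by
    intro k hk hr hP
    have h1 := S.nrm_mul (ρ (k + 1)) (ρ k - ρ (k + 1)) (hS.gap_pos k).le
      (fun x => g x k (s k x).1) (fun x => (s k x).2 k)
    rw [add_sub_cancel] at h1
    refine h1.trans ?_
    rw [ENNReal.ofReal_mul (by positivity)]
    refine mul_le_mul' (hg k _ hr) (hP.trans (ENNReal.ofReal_le_ofReal ?_))
    rw [hβ' k hk]
    nlinarith [hS.delta_pos k, (hx k).1]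
  have gen_le : ∀ k, A * E k * (8 * δ k) ≤ 8 * A * ε * (1 / 2) ^ k := by
    intro k
    have := mul_le_mul_of_nonneg_left (hS.exp_mul_le hε.le k) (by positivity : 0 ≤ 8 * A)
    simp only [hE]
    linarith
  have gen_half : ∀ k, A * E k * (8 * δ k) ≤ 1 / 2 := by
    intro k
    have : 8 * A * ε * (1 / 2) ^ k ≤ 8 * A * ε :=
      mul_le_of_le_one_right (by positivity) (hx k).2
    linarith [gen_le k]
  have main : ∀ k ≤ m + 1,
      (∀ j, S.scl (fun x => (s k x).1 j) ≤ ENNReal.ofReal (16 * ε * (1 - (1 / 2) ^ k))) ∧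
      ∀ i ≥ k, S.nrm (ρ i) (fun x => (s k x).2 i)
        ≤ ENNReal.ofReal (4 * (2 - (1 / 2) ^ k) * β i) := by
    intro k
    induction k with
    | zero =>
      intro _
      refine ⟨fun j => ?_, fun i _ => ?_⟩
      · exact (S.scl_zero.le.trans bot_le)
      · refine (hP0 i).trans (ENNReal.ofReal_le_ofReal (le_of_eq ?_))
        norm_num
    | succ k ih =>
      intro hk
      obtain ⟨ihr, ihP⟩ := ih (by omega)
      have hkm : k ≤ m := by omega
      obtain ⟨hx0, hx1⟩ := hx k
      have hr1 : ∀ j, S.scl (fun x => (s k x).1 j) ≤ 1 := fun j =>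
        (ihr j).trans (ENNReal.ofReal_le_one.2 (by nlinarith))
      set a := A * E k * (8 * δ k) with ha
      have hδ := hS.delta_pos k
      have ha0 : 0 ≤ a := by positivity
      have haε : a ≤ 8 * A * ε * (1 / 2) ^ k := gen_le k
      have ha2 : a ≤ 1 / 2 := gen_half k
      have hΨ := gen k hkm hr1 (ihP k le_rfl)
      set Ψ : I → TOp := fun x => g x k (s k x).1 * (s k x).2 k with hΨdef
      have c0 : 0 ≤ 4 * (2 - (1 / 2 : ℝ) ^ k) := by linarith
      -- conjugation of a component of the remainder
      have conj : ∀ i ≥ k + 1, S.nrm (ρ i) (fun x => opConj (Ψ x) ((s k x).2 i))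
          ≤ ENNReal.ofReal ((1 + 8 * a) * (4 * (2 - (1 / 2) ^ k) * β i)) := fun i hi =>
        OpScale.nrm_opConj_le (hS.rho_pos i).le ha0 ha2 (mul_nonneg c0 (hβ0 i))
          ((S.nrm_mono (hS.rho_anti.antitone hi) Ψ).trans hΨ) (ihP i (by omega))
      -- the growth of the constants is summable
      have step : ∀ t : ℝ, 0 ≤ t → t ≤ 1 / 4 * (1 / 2) ^ k →
          (1 + t) * (4 * (2 - (1 / 2 : ℝ) ^ k)) ≤ 4 * (2 - (1 / 2) ^ (k + 1)) := by
        intro t ht ht'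
        rw [pow_succ]
        nlinarith
      have hAx : 516 * A * ε * (1 / 2) ^ k ≤ (1 / 2) ^ k := mul_le_of_le_one_left hx0.le hεA
      have hεx : ε * (1 / 2) ^ k ≤ A * ε * (1 / 2) ^ k := by
        rw [mul_assoc A]
        exact le_mul_of_one_le_left (by positivity) hA
      refine ⟨fun j => ?_, fun i hi => ?_⟩
      · have e : (fun x => (s (k + 1) x).1 j)
            = (fun x => (s k x).1 j) + fun x => ((s k x).2 k 0 j j).im := rfl
        rw [e]
        refine (S.scl_add _ _).trans ((add_le_add (ihr j) ((S.scl_im (ρ k) (hS.rho_pos k).le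
          (fun x => (s k x).2 k) 0 j j).trans (ihP k le_rfl))).trans ?_)
        rw [← ENNReal.ofReal_add (by nlinarith) (mul_nonneg c0 (hβ0 k))]
        refine ENNReal.ofReal_le_ofReal ?_
        rw [hβ' k hkm, pow_succ]
        nlinarith [hS.delta_le hC hε.le k]
      · rcases eq_or_lt_of_le hi with rfl | hlt
        · have e : (fun x => (s (k + 1) x).2 (k + 1))
              = (fun x => newRemainder η (N k) (Ψ x) ((s k x).2 k))
                + fun x => opConj (Ψ x) ((s k x).2 (k + 1)) := by
            funext x
            simp [hs, multScheme, hΨdef]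
          have hP := ihP k le_rfl
          rw [hβ' k hkm] at hP
          have hnew := OpScale.nrm_newRemainder_le (S := S) (N := N k) (hS.rho_pos (k + 1)).le
            (hS.gap_pos k).le ha0 ha2 (mul_nonneg c0 hδ.le) hΨ (P := fun x => (s k x).2 k)
            (by rwa [add_sub_cancel])
          rw [e]
          refine (S.nrm_add _ _ _).trans ((add_le_add hnew (conj _ le_rfl)).trans ?_)
          have hsm := hS.small k
          have hd1 := hS.delta_pos (k + 1)
          have h1 : Real.exp (-(N k * (ρ k - ρ (k + 1)))) * δ k ≤ ε * (1 / 2) ^ k * δ (k + 1) := by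
            have : 0 ≤ E k * δ k ^ 2 := by positivity
            linarith
          have h2 : E k * δ k ^ 2 ≤ ε * (1 / 2) ^ k * δ (k + 1) := by
            have : 0 ≤ Real.exp (-(N k * (ρ k - ρ (k + 1)))) * δ k := by positivity
            linarith
          have h3 : Real.exp (-(N k * (ρ k - ρ (k + 1)))) * δ k + 8 * a * δ k
              ≤ (65 * A * ε * (1 / 2) ^ k) * δ (k + 1) := by
            have h2' := mul_le_mul_of_nonneg_left h2 (by positivity : 0 ≤ 64 * A)
            have h4 := mul_le_mul_of_nonneg_right hεx hd1.le
            have : 8 * a * δ k = 64 * A * (E k * δ k ^ 2) := by rw [ha]; ring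
            rw [this]
            linarith
          rw [← ENNReal.ofReal_add (by positivity)
            (mul_nonneg (by positivity) (mul_nonneg c0 (hβ0 _)))]
          refine ENNReal.ofReal_le_ofReal ?_
          have h5 : (65 * A * ε * (1 / 2) ^ k) * δ (k + 1)
              ≤ (65 * A * ε * (1 / 2) ^ k) * β (k + 1) := by
            gcongr
            exact hβ _
          have h6 := step (65 * A * ε * (1 / 2) ^ k + 8 * a) (by positivity) (by linarith)
          calc Real.exp (-(N k * (ρ k - ρ (k + 1)))) * (4 * (2 - (1 / 2) ^ k) * δ k)
                + 8 * a * (4 * (2 - (1 / 2) ^ k) * δ k)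
                + (1 + 8 * a) * (4 * (2 - (1 / 2) ^ k) * β (k + 1))
              = 4 * (2 - (1 / 2) ^ k) *
                  (Real.exp (-(N k * (ρ k - ρ (k + 1)))) * δ k + 8 * a * δ k)
                + (1 + 8 * a) * (4 * (2 - (1 / 2) ^ k) * β (k + 1)) := by ring
            _ ≤ 4 * (2 - (1 / 2) ^ k) * ((65 * A * ε * (1 / 2) ^ k) * β (k + 1))
                + (1 + 8 * a) * (4 * (2 - (1 / 2) ^ k) * β (k + 1)) := by
                gcongr
                exact h3.trans h5
            _ = (1 + (65 * A * ε * (1 / 2) ^ k + 8 * a)) * (4 * (2 - (1 / 2) ^ k))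
                  * β (k + 1) := by ring
            _ ≤ _ := mul_le_mul_of_nonneg_right h6 (hβ0 _)
        · have e : (fun x => (s (k + 1) x).2 i) = fun x => opConj (Ψ x) ((s k x).2 i) := by
            funext x
            simp [hs, multScheme, hΨdef, hlt.ne', hlt]
          rw [e]
          refine (conj i hi).trans (ENNReal.ofReal_le_ofReal ?_)
          rw [← mul_assoc]
          refine mul_le_mul_of_nonneg_right (step (8 * a) (by positivity) ?_) (hβ0 i)
          linarith
  have r1 : ∀ k ≤ m + 1, ∀ j, S.scl (fun x => (s k x).1 j) ≤ 1 := fun k hk j =>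
    ((main k hk).1 j).trans (ENNReal.ofReal_le_one.2 (by nlinarith [(hx k).1, (hx k).2]))
  refine ⟨r1, fun k hk i hi => ((main k hk).2 i hi).trans (ENNReal.ofReal_le_ofReal ?_),
    fun k hk => ?_⟩
  · nlinarith [hβ0 i, (hx k).1]
  · exact (gen k hk (r1 k (by omega)) ((main k (by omega)).2 k le_rfl)).trans
      (ENNReal.ofReal_le_one.2 ((gen_half k).trans (by norm_num)))

/-! ### Divisor weights against exponential decay -/

lemma one_le_dd (ℓ : Idx) : 1 ≤ dd ℓ := by
  have h := Finset.prod_le_prod (s := ℓ.support) (f := fun _ => (1 : ℝ))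
    (g := fun i : ℕ+ => 1 + |((ℓ i : ℤ) : ℝ)| ^ 5 * ((i : ℕ) : ℝ) ^ 5) (fun _ _ => zero_le_one)
    fun i _ => le_add_of_nonneg_right (by positivity)
  simpa [dd, Finsupp.prod] using h

/-- The contribution of one component `n = ℓ_i`, with `x = i^η |n|`. -/
lemma dd_factor_le {η κ : ℝ} (hη : 0 < η) (hκ : 0 < κ) (i : ℕ+) {n : ℤ} (hn : n ≠ 0) :
    1 ≤ ((i : ℕ) : ℝ) ^ η * |(n : ℝ)| ∧ ((i : ℕ) : ℝ) ^ η ≤ ((i : ℕ) : ℝ) ^ η * |(n : ℝ)| ∧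
    (1 + |(n : ℝ)| ^ 5 * ((i : ℕ) : ℝ) ^ 5) ^ 4
      ≤ Real.exp ((4 + 4 * ((5 + 5 / η) / κ)) * (((i : ℕ) : ℝ) ^ η * |(n : ℝ)|) ^ κ) := by
  set I : ℝ := ((i : ℕ) : ℝ) with hI
  set a : ℝ := |(n : ℝ)| with ha
  have hI1 : 1 ≤ I := by rw [hI]; exact_mod_cast i.pos
  have ha1 : 1 ≤ a := by rw [ha]; exact_mod_cast Int.one_le_abs hn
  have hIη : 1 ≤ I ^ η := Real.one_le_rpow hI1 hη.le
  set x := I ^ η * a with hx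
  have hIx : I ^ η ≤ x := le_mul_of_one_le_right (by positivity) ha1
  have hax : a ≤ x := le_mul_of_one_le_left (by positivity) hIη
  have hx1 : 1 ≤ x := hIη.trans hIx
  have hx0 : 0 < x := by linarith
  refine ⟨hx1, hIx, ?_⟩
  have hIx' : I ≤ x ^ (1 / η) := by
    calc I = (I ^ η) ^ (1 / η) := by
          rw [← Real.rpow_mul (by positivity), mul_one_div_cancel hη.ne', Real.rpow_one]
      _ ≤ x ^ (1 / η) := Real.rpow_le_rpow (by positivity) hIx (by positivity)
  have h1 : 1 + a ^ 5 * I ^ 5 ≤ 2 * x ^ (5 + 5 / η) := by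
    have e : x ^ (5 + 5 / η) = x ^ 5 * (x ^ (1 / η)) ^ 5 := by
      rw [Real.rpow_add hx0, ← Real.rpow_natCast (x ^ (1 / η)), ← Real.rpow_mul hx0.le]
      norm_num [Real.rpow_ofNat]
      left; congr 1; ring
    rw [e]
    have h2 : a ^ 5 * I ^ 5 ≤ x ^ 5 * (x ^ (1 / η)) ^ 5 := by gcongr
    have h3 : 1 ≤ a ^ 5 * I ^ 5 := one_le_mul_of_one_le_of_one_le (one_le_pow₀ ha1)
      (one_le_pow₀ hI1)
    linarith
  have hxκ : 1 ≤ x ^ κ := Real.one_le_rpow hx1 hκ.le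
  have hlog : Real.log x ≤ x ^ κ / κ := Real.log_le_rpow_div hx0.le hκ
  have hp : 0 < 5 + 5 / η := by positivity
  have hl2 : Real.log 2 ≤ 1 := by linarith [Real.log_two_lt_d9]
  have h4 : 2 * x ^ (5 + 5 / η) ≤ Real.exp ((1 + (5 + 5 / η) / κ) * x ^ κ) := by
    have e2 : 2 * x ^ (5 + 5 / η) = Real.exp (Real.log 2 + Real.log x * (5 + 5 / η)) := by
      rw [Real.exp_add, Real.exp_log two_pos, Real.rpow_def_of_pos hx0]
    rw [e2]
    refine Real.exp_le_exp.2 ?_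
    have := mul_le_mul_of_nonneg_right hlog hp.le
    calc Real.log 2 + Real.log x * (5 + 5 / η) ≤ 1 * x ^ κ + x ^ κ / κ * (5 + 5 / η) := by
          linarith
      _ = _ := by ring
  calc (1 + a ^ 5 * I ^ 5) ^ 4 ≤ (Real.exp ((1 + (5 + 5 / η) / κ) * x ^ κ)) ^ 4 := by
        gcongr
        exact h1.trans h4
    _ = _ := by
        rw [← Real.exp_nat_mul]
        congr 1
        push_cast
        ring

lemma card_pnat_le_le (s : Finset ℕ+) {Y : ℝ} (hY : 0 ≤ Y) :
    ((s.filter fun i : ℕ+ => ((i : ℕ) : ℝ) ≤ Y).card : ℝ) ≤ Y := by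
  have h : (s.filter fun i : ℕ+ => ((i : ℕ) : ℝ) ≤ Y).card ≤ (Finset.Icc 1 ⌊Y⌋₊).card := by
    refine Finset.card_le_card_of_injOn (fun i : ℕ+ => (i : ℕ)) (fun i hi => ?_)
      (fun a _ b _ h => PNat.coe_injective h)
    have hi' : ((i : ℕ) : ℝ) ≤ Y := by
      have := Finset.mem_coe.1 hi
      exact (Finset.mem_filter.1 this).2
    simp only [Finset.coe_Icc, Set.mem_Icc]
    exact ⟨i.pos, Nat.le_floor hi'⟩
  rw [Nat.card_Icc, Nat.add_sub_cancel] at h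
  exact (Nat.cast_le.2 h).trans (Nat.floor_le hY)

/-- A loss of `Δ` in the analyticity width absorbs a power of the divisor weight `𝚍(ℓ)` at the cost
of `e^{C Δ^{-μ}}`, for every `μ > 1/η`. In the product over the components, the factors with
`i^η |ℓ_i| ≥ X = (c/Δ)^{1/(1-κ)}` are at most `1`; there are at most `X^{1/η}` other ones, each of
size at most `e^{c X^κ}`; and `κ` is chosen so that `(κ + 1/η)/(1-κ) = μ`. -/
lemma exists_dd_pow_le {η μ : ℝ} (hη : 0 < η) (hμ : 1 / η < μ) :
    ∃ C > (0 : ℝ), ∀ Δ > (0 : ℝ), ∀ ℓ : Idx,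
      Real.exp (-Δ * wt η ℓ) * dd ℓ ^ 4 ≤ Real.exp (C * Δ ^ (-μ)) := by
  have hη' : 0 < 1 / η := by positivity
  have hμ0 : 0 < μ := hη'.trans hμ
  set κ := (μ - 1 / η) / (1 + μ) with hκdef
  have hκ : 0 < κ := div_pos (by linarith) (by linarith)
  have hκ1 : κ < 1 := by rw [hκdef, div_lt_one (by linarith)]; linarith
  set c := 4 + 4 * ((5 + 5 / η) / κ) with hc
  have hc0 : 0 < c := by positivity
  refine ⟨c * c ^ μ, by positivity, fun Δ hΔ ℓ => ?_⟩
  set X := (c / Δ) ^ (1 / (1 - κ)) with hX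
  have hX0 : 0 < X := by positivity
  have h1κ : 0 < 1 - κ := by linarith
  have hfac : ∀ i ∈ ℓ.support, Real.exp (-Δ * (((i : ℕ) : ℝ) ^ η * |((ℓ i : ℤ) : ℝ)|))
      * (1 + |((ℓ i : ℤ) : ℝ)| ^ 5 * ((i : ℕ) : ℝ) ^ 5) ^ 4
      ≤ if ((i : ℕ) : ℝ) ≤ X ^ (1 / η) then Real.exp (c * X ^ κ) else 1 := by
    intro i hi
    obtain ⟨hx1, hIx, hf⟩ := dd_factor_le hη hκ i (Finsupp.mem_support_iff.1 hi)
    set x := ((i : ℕ) : ℝ) ^ η * |((ℓ i : ℤ) : ℝ)| with hx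
    have hx0 : 0 < x := by linarith
    have h1 : Real.exp (-Δ * x) * (1 + |((ℓ i : ℤ) : ℝ)| ^ 5 * ((i : ℕ) : ℝ) ^ 5) ^ 4
        ≤ Real.exp (c * x ^ κ - Δ * x) := by
      have e : c * x ^ κ - Δ * x = -Δ * x + c * x ^ κ := by ring
      rw [e, Real.exp_add]
      exact mul_le_mul_of_nonneg_left hf (Real.exp_pos _).le
    refine h1.trans ?_
    rcases le_total X x with hXx | hxX
    · have h2 : c * x ^ κ ≤ Δ * x := by
        have h3 : c / Δ ≤ x ^ (1 - κ) := by
          calc c / Δ = X ^ (1 - κ) := by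
                rw [hX, ← Real.rpow_mul (by positivity), one_div_mul_cancel h1κ.ne', Real.rpow_one]
            _ ≤ x ^ (1 - κ) := Real.rpow_le_rpow hX0.le hXx h1κ.le
        rw [div_le_iff₀ hΔ] at h3
        calc c * x ^ κ ≤ x ^ (1 - κ) * Δ * x ^ κ := by gcongr
          _ = Δ * (x ^ (1 - κ) * x ^ κ) := by ring
          _ = Δ * x := by rw [← Real.rpow_add hx0, sub_add_cancel, Real.rpow_one]
      have h4 : Real.exp (c * x ^ κ - Δ * x) ≤ 1 := Real.exp_le_one_iff.2 (by linarith)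
      split_ifs
      · exact h4.trans (Real.one_le_exp (by positivity))
      · exact h4
    · rw [if_pos]
      · refine Real.exp_le_exp.2 ?_
        have : c * x ^ κ ≤ c * X ^ κ := by gcongr
        nlinarith [mul_pos hΔ hx0]
      · calc ((i : ℕ) : ℝ) = (((i : ℕ) : ℝ) ^ η) ^ (1 / η) := by
              rw [← Real.rpow_mul (by positivity), mul_one_div_cancel hη.ne', Real.rpow_one]
          _ ≤ X ^ (1 / η) := Real.rpow_le_rpow (by positivity) (hIx.trans hxX) hη'.le
  have hprod : Real.exp (-Δ * wt η ℓ) * dd ℓ ^ 4 = ∏ i ∈ ℓ.support,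
      (Real.exp (-Δ * (((i : ℕ) : ℝ) ^ η * |((ℓ i : ℤ) : ℝ)|))
      * (1 + |((ℓ i : ℤ) : ℝ)| ^ 5 * ((i : ℕ) : ℝ) ^ 5) ^ 4) := by
    rw [Finset.prod_mul_distrib, ← Real.exp_sum, Finset.prod_pow, ← Finset.mul_sum]
    rfl
  calc Real.exp (-Δ * wt η ℓ) * dd ℓ ^ 4
      ≤ ∏ i ∈ ℓ.support, if ((i : ℕ) : ℝ) ≤ X ^ (1 / η) then Real.exp (c * X ^ κ) else 1 := by
        rw [hprod]
        exact Finset.prod_le_prod (fun i _ => by positivity) hfac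
    _ = Real.exp (((ℓ.support.filter fun i : ℕ+ => ((i : ℕ) : ℝ) ≤ X ^ (1 / η)).card : ℝ)
          * (c * X ^ κ)) := by
        rw [Finset.prod_ite, Finset.prod_const, Finset.prod_const_one, mul_one, Real.exp_nat_mul]
    _ ≤ Real.exp (X ^ (1 / η) * (c * X ^ κ)) := by
        gcongr
        exact card_pnat_le_le _ (by positivity)
    _ = Real.exp (c * c ^ μ * Δ ^ (-μ)) := by
        congr 1
        have h5 : 1 / (1 - κ) * (1 / η + κ) = μ := by
          have h6 : κ * (1 + μ) = μ - 1 / η := div_mul_cancel₀ _ (by linarith)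
          rw [one_div, inv_mul_eq_div, div_eq_iff h1κ.ne']
          linarith
        calc X ^ (1 / η) * (c * X ^ κ) = c * (X ^ (1 / η) * X ^ κ) := by ring
          _ = c * (c / Δ) ^ μ := by
              rw [← Real.rpow_add hX0, hX, ← Real.rpow_mul (by positivity), h5]
          _ = c * c ^ μ * Δ ^ (-μ) := by
              rw [Real.div_rpow hc0.le hΔ.le, Real.rpow_neg hΔ.le]
              ring

/-! ### The cut-off reciprocal -/

/-- A `C^{1,1}` function equal to `1/y` for `|y| ≥ 1`. -/
def recip (y : ℝ) : ℝ := if 1 ≤ |y| then y⁻¹ else 2 * y - y ^ 3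

/-- The derivative of `recip`: it is `2 - 3 y²` for `|y| ≤ 1` and `-1/y²` for `|y| ≥ 1`. -/
def recipDeriv (y : ℝ) : ℝ := 3 - 3 * (min |y| 1) ^ 2 - ((max |y| 1) ^ 2)⁻¹

lemma recipDeriv_of_le {y : ℝ} (h : |y| ≤ 1) : recipDeriv y = 2 - 3 * y ^ 2 := by
  rw [recipDeriv, min_eq_left h, max_eq_right h, sq_abs]
  norm_num
  ring

lemma recipDeriv_of_ge {y : ℝ} (h : 1 ≤ |y|) : recipDeriv y = -(y ^ 2)⁻¹ := by
  rw [recipDeriv, min_eq_right h, max_eq_left h, sq_abs]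
  norm_num

lemma recip_neg (y : ℝ) : recip (-y) = -recip y := by
  simp only [recip, abs_neg, inv_neg]
  split_ifs
  · rfl
  · ring

lemma hasDerivAt_cubic (x : ℝ) : HasDerivAt (fun y : ℝ => 2 * y - y ^ 3) (2 - 3 * x ^ 2) x := by
  have := ((hasDerivAt_id x).const_mul 2).fun_sub (hasDerivAt_pow 3 x)
  simpa using this

lemma hasDerivAt_recip_one : HasDerivAt recip (-1) 1 := by
  rw [← hasDerivWithinAt_univ, ← Set.Iic_union_Ici (a := (1 : ℝ))]
  refine HasDerivWithinAt.union ?_ ?_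
  · have h : HasDerivAt (fun y : ℝ => 2 * y - y ^ 3) (-1) 1 := by
      convert hasDerivAt_cubic 1 using 1; norm_num
    refine h.hasDerivWithinAt.congr_of_eventuallyEq ?_ (by norm_num [recip])
    filter_upwards [self_mem_nhdsWithin, mem_nhdsWithin_of_mem_nhds (lt_mem_nhds zero_lt_one)]
      with y hy hy0
    rcases eq_or_lt_of_le (show y ≤ 1 from hy) with rfl | hlt
    · norm_num [recip]
    · rw [recip, if_neg]
      rw [abs_of_pos hy0]
      linarith
  · have h : HasDerivAt (fun y : ℝ => y⁻¹) (-1) 1 := by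
      simpa using hasDerivAt_inv (one_ne_zero (α := ℝ))
    refine h.hasDerivWithinAt.congr (fun y hy => ?_) (by norm_num [recip])
    rw [recip, if_pos ((show (1 : ℝ) ≤ y from hy).trans (le_abs_self y))]

lemma hasDerivAt_recip (x : ℝ) : HasDerivAt recip (recipDeriv x) x := by
  rcases lt_trichotomy |x| 1 with h | h | h
  · rw [recipDeriv_of_le h.le]
    refine (hasDerivAt_cubic x).congr_of_eventuallyEq ?_
    filter_upwards [continuous_abs.continuousAt.eventually (gt_mem_nhds h)] with y hy
    rw [recip, if_neg (not_le.2 hy)]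
  · rw [recipDeriv_of_ge h.ge]
    rcases eq_or_eq_neg_of_abs_eq h with rfl | rfl
    · simpa using hasDerivAt_recip_one
    · have h1 : HasDerivAt recip (-1) (-(-1 : ℝ)) := by rw [neg_neg]; exact hasDerivAt_recip_one
      have h2 : HasDerivAt (fun y => -recip (-y)) (-(-1 * -1)) (-1) :=
        (h1.comp (-1 : ℝ) (hasDerivAt_neg (-1 : ℝ))).fun_neg
      have e : recip = fun y => -recip (-y) := by funext y; rw [recip_neg, neg_neg]
      rw [e]
      norm_num at h2 ⊢
      exact h2
  · have h0 : x ≠ 0 := by rintro rfl; norm_num at h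
    rw [recipDeriv_of_ge h.le]
    refine (hasDerivAt_inv h0).congr_of_eventuallyEq ?_
    filter_upwards [continuous_abs.continuousAt.eventually (lt_mem_nhds h)] with y hy
    rw [recip, if_pos (show 1 ≤ |y| from le_of_lt hy)]

lemma abs_recip_le (y : ℝ) : |recip y| ≤ 2 := by
  rw [recip]
  split_ifs with h
  · rw [abs_inv]
    exact (inv_le_one_of_one_le₀ h).trans one_le_two
  · obtain ⟨h1, h2⟩ := abs_lt.1 (not_le.1 h)
    rw [abs_le]
    constructor <;> nlinarith [sq_nonneg y, sq_nonneg (y - 1), sq_nonneg (y + 1)]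

lemma abs_recipDeriv_le (y : ℝ) : |recipDeriv y| ≤ 2 := by
  rcases le_total |y| 1 with h | h
  · rw [recipDeriv_of_le h]
    have : y ^ 2 ≤ 1 := by rw [← sq_abs]; nlinarith [abs_nonneg y]
    rw [abs_le]
    constructor <;> nlinarith [sq_nonneg y]
  · rw [recipDeriv_of_ge h, abs_neg, abs_inv]
    have : 1 ≤ |y ^ 2| := by rw [abs_pow]; exact one_le_pow₀ h
    exact (inv_le_one_of_one_le₀ this).trans one_le_two

lemma abs_recipDeriv_sub_le (x y : ℝ) : |recipDeriv x - recipDeriv y| ≤ 8 * |x - y| := by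
  have hxy : |(|x| - |y|)| ≤ |x - y| := abs_abs_sub_abs_le_abs_sub x y
  have h1 : |(min |x| 1) - min |y| 1| ≤ |x - y| :=
    (abs_min_sub_min_le_max _ _ _ _).trans (max_le hxy (by simp))
  have h2 : |(max |x| 1) - max |y| 1| ≤ |x - y| :=
    (abs_max_sub_max_le_max _ _ _ _).trans (max_le hxy (by simp))
  rw [recipDeriv, recipDeriv]
  set u := min |x| 1 with hu
  set v := min |y| 1 with hv
  set p := max |x| 1 with hp
  set q := max |y| 1 with hq
  have hu0 : 0 ≤ u := le_min (abs_nonneg _) zero_le_one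
  have hv0 : 0 ≤ v := le_min (abs_nonneg _) zero_le_one
  have hu1 : u ≤ 1 := min_le_right _ _
  have hv1 : v ≤ 1 := min_le_right _ _
  have hp1 : 1 ≤ p := le_max_right _ _
  have hq1 : 1 ≤ q := le_max_right _ _
  have h3 : |u ^ 2 - v ^ 2| ≤ 2 * |x - y| := by
    rw [sq_sub_sq, abs_mul]
    refine mul_le_mul ?_ h1 (abs_nonneg _) zero_le_two
    rw [abs_of_nonneg (by linarith)]; linarith
  have h4 : |(p ^ 2)⁻¹ - (q ^ 2)⁻¹| ≤ 2 * |x - y| := by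
    have e : (p ^ 2)⁻¹ - (q ^ 2)⁻¹ = (p⁻¹ + q⁻¹) * (p⁻¹ * q⁻¹) * (q - p) := by
      field_simp
      ring
    have hp' := inv_le_one_of_one_le₀ hp1
    have hq' := inv_le_one_of_one_le₀ hq1
    have hp0 : 0 ≤ p⁻¹ := by positivity
    have hq0 : 0 ≤ q⁻¹ := by positivity
    rw [e, abs_mul, abs_sub_comm q p]
    refine mul_le_mul ?_ h2 (abs_nonneg _) zero_le_two
    rw [abs_of_nonneg (by positivity)]
    have : p⁻¹ * q⁻¹ ≤ 1 := mul_le_one₀ hp' hq0 hq'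
    nlinarith [mul_nonneg hp0 hq0]
  have e : 3 - 3 * u ^ 2 - (p ^ 2)⁻¹ - (3 - 3 * v ^ 2 - (q ^ 2)⁻¹)
      = -(3 * (u ^ 2 - v ^ 2) + ((p ^ 2)⁻¹ - (q ^ 2)⁻¹)) := by ring
  rw [e, abs_neg]
  refine (abs_add_le _ _).trans ?_
  rw [abs_mul, abs_of_pos (by norm_num : (0 : ℝ) < 3)]
  linarith

lemma abs_recip_sub_le (x y : ℝ) : |recip x - recip y| ≤ 2 * |x - y| :=
  convex_univ.norm_image_sub_le_of_norm_hasDerivWithin_le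
    (fun z _ => (hasDerivAt_recip z).hasDerivWithinAt) (fun z _ => abs_recipDeriv_le z)
    (Set.mem_univ y) (Set.mem_univ x)

/-- Second differences of `recip`: the mean value theorem along the segments from `y₁` to `x₁` and
from `y₂` to `x₂`. -/
lemma abs_recip_second_diff_le (x₁ y₁ x₂ y₂ : ℝ) :
    |(recip x₁ - recip y₁) - (recip x₂ - recip y₂)|
      ≤ 2 * |(x₁ - y₁) - (x₂ - y₂)| + 8 * ((|x₁ - x₂| + |y₁ - y₂|) * |x₂ - y₂|) := by
  set φ : ℝ → ℝ := fun t => recip (y₁ + t * (x₁ - y₁)) - recip (y₂ + t * (x₂ - y₂)) with hφ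
  have hline : ∀ (u v t : ℝ), HasDerivAt (fun t : ℝ => recip (u + t * v))
      (recipDeriv (u + t * v) * v) t := by
    intro u v t
    have h1 : HasDerivAt (fun t : ℝ => u + t * v) v t := by
      simpa using ((hasDerivAt_id t).mul_const v).const_add u
    exact (hasDerivAt_recip _).comp t h1
  have hd : ∀ t ∈ Set.Icc (0 : ℝ) 1, HasDerivWithinAt φ
      (recipDeriv (y₁ + t * (x₁ - y₁)) * (x₁ - y₁) - recipDeriv (y₂ + t * (x₂ - y₂)) * (x₂ - y₂))
      (Set.Icc 0 1) t := fun t _ => ((hline _ _ t).sub (hline _ _ t)).hasDerivWithinAt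
  have hb : ∀ t ∈ Set.Icc (0 : ℝ) 1,
      ‖recipDeriv (y₁ + t * (x₁ - y₁)) * (x₁ - y₁) - recipDeriv (y₂ + t * (x₂ - y₂)) * (x₂ - y₂)‖
      ≤ 2 * |(x₁ - y₁) - (x₂ - y₂)| + 8 * ((|x₁ - x₂| + |y₁ - y₂|) * |x₂ - y₂|) := by
    intro t ht
    set p₁ := y₁ + t * (x₁ - y₁) with hp₁
    set p₂ := y₂ + t * (x₂ - y₂) with hp₂
    have e : recipDeriv p₁ * (x₁ - y₁) - recipDeriv p₂ * (x₂ - y₂)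
        = recipDeriv p₁ * ((x₁ - y₁) - (x₂ - y₂))
          + (recipDeriv p₁ - recipDeriv p₂) * (x₂ - y₂) := by
      ring
    have hp : |p₁ - p₂| ≤ |x₁ - x₂| + |y₁ - y₂| := by
      have e2 : p₁ - p₂ = t * (x₁ - x₂) + (1 - t) * (y₁ - y₂) := by rw [hp₁, hp₂]; ring
      rw [e2]
      refine (abs_add_le _ _).trans ?_
      rw [abs_mul, abs_mul, abs_of_nonneg ht.1, abs_of_nonneg (sub_nonneg.2 ht.2)]
      nlinarith [abs_nonneg (x₁ - x₂), abs_nonneg (y₁ - y₂), ht.1, ht.2]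
    rw [e, Real.norm_eq_abs]
    refine (abs_add_le _ _).trans (add_le_add ?_ ?_)
    · rw [abs_mul]
      exact mul_le_mul_of_nonneg_right (abs_recipDeriv_le _) (abs_nonneg _)
    · rw [abs_mul, ← mul_assoc]
      exact mul_le_mul_of_nonneg_right ((abs_recipDeriv_sub_le _ _).trans (by linarith))
        (abs_nonneg _)
  have := (convex_Icc (0 : ℝ) 1).norm_image_sub_le_of_norm_hasDerivWithin_le hd hb
    (Set.left_mem_Icc.2 zero_le_one) (Set.right_mem_Icc.2 zero_le_one)
  rw [Real.norm_eq_abs, sub_zero, norm_one, mul_one] at this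
  refine le_trans (le_of_eq ?_) this
  simp only [hφ, one_mul, zero_mul, add_zero, add_sub_cancel]
  congr 1
  ring

/-- The reciprocal `1/x`, smoothed for `|x| ≤ a`. -/
def cutInv (a x : ℝ) : ℝ := a⁻¹ * recip (a⁻¹ * x)

lemma cutInv_of_le {a x : ℝ} (ha : 0 < a) (h : a ≤ |x|) : cutInv a x = x⁻¹ := by
  rw [cutInv, recip, if_pos, mul_inv, inv_inv, ← mul_assoc, inv_mul_cancel₀ ha.ne', one_mul]
  rw [abs_mul, abs_inv, abs_of_pos ha, inv_mul_eq_div, one_le_div ha]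
  exact h

lemma enorm_le_ofReal_mul {x y c : ℝ} (hc : 0 ≤ c) (h : |x| ≤ c * |y|) :
    ‖x‖ₑ ≤ ENNReal.ofReal c * ‖y‖ₑ := by
  rw [← ofReal_norm, ← ofReal_norm, ← ENNReal.ofReal_mul hc]
  exact ENNReal.ofReal_le_ofReal h

lemma enorm_cutInv_le {a : ℝ} (ha : 0 < a) (x : ℝ) :
    ‖cutInv a x‖ₑ ≤ ENNReal.ofReal (2 * a⁻¹) := by
  rw [← ofReal_norm, Real.norm_eq_abs, cutInv, abs_mul, abs_of_pos (inv_pos.2 ha), mul_comm]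
  gcongr
  exact abs_recip_le _

lemma enorm_cutInv_sub_le {a : ℝ} (ha : 0 < a) (x y : ℝ) :
    ‖cutInv a x - cutInv a y‖ₑ ≤ ENNReal.ofReal (2 * a⁻¹ ^ 2) * ‖x - y‖ₑ := by
  refine enorm_le_ofReal_mul (by positivity) ?_
  have ha' := inv_pos.2 ha
  rw [cutInv, cutInv, ← mul_sub, abs_mul, abs_of_pos ha']
  have := abs_recip_sub_le (a⁻¹ * x) (a⁻¹ * y)
  rw [← mul_sub, abs_mul, abs_of_pos ha'] at this
  calc a⁻¹ * _ ≤ a⁻¹ * (2 * (a⁻¹ * |x - y|)) := by gcongr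
    _ = _ := by ring

lemma enorm_cutInv_second_diff_le {a : ℝ} (ha : 0 < a) (x₁ y₁ x₂ y₂ : ℝ) :
    ‖(cutInv a x₁ - cutInv a y₁) - (cutInv a x₂ - cutInv a y₂)‖ₑ
      ≤ ENNReal.ofReal (2 * a⁻¹ ^ 2) * ‖(x₁ - y₁) - (x₂ - y₂)‖ₑ
        + ENNReal.ofReal (8 * a⁻¹ ^ 3) * ((‖x₁ - x₂‖ₑ + ‖y₁ - y₂‖ₑ) * ‖x₂ - y₂‖ₑ) := by
  have ha' := inv_pos.2 ha
  simp only [← ofReal_norm, Real.norm_eq_abs]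
  rw [← ENNReal.ofReal_add (abs_nonneg _) (abs_nonneg _), ← ENNReal.ofReal_mul (by positivity),
    ← ENNReal.ofReal_mul (by positivity), ← ENNReal.ofReal_mul (by positivity),
    ← ENNReal.ofReal_add (by positivity) (by positivity)]
  refine ENNReal.ofReal_le_ofReal ?_
  have := abs_recip_second_diff_le (a⁻¹ * x₁) (a⁻¹ * y₁) (a⁻¹ * x₂) (a⁻¹ * y₂)
  simp only [← mul_sub, abs_mul, abs_of_pos ha'] at this
  simp only [cutInv, ← mul_sub, abs_mul, abs_of_pos ha']
  refine (mul_le_mul_of_nonneg_left this ha'.le).trans (le_of_eq ?_)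
  ring

/-! ### The homological equation -/

/-- The strength `max(|j³ - j'³|, 1)` of the small divisor conditions. -/
def cubeGap (j j' : Mode) : ℝ := max |((j : ℤ) : ℝ) ^ 3 - ((j' : ℤ) : ℝ) ^ 3| 1

/-- The size below which the small divisors are modified. -/
def divThreshold (κ : ℝ) (ℓ : Idx) (j j' : Mode) : ℝ := κ * cubeGap j j' / dd ℓ

/-- The Fourier multiplier solving the homological equation, with the reciprocals of the small
divisors modified below the threshold, so that it is defined for all frequencies. -/
def cutMult (κ η N : ℝ) (ω : Freq) (Om : Mode → ℝ) : TOp := fun ℓ j j' =>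
  open Classical in
  if (ℓ = 0 ∧ j = j') ∨ N < wt η ℓ then 0
  else Complex.I * ((cutInv (divThreshold κ ℓ j j') (dot ω ℓ + Om j - Om j') : ℝ) : ℂ)

lemma one_le_cubeGap (j j' : Mode) : 1 ≤ cubeGap j j' := le_max_right _ _

lemma divThreshold_pos {κ : ℝ} (hκ : 0 < κ) (ℓ : Idx) (j j' : Mode) :
    0 < divThreshold κ ℓ j j' := by
  have := one_le_dd ℓ
  have := one_le_cubeGap j j'
  unfold divThreshold
  positivity

lemma homSol_eq_cutMult_mul {κ η N : ℝ} (hκ : 0 < κ) {ω : Freq} {Om : Mode → ℝ}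
    (h : ∀ (ℓ : Idx) (j j' : Mode), ¬ (ℓ = 0 ∧ j = j') → wt η ℓ ≤ N →
      divThreshold κ ℓ j j' ≤ |dot ω ℓ + Om j - Om j'|) (P : TOp) :
    homSol η N ω Om P = cutMult κ η N ω Om * P := by
  classical
  funext ℓ j j'
  simp only [homSol, cutMult, Pi.mul_apply]
  split_ifs with hc
  · simp
  · push Not at hc
    rw [cutInv_of_le (divThreshold_pos hκ ℓ j j')
      (h ℓ j j' (fun h' => hc.1 h'.1 h'.2) hc.2), Complex.ofReal_inv, div_eq_mul_inv, mul_inv,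
      Complex.inv_I]
    ring

lemma abs_sub_le_cube (j j' : Mode) :
    |((j : ℤ) : ℝ) - ((j' : ℤ) : ℝ)| ≤ |((j : ℤ) : ℝ) ^ 3 - ((j' : ℤ) : ℝ) ^ 3| := by
  obtain ⟨j, hj⟩ := j
  obtain ⟨j', hj'⟩ := j'
  have e : (j : ℝ) ^ 3 - (j' : ℝ) ^ 3 = ((j : ℝ) - j') * ((j : ℝ) ^ 2 + j * j' + (j' : ℝ) ^ 2) := by
    ring
  simp only
  rw [e, abs_mul]
  refine le_mul_of_one_le_right (abs_nonneg _) (le_trans ?_ (le_abs_self _))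
  have h1 : (1 : ℝ) ≤ (j : ℝ) ^ 2 := by
    have : 1 ≤ j ^ 2 := by have := sq_pos_of_ne_zero hj; omega
    exact_mod_cast this
  have h2 : (1 : ℝ) ≤ (j' : ℝ) ^ 2 := by
    have : 1 ≤ j' ^ 2 := by have := sq_pos_of_ne_zero hj'; omega
    exact_mod_cast this
  nlinarith [sq_nonneg ((j : ℝ) + j')]

lemma one_le_abs_cube_sub {j j' : Mode} (h : j ≠ j') :
    1 ≤ |((j : ℤ) : ℝ) ^ 3 - ((j' : ℤ) : ℝ) ^ 3| := by
  refine le_trans ?_ (abs_sub_le_cube j j')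
  have : (1 : ℤ) ≤ |(j : ℤ) - (j' : ℤ)| :=
    Int.one_le_abs (sub_ne_zero.2 fun h' => h (Subtype.ext h'))
  exact_mod_cast this

lemma sum_abs_le_dd (ℓ : Idx) : ∑ i ∈ ℓ.support, |((ℓ i : ℤ) : ℝ)| ≤ dd ℓ := by
  have key : ∀ s ⊆ ℓ.support, 1 + ∑ i ∈ s, |((ℓ i : ℤ) : ℝ)|
      ≤ ∏ i ∈ s, (1 + |((ℓ i : ℤ) : ℝ)| ^ 5 * ((i : ℕ) : ℝ) ^ 5) := by
    intro s
    induction s using Finset.induction_on with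
    | empty => simp
    | insert i s hi ih =>
      intro hs
      rw [Finset.sum_insert hi, Finset.prod_insert hi]
      have ih' := ih ((Finset.subset_insert i s).trans hs)
      have hi1 : (1 : ℝ) ≤ ((i : ℕ) : ℝ) := by exact_mod_cast i.pos
      have hn : (1 : ℝ) ≤ |((ℓ i : ℤ) : ℝ)| := by
        exact_mod_cast Int.one_le_abs
          (Finsupp.mem_support_iff.1 (hs (Finset.mem_insert_self i s)))
      have h1 : |((ℓ i : ℤ) : ℝ)| ≤ |((ℓ i : ℤ) : ℝ)| ^ 5 * ((i : ℕ) : ℝ) ^ 5 :=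
        (le_self_pow₀ hn (by norm_num)).trans
          (le_mul_of_one_le_right (by positivity) (one_le_pow₀ hi1))
      have h2 : 0 ≤ ∑ i ∈ s, |((ℓ i : ℤ) : ℝ)| := Finset.sum_nonneg fun _ _ => abs_nonneg _
      calc 1 + (|((ℓ i : ℤ) : ℝ)| + ∑ i ∈ s, |((ℓ i : ℤ) : ℝ)|)
          ≤ (1 + |((ℓ i : ℤ) : ℝ)|) * (1 + ∑ i ∈ s, |((ℓ i : ℤ) : ℝ)|) := by nlinarith
        _ ≤ _ := by gcongr
  have := key ℓ.support subset_rfl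
  have e : dd ℓ = ∏ i ∈ ℓ.support, (1 + |((ℓ i : ℤ) : ℝ)| ^ 5 * ((i : ℕ) : ℝ) ^ 5) := rfl
  rw [e]
  linarith

lemma enorm_dot_sub_le (ω₁ ω₂ : Freq) (ℓ : Idx) :
    ‖dot ω₁ ℓ - dot ω₂ ℓ‖ₑ ≤ ENNReal.ofReal (dd ℓ) * supDist ω₁ ω₂ := by
  have e : dot ω₁ ℓ - dot ω₂ ℓ = ∑ i ∈ ℓ.support, (ω₁ i - ω₂ i) * ((ℓ i : ℤ) : ℝ) := by
    simp only [dot, Finsupp.sum, ← Finset.sum_sub_distrib, sub_mul]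
  rw [e]
  calc _ ≤ ∑ i ∈ ℓ.support, ‖(ω₁ i - ω₂ i) * ((ℓ i : ℤ) : ℝ)‖ₑ := enorm_sum_le _ _
    _ ≤ ∑ i ∈ ℓ.support, ENNReal.ofReal |((ℓ i : ℤ) : ℝ)| * supDist ω₁ ω₂ := by
        refine Finset.sum_le_sum fun i _ => ?_
        rw [enorm_mul, mul_comm, ← ofReal_norm ((ℓ i : ℤ) : ℝ), Real.norm_eq_abs]
        gcongr
        exact le_iSup (fun i => ‖ω₁ i - ω₂ i‖ₑ) i
    _ = ENNReal.ofReal (∑ i ∈ ℓ.support, |((ℓ i : ℤ) : ℝ)|) * supDist ω₁ ω₂ := by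
        rw [← Finset.sum_mul, ENNReal.ofReal_sum_of_nonneg fun _ _ => abs_nonneg _]
    _ ≤ _ := by
        gcongr
        exact sum_abs_le_dd ℓ

/-- The scale of operators depending on `ω ∈ Ω` in a Lipschitz way. -/
def lipScale (η γ : ℝ) (Ω : Set Freq) : OpScale η (Ω × Unit) :=
  (OpScale.point η).fam (ENNReal.ofReal γ) fun x y : Ω => supDist x.1 y.1

/-- The scale of pairs of families depending on `ω ∈ Ω`: it measures the weighted Lipschitz norms
of both members, and `1/s` times that of their difference. -/
def pairScale (η γ s : ℝ) (Ω : Set Freq) : OpScale η (Bool × (Ω × Unit)) :=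
  (lipScale η γ Ω).fam 1 fun _ _ => ENNReal.ofReal s

lemma pairScale_mlt_le {η γ s Δ : ℝ} {Ω : Set Freq} (hs : 0 < s)
    {g : Bool × (Ω × Unit) → TOp} {M : ℝ≥0∞}
    (h1 : ∀ b x, multNorm η Δ (g (b, x, ())) ≤ M)
    (h2 : ∀ b x y, x ≠ y → ENNReal.ofReal γ *
      (multNorm η Δ (g (b, x, ()) - g (b, y, ())) / supDist x.1 y.1) ≤ M)
    (h3 : ∀ b b' x, b ≠ b' → multNorm η Δ (g (b, x, ()) - g (b', x, ())) ≤ M * ENNReal.ofReal s)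
    (h4 : ∀ b b' x y, b ≠ b' → x ≠ y → ENNReal.ofReal γ *
      (multNorm η Δ ((g (b, x, ()) - g (b', x, ())) - (g (b, y, ()) - g (b', y, ())))
        / supDist x.1 y.1) ≤ M * ENNReal.ofReal s) :
    (pairScale η γ s Ω).mlt Δ g ≤ 4 * M := by
  have hs' : ENNReal.ofReal s ≠ 0 := by simpa using hs
  have : (4 : ℝ≥0∞) * M = (M + M) + (M + M) := by ring
  rw [this]
  refine famNorm_le (fun b => famNorm_le (fun x => h1 b x) fun x y h => h2 b x y h)
    fun b b' hb => ?_
  rw [one_mul]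
  refine ENNReal.div_le_of_le_mul ?_
  rw [add_mul]
  exact famNorm_le (fun x => h3 b b' x hb) fun x y h => h4 b b' x y hb h

lemma mul_multNorm_div_le_iff {η Δ : ℝ} {w d b : ℝ≥0∞} {g : TOp} :
    w * (multNorm η Δ g / d) ≤ b ↔
      ∀ ℓ j j', expWt η (-Δ) ℓ * (w * (‖g ℓ j j'‖ₑ / d)) ≤ b := by
  have e : ∀ ℓ j j', expWt η (-Δ) ℓ * (w * (‖g ℓ j j'‖ₑ / d))
      = w * ((expWt η (-Δ) ℓ * ‖g ℓ j j'‖ₑ) / d) := by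
    intro ℓ j j'
    simp only [div_eq_mul_inv]
    ring
  simp only [e, multNorm, ENNReal.iSup_div, ENNReal.mul_iSup, iSup_le_iff]

/-- The variation of the divisors with the unknown part of the eigenvalues. -/
lemma scl_divisor_le {η : ℝ} {I : Type} (S : OpScale η I) {l3 l1 : I → ℝ} {r : I → Mode → ℝ}
    (h3 : S.scl (fun x => l3 x - 1) ≤ 3) (h1 : S.scl l1 ≤ 3)
    (hr : ∀ j, S.scl (fun x => r x j) ≤ 1) (j j' : Mode) :
    S.scl (fun x => -(((j : ℤ) : ℝ) ^ 3 - ((j' : ℤ) : ℝ) ^ 3) * (l3 x - 1)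
      + (((j : ℤ) : ℝ) - ((j' : ℤ) : ℝ)) * l1 x + r x j + -1 * r x j')
      ≤ ENNReal.ofReal (8 * cubeGap j j') := by
  have hW := one_le_cubeGap j j'
  set c3 := ((j : ℤ) : ℝ) ^ 3 - ((j' : ℤ) : ℝ) ^ 3 with hc3
  set c1 := ((j : ℤ) : ℝ) - ((j' : ℤ) : ℝ) with hc1
  have hc3W : ‖-c3‖ₑ ≤ ENNReal.ofReal (cubeGap j j') := by
    rw [enorm_neg, ← ofReal_norm]
    exact ENNReal.ofReal_le_ofReal (le_max_left _ _)
  have hc1W : ‖c1‖ₑ ≤ ENNReal.ofReal (cubeGap j j') := by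
    rw [← ofReal_norm]
    exact ENNReal.ofReal_le_ofReal ((abs_sub_le_cube j j').trans (le_max_left _ _))
  refine (S.scl_add (fun x => -c3 * (l3 x - 1) + c1 * l1 x + r x j) fun x => -1 * r x j').trans ?_
  have t4 := (S.scl_smul (-1) fun x => r x j').trans (mul_le_mul' le_rfl (hr j'))
  have t3 := hr j
  have t2 := (S.scl_smul c1 l1).trans (mul_le_mul' hc1W h1)
  have t1 := (S.scl_smul (-c3) fun x => l3 x - 1).trans (mul_le_mul' hc3W h3)
  have t := add_le_add ((S.scl_add (fun x => -c3 * (l3 x - 1) + c1 * l1 x) fun x => r x j).trans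
    (add_le_add ((S.scl_add (fun x => -c3 * (l3 x - 1)) fun x => c1 * l1 x).trans
      (add_le_add t1 t2)) t3)) t4
  refine t.trans ?_
  have e1 : ‖(-1 : ℝ)‖ₑ * 1 = ENNReal.ofReal 1 := by simp
  have e3 : (3 : ℝ≥0∞) = ENNReal.ofReal 3 := by simp
  rw [e1, e3, ← ENNReal.ofReal_one, ← ENNReal.ofReal_mul (by positivity),
    ← ENNReal.ofReal_add (by positivity) (by positivity),
    ← ENNReal.ofReal_add (by positivity) (by positivity),
    ← ENNReal.ofReal_add (by positivity) (by positivity)]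
  exact ENNReal.ofReal_le_ofReal (by linarith)

lemma famNorm_pair_diff_le {Y : Type} [Sub Y] {n : Y → ℝ≥0∞} {s : ℝ} (hs : 0 < s)
    {f : Bool → Y} {c : ℝ≥0∞} (h : famNorm 1 (fun _ _ => ENNReal.ofReal s) n f ≤ c) {b b' : Bool}
    (hb : b ≠ b') : n (f b - f b') ≤ c * ENNReal.ofReal s := by
  have h1 := (le_famNorm_diff (w := 1) (d := fun _ _ => ENNReal.ofReal s) n f hb).trans h
  rw [one_mul] at h1
  rwa [ENNReal.div_le_iff (by simpa using hs) ENNReal.ofReal_ne_top] at h1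

/-- The four quantities entering the norm of a pair of families of numbers. -/
lemma bounds_of_pairScale_scl_le {η γ s : ℝ} (hs : 0 < s) {Ω : Set Freq}
    {B : Bool × (Ω × Unit) → ℝ} {c : ℝ≥0∞} (h : (pairScale η γ s Ω).scl B ≤ c) :
    (∀ b x y, x ≠ y → ENNReal.ofReal γ *
      (‖B (b, x, ()) - B (b, y, ())‖ₑ / supDist x.1 y.1) ≤ c) ∧
    (∀ b b' x, b ≠ b' → ‖B (b, x, ()) - B (b', x, ())‖ₑ ≤ c * ENNReal.ofReal s) ∧
    (∀ b b' x y, b ≠ b' → x ≠ y → ENNReal.ofReal γ *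
      (‖(B (b, x, ()) - B (b', x, ())) - (B (b, y, ()) - B (b', y, ()))‖ₑ
        / supDist x.1 y.1) ≤ c * ENNReal.ofReal s) := by
  have h1 : ∀ b, famNorm (ENNReal.ofReal γ) (fun x y : Ω => supDist x.1 y.1)
      ((OpScale.point η).scl) (fun x i => B (b, x, i)) ≤ c := fun b =>
    (le_famNorm (lipScale η γ Ω).scl (fun b i => B (b, i)) b).trans h
  have h2 : ∀ b b', b ≠ b' → famNorm (ENNReal.ofReal γ) (fun x y : Ω => supDist x.1 y.1)
      ((OpScale.point η).scl) (fun x i => B (b, x, i) - B (b', x, i)) ≤ c * ENNReal.ofReal s :=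
    fun b b' hb => famNorm_pair_diff_le (n := (lipScale η γ Ω).scl)
      (f := fun b i => B (b, i)) hs h hb
  refine ⟨fun b x y hxy => ?_, fun b b' x hb => ?_, fun b b' x y hb hxy => ?_⟩
  · exact (le_famNorm_diff (OpScale.point η).scl (fun x i => B (b, x, i)) hxy).trans (h1 b)
  · exact (le_famNorm (OpScale.point η).scl (fun x i => B (b, x, i) - B (b', x, i)) x).trans
      (h2 b b' hb)
  · exact (le_famNorm_diff (OpScale.point η).scl
      (fun x i => B (b, x, i) - B (b', x, i)) hxy).trans (h2 b b' hb)

lemma exists_cutMult_coeff (κ η N : ℝ) (ℓ : Idx) (j j' : Mode) :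
    ∃ c : ℂ, ‖c‖ₑ ≤ 1 ∧ ∀ ω Om, cutMult κ η N ω Om ℓ j j'
      = c * ((cutInv (divThreshold κ ℓ j j') (dot ω ℓ + Om j - Om j') : ℝ) : ℂ) := by
  classical
  by_cases h : (ℓ = 0 ∧ j = j') ∨ N < wt η ℓ
  · exact ⟨0, by simp, fun ω Om => by simp only [cutMult, if_pos h, zero_mul]⟩
  · refine ⟨Complex.I, ?_, fun ω Om => by simp only [cutMult, if_neg h]⟩
    rw [← ofReal_norm, Complex.norm_I, ENNReal.ofReal_one]

lemma enorm_mul_ofReal_le {c : ℂ} (hc : ‖c‖ₑ ≤ 1) (r : ℝ) : ‖c * (r : ℂ)‖ₑ ≤ ‖r‖ₑ := by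
  rw [enorm_mul]
  refine (mul_le_of_le_one_left' hc).trans (le_of_eq ?_)
  rw [← ofReal_norm, ← ofReal_norm, Complex.norm_real]

lemma mul_enorm_cutInv_sub_div_le {a V K x y : ℝ} {w d : ℝ≥0∞} {c : ℂ} (ha : 0 < a)
    (hc : ‖c‖ₑ ≤ 1) (hK : 2 * a⁻¹ ^ 2 * V ≤ K) (h : w * (‖x - y‖ₑ / d) ≤ ENNReal.ofReal V) :
    w * (‖c * (cutInv a x : ℂ) - c * (cutInv a y : ℂ)‖ₑ / d) ≤ ENNReal.ofReal K := by
  have e : c * (cutInv a x : ℂ) - c * (cutInv a y : ℂ)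
      = c * ((cutInv a x - cutInv a y : ℝ) : ℂ) := by push_cast; ring
  have hpos : 0 ≤ 2 * a⁻¹ ^ 2 := by positivity
  rw [e]
  calc w * (‖c * ((cutInv a x - cutInv a y : ℝ) : ℂ)‖ₑ / d)
      ≤ w * (ENNReal.ofReal (2 * a⁻¹ ^ 2) * ‖x - y‖ₑ / d) :=
        mul_le_mul' le_rfl (ENNReal.div_le_div_right
          ((enorm_mul_ofReal_le hc _).trans (enorm_cutInv_sub_le ha _ _)) _)
    _ = ENNReal.ofReal (2 * a⁻¹ ^ 2) * (w * (‖x - y‖ₑ / d)) := by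
        simp only [div_eq_mul_inv]; ring
    _ ≤ ENNReal.ofReal (2 * a⁻¹ ^ 2) * ENNReal.ofReal V := mul_le_mul' le_rfl h
    _ ≤ ENNReal.ofReal K := by
        rw [← ENNReal.ofReal_mul hpos]
        exact ENNReal.ofReal_le_ofReal hK

lemma enorm_cutInv_sub_le_mul {a U K x y : ℝ} {s : ℝ≥0∞} {c : ℂ} (ha : 0 < a)
    (hc : ‖c‖ₑ ≤ 1) (hK : 2 * a⁻¹ ^ 2 * U ≤ K) (h : ‖x - y‖ₑ ≤ ENNReal.ofReal U * s) :
    ‖c * (cutInv a x : ℂ) - c * (cutInv a y : ℂ)‖ₑ ≤ ENNReal.ofReal K * s := by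
  have e : c * (cutInv a x : ℂ) - c * (cutInv a y : ℂ)
      = c * ((cutInv a x - cutInv a y : ℝ) : ℂ) := by push_cast; ring
  have hpos : 0 ≤ 2 * a⁻¹ ^ 2 := by positivity
  rw [e]
  refine (enorm_mul_ofReal_le hc _).trans ((enorm_cutInv_sub_le ha _ _).trans
    ((mul_le_mul' le_rfl h).trans ?_))
  rw [← mul_assoc, ← ENNReal.ofReal_mul hpos]
  exact mul_le_mul' (ENNReal.ofReal_le_ofReal hK) le_rfl

lemma mul_enorm_cutInv_second_diff_div_le {a U V K x₁ y₁ x₂ y₂ : ℝ} {w d s : ℝ≥0∞} {c : ℂ}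
    (ha : 0 < a) (hU : 0 ≤ U) (hV : 0 ≤ V) (hc : ‖c‖ₑ ≤ 1)
    (hK : 2 * a⁻¹ ^ 2 * U + 8 * a⁻¹ ^ 3 * ((V + V) * U) ≤ K)
    (h1 : w * (‖(x₁ - y₁) - (x₂ - y₂)‖ₑ / d) ≤ ENNReal.ofReal U * s)
    (h2 : w * (‖x₁ - x₂‖ₑ / d) ≤ ENNReal.ofReal V) (h3 : w * (‖y₁ - y₂‖ₑ / d) ≤ ENNReal.ofReal V)
    (h4 : ‖x₂ - y₂‖ₑ ≤ ENNReal.ofReal U * s) :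
    w * (‖(c * (cutInv a x₁ : ℂ) - c * (cutInv a y₁ : ℂ))
      - (c * (cutInv a x₂ : ℂ) - c * (cutInv a y₂ : ℂ))‖ₑ / d) ≤ ENNReal.ofReal K * s := by
  have e : (c * (cutInv a x₁ : ℂ) - c * (cutInv a y₁ : ℂ))
      - (c * (cutInv a x₂ : ℂ) - c * (cutInv a y₂ : ℂ))
      = c * (((cutInv a x₁ - cutInv a y₁) - (cutInv a x₂ - cutInv a y₂) : ℝ) : ℂ) := by
    push_cast; ring
  have p2 : 0 ≤ 2 * a⁻¹ ^ 2 := by positivity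
  have p3 : 0 ≤ 8 * a⁻¹ ^ 3 := by positivity
  have pV : 0 ≤ V + V := add_nonneg hV hV
  rw [e]
  calc w * (‖c * (((cutInv a x₁ - cutInv a y₁) - (cutInv a x₂ - cutInv a y₂) : ℝ) : ℂ)‖ₑ / d)
      ≤ w * ((ENNReal.ofReal (2 * a⁻¹ ^ 2) * ‖(x₁ - y₁) - (x₂ - y₂)‖ₑ
        + ENNReal.ofReal (8 * a⁻¹ ^ 3) * ((‖x₁ - x₂‖ₑ + ‖y₁ - y₂‖ₑ) * ‖x₂ - y₂‖ₑ)) / d) :=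
        mul_le_mul' le_rfl (ENNReal.div_le_div_right
          ((enorm_mul_ofReal_le hc _).trans (enorm_cutInv_second_diff_le ha _ _ _ _)) _)
    _ = ENNReal.ofReal (2 * a⁻¹ ^ 2) * (w * (‖(x₁ - y₁) - (x₂ - y₂)‖ₑ / d))
        + ENNReal.ofReal (8 * a⁻¹ ^ 3) * ((w * (‖x₁ - x₂‖ₑ / d)
          + w * (‖y₁ - y₂‖ₑ / d)) * ‖x₂ - y₂‖ₑ) := by
        simp only [div_eq_mul_inv]; ring
    _ ≤ ENNReal.ofReal (2 * a⁻¹ ^ 2) * (ENNReal.ofReal U * s)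
        + ENNReal.ofReal (8 * a⁻¹ ^ 3) * ((ENNReal.ofReal V + ENNReal.ofReal V)
          * (ENNReal.ofReal U * s)) :=
        add_le_add (mul_le_mul' le_rfl h1) (mul_le_mul' le_rfl
          (mul_le_mul' (add_le_add h2 h3) h4))
    _ = ENNReal.ofReal (2 * a⁻¹ ^ 2 * U + 8 * a⁻¹ ^ 3 * ((V + V) * U)) * s := by
        rw [ENNReal.ofReal_add (mul_nonneg p2 hU) (mul_nonneg p3 (mul_nonneg pV hU)),
          ENNReal.ofReal_mul p2, ENNReal.ofReal_mul p3, ENNReal.ofReal_mul pV,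
          ENNReal.ofReal_add hV hV]
        ring
    _ ≤ ENNReal.ofReal K * s := mul_le_mul' (ENNReal.ofReal_le_ofReal hK) le_rfl

/-- The reciprocals of the thresholds against the powers of `𝚍(ℓ)`. -/
lemma divThreshold_inv_bounds {κ : ℝ} (hκ : 0 < κ) (hκ1 : κ ≤ 1) (ℓ : Idx) (j j' : Mode) :
    2 * (divThreshold κ ℓ j j')⁻¹ ≤ 1168 / κ ^ 4 * dd ℓ ^ 4 ∧
    2 * (divThreshold κ ℓ j j')⁻¹ ^ 2 * (dd ℓ + 8 * cubeGap j j') ≤ 1168 / κ ^ 4 * dd ℓ ^ 4 ∧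
    2 * (divThreshold κ ℓ j j')⁻¹ ^ 2 * (8 * cubeGap j j')
      + 8 * (divThreshold κ ℓ j j')⁻¹ ^ 3 * ((dd ℓ + 8 * cubeGap j j' + (dd ℓ + 8 * cubeGap j j'))
        * (8 * cubeGap j j')) ≤ 1168 / κ ^ 4 * dd ℓ ^ 4 := by
  have hd := one_le_dd ℓ
  have hW := one_le_cubeGap j j'
  set D := dd ℓ with hD
  set W := cubeGap j j' with hWdef
  have hq1 : 1 ≤ D / κ := by rw [one_le_div hκ]; linarith
  have hDq : D ≤ D / κ := by rw [le_div_iff₀ hκ]; nlinarith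
  have e : 1168 / κ ^ 4 * D ^ 4 = 1168 * (D / κ) ^ 4 := by rw [div_pow]; ring
  have ei : (divThreshold κ ℓ j j')⁻¹ = (D / κ) * W⁻¹ := by
    rw [divThreshold, ← hD, ← hWdef]
    field_simp
  rw [e, ei]
  set q := D / κ with hq
  have hW0 : 0 < W⁻¹ := by positivity
  have hW1 : W⁻¹ ≤ 1 := inv_le_one_of_one_le₀ hW
  have hWW : W⁻¹ * W = 1 := inv_mul_cancel₀ (by linarith)
  have hq2 : 1 ≤ q ^ 2 := one_le_pow₀ hq1
  have hDW : D + 8 * W ≤ 9 * (q * W) := by nlinarith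
  have a1 : q * W⁻¹ ≤ q := mul_le_of_le_one_right (by linarith) hW1
  have p14 : q ≤ q ^ 4 := le_self_pow₀ hq1 (by norm_num)
  have p34 : q ^ 3 ≤ q ^ 4 := pow_le_pow_right₀ hq1 (by norm_num)
  have p24 : q ^ 2 ≤ q ^ 4 := pow_le_pow_right₀ hq1 (by norm_num)
  have q0 : 0 < q := by linarith
  refine ⟨by nlinarith, ?_, ?_⟩
  · calc 2 * (q * W⁻¹) ^ 2 * (D + 8 * W) ≤ 2 * (q * W⁻¹) ^ 2 * (9 * (q * W)) := by gcongr
      _ = 18 * q ^ 3 * W⁻¹ * (W⁻¹ * W) := by ring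
      _ ≤ 18 * q ^ 3 * 1 * 1 := by rw [hWW]; gcongr
      _ ≤ _ := by nlinarith
  · calc 2 * (q * W⁻¹) ^ 2 * (8 * W) + 8 * (q * W⁻¹) ^ 3 * ((D + 8 * W + (D + 8 * W)) * (8 * W))
        ≤ 2 * (q * W⁻¹) ^ 2 * (8 * W)
          + 8 * (q * W⁻¹) ^ 3 * ((9 * (q * W) + 9 * (q * W)) * (8 * W)) := by gcongr
      _ = 16 * q ^ 2 * W⁻¹ * (W⁻¹ * W) + 1152 * q ^ 4 * W⁻¹ * (W⁻¹ * W) ^ 2 := by ring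
      _ ≤ 16 * q ^ 2 * 1 * 1 + 1152 * q ^ 4 * 1 * 1 ^ 2 := by rw [hWW]; gcongr
      _ ≤ _ := by nlinarith

/-- The coefficients of the multiplier solving the homological equation for a pair of operators,
their Lipschitz variations, their variations with the operator, and the mixed ones. -/
lemma cutMult_coeff_bounds {η κ γ s N : ℝ} (hκ : 0 < κ) (hκ1 : κ ≤ 1) (hγ1 : γ ≤ 1) (hs : 0 < s)
    {Ω : Set Freq} {l3 l1 : Bool × (Ω × Unit) → ℝ} {r : Bool × (Ω × Unit) → Mode → ℝ}
    (h3 : (pairScale η γ s Ω).scl (fun x => l3 x - 1) ≤ 3) (h1 : (pairScale η γ s Ω).scl l1 ≤ 3)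
    (hr : ∀ j, (pairScale η γ s Ω).scl (fun x => r x j) ≤ 1) {g : Bool × (Ω × Unit) → TOp}
    (hg : ∀ x, g x = cutMult κ η N x.2.1.1
      (fun j => -l3 x * ((j : ℤ) : ℝ) ^ 3 + l1 x * ((j : ℤ) : ℝ) + r x j)) (ℓ : Idx) (j j' : Mode) :
    (∀ b x, ‖g (b, x, ()) ℓ j j'‖ₑ ≤ ENNReal.ofReal (1168 / κ ^ 4 * dd ℓ ^ 4)) ∧
    (∀ b x y, x ≠ y → ENNReal.ofReal γ *
      (‖(g (b, x, ()) - g (b, y, ())) ℓ j j'‖ₑ / supDist x.1 y.1)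
        ≤ ENNReal.ofReal (1168 / κ ^ 4 * dd ℓ ^ 4)) ∧
    (∀ b b' x, b ≠ b' → ‖(g (b, x, ()) - g (b', x, ())) ℓ j j'‖ₑ
      ≤ ENNReal.ofReal (1168 / κ ^ 4 * dd ℓ ^ 4) * ENNReal.ofReal s) ∧
    (∀ b b' x y, b ≠ b' → x ≠ y → ENNReal.ofReal γ *
      (‖((g (b, x, ()) - g (b', x, ())) - (g (b, y, ()) - g (b', y, ()))) ℓ j j'‖ₑ
        / supDist x.1 y.1) ≤ ENNReal.ofReal (1168 / κ ^ 4 * dd ℓ ^ 4) * ENNReal.ofReal s) := by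
  obtain ⟨c, hc, hgc⟩ := exists_cutMult_coeff κ η N ℓ j j'
  obtain ⟨b1, b2, b3⟩ := divThreshold_inv_bounds hκ hκ1 ℓ j j'
  have ha := divThreshold_pos hκ ℓ j j'
  set a := divThreshold κ ℓ j j' with hadef
  have ha' : 0 < a⁻¹ := inv_pos.2 ha
  have hd := one_le_dd ℓ
  have hW := one_le_cubeGap j j'
  set W := cubeGap j j' with hWdef
  have hU : 0 ≤ 8 * W := by linarith
  have hV : 0 ≤ dd ℓ + 8 * W := by linarith
  have b2' : 2 * a⁻¹ ^ 2 * (8 * W) ≤ 1168 / κ ^ 4 * dd ℓ ^ 4 :=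
    (mul_le_mul_of_nonneg_left (by linarith) (by positivity)).trans b2
  have hB := scl_divisor_le (pairScale η γ s Ω) h3 h1 hr j j'
  set B : Bool × (Ω × Unit) → ℝ := fun x =>
    -(((j : ℤ) : ℝ) ^ 3 - ((j' : ℤ) : ℝ) ^ 3) * (l3 x - 1)
    + (((j : ℤ) : ℝ) - ((j' : ℤ) : ℝ)) * l1 x + r x j + -1 * r x j' with hBdef
  set D : Bool → Ω → ℝ := fun b x => dot x.1 ℓ + B (b, x, ())
    - (((j : ℤ) : ℝ) ^ 3 - ((j' : ℤ) : ℝ) ^ 3) with hD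
  have hgD : ∀ b x, g (b, x, ()) ℓ j j' = c * ((cutInv a (D b x) : ℝ) : ℂ) := by
    intro b x
    have e : D b x = dot x.1 ℓ
        + (-l3 (b, x, ()) * ((j : ℤ) : ℝ) ^ 3 + l1 (b, x, ()) * ((j : ℤ) : ℝ) + r (b, x, ()) j)
        - (-l3 (b, x, ()) * ((j' : ℤ) : ℝ) ^ 3 + l1 (b, x, ()) * ((j' : ℤ) : ℝ)
          + r (b, x, ()) j') := by
      simp only [hD, hBdef]
      ring
    rw [e, hg]
    exact hgc _ _
  -- variations of the divisor
  obtain ⟨hBlip, hBdiff, hBmix⟩ := bounds_of_pairScale_scl_le hs hB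
  have hD2 : ∀ b b' x, b ≠ b' → ‖D b x - D b' x‖ₑ
      ≤ ENNReal.ofReal (8 * W) * ENNReal.ofReal s := by
    intro b b' x h
    have e : D b x - D b' x = B (b, x, ()) - B (b', x, ()) := by simp only [hD]; ring
    rw [e]
    exact hBdiff b b' x h
  have hD3 : ∀ b b' x y, b ≠ b' → x ≠ y → ENNReal.ofReal γ *
      (‖(D b x - D b' x) - (D b y - D b' y)‖ₑ / supDist x.1 y.1)
      ≤ ENNReal.ofReal (8 * W) * ENNReal.ofReal s := by
    intro b b' x y h hxy
    have e : (D b x - D b' x) - (D b y - D b' y)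
        = (B (b, x, ()) - B (b', x, ())) - (B (b, y, ()) - B (b', y, ())) := by
      simp only [hD]; ring
    rw [e]
    exact hBmix b b' x y h hxy
  have hD1 : ∀ b x y, x ≠ y → ENNReal.ofReal γ * (‖D b x - D b y‖ₑ / supDist x.1 y.1)
      ≤ ENNReal.ofReal (dd ℓ + 8 * W) := by
    intro b x y hxy
    have e : D b x - D b y = (dot x.1 ℓ - dot y.1 ℓ) + (B (b, x, ()) - B (b, y, ())) := by
      simp only [hD]; ring
    rw [e, ENNReal.ofReal_add (zero_le_one.trans hd) hU]
    refine (mul_le_mul' le_rfl (ENNReal.div_le_div_right (enorm_add_le _ _) _)).trans ?_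
    rw [ENNReal.add_div, mul_add]
    refine add_le_add ?_ (hBlip b x y hxy)
    refine (mul_le_of_le_one_left' (ENNReal.ofReal_le_one.2 hγ1)).trans ?_
    exact ENNReal.div_le_of_le_mul (enorm_dot_sub_le _ _ _)
  refine ⟨fun b x => ?_, fun b x y hxy => ?_, fun b b' x hb => ?_, fun b b' x y hb hxy => ?_⟩
  · rw [hgD]
    exact (enorm_mul_ofReal_le hc _).trans ((enorm_cutInv_le ha _).trans
      (ENNReal.ofReal_le_ofReal b1))
  · simp only [Pi.sub_apply, hgD]
    exact mul_enorm_cutInv_sub_div_le ha hc b2 (hD1 b x y hxy)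
  · simp only [Pi.sub_apply, hgD]
    exact enorm_cutInv_sub_le_mul ha hc b2' (hD2 b b' x hb)
  · simp only [Pi.sub_apply, hgD]
    exact mul_enorm_cutInv_second_diff_div_le ha hU hV hc b3 (hD3 b b' x y hb hxy)
      (hD1 b x y hxy) (hD1 b' x y hxy) (hD2 b b' y hb)

/-- Bound on the solution of the homological equation for pairs of operators: the multiplier loses
`Δ` of analyticity and grows at most like `e^{C Δ^{-μ}}`, together with its Lipschitz variation in
`ω` and its variation with the operator. -/
lemma pairScale_mlt_cutMult_le {η μ κ γ s C : ℝ} (hκ : 0 < κ) (hκ1 : κ ≤ 1) (hγ1 : γ ≤ 1)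
    (hs : 0 < s)
    (hC : ∀ Δ > (0 : ℝ), ∀ ℓ : Idx,
      Real.exp (-Δ * wt η ℓ) * dd ℓ ^ 4 ≤ Real.exp (C * Δ ^ (-μ)))
    {Ω : Set Freq} {l3 l1 : Bool × (Ω × Unit) → ℝ} {r : Bool × (Ω × Unit) → Mode → ℝ}
    (h3 : (pairScale η γ s Ω).scl (fun x => l3 x - 1) ≤ 3) (h1 : (pairScale η γ s Ω).scl l1 ≤ 3)
    (hr : ∀ j, (pairScale η γ s Ω).scl (fun x => r x j) ≤ 1) (N : ℝ) {Δ : ℝ} (hΔ : 0 < Δ) :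
    (pairScale η γ s Ω).mlt Δ (fun x => cutMult κ η N x.2.1.1
      (fun j => -l3 x * ((j : ℤ) : ℝ) ^ 3 + l1 x * ((j : ℤ) : ℝ) + r x j))
      ≤ ENNReal.ofReal (4672 / κ ^ 4 * Real.exp (C * Δ ^ (-μ))) := by
  set Q : Idx → ℝ≥0∞ := fun ℓ => ENNReal.ofReal (1168 / κ ^ 4 * dd ℓ ^ 4) with hQ
  set M : ℝ≥0∞ := ENNReal.ofReal (1168 / κ ^ 4 * Real.exp (C * Δ ^ (-μ))) with hM
  have h4M : ENNReal.ofReal (4672 / κ ^ 4 * Real.exp (C * Δ ^ (-μ))) = 4 * M := by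
    rw [hM, ← ENNReal.ofReal_ofNat 4, ← ENNReal.ofReal_mul (by norm_num)]
    congr 1
    ring
  rw [h4M]
  have hQM : ∀ ℓ, expWt η (-Δ) ℓ * Q ℓ ≤ M := by
    intro ℓ
    rw [expWt, hQ, ← ENNReal.ofReal_mul (Real.exp_pos _).le]
    refine ENNReal.ofReal_le_ofReal ?_
    rw [mul_left_comm]
    exact mul_le_mul_of_nonneg_left (hC Δ hΔ ℓ) (by positivity)
  have key := cutMult_coeff_bounds (N := N) hκ hκ1 hγ1 hs h3 h1 hr (fun _ => rfl)
  refine pairScale_mlt_le hs (fun b x => multNorm_le_iff.2 fun ℓ j j' => ?_)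
    (fun b x y h => mul_multNorm_div_le_iff.2 fun ℓ j j' => ?_)
    (fun b b' x h => multNorm_le_iff.2 fun ℓ j j' => ?_)
    (fun b b' x y h h' => mul_multNorm_div_le_iff.2 fun ℓ j j' => ?_)
  · exact (mul_le_mul' le_rfl ((key ℓ j j').1 b x)).trans (hQM ℓ)
  · exact (mul_le_mul' le_rfl ((key ℓ j j').2.1 b x y h)).trans (hQM ℓ)
  · refine (mul_le_mul' le_rfl ((key ℓ j j').2.2.1 b b' x h)).trans ?_
    rw [← mul_assoc]
    exact mul_le_mul' (hQM ℓ) le_rfl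
  · refine (mul_le_mul' le_rfl ((key ℓ j j').2.2.2 b b' x y h h')).trans ?_
    rw [← mul_assoc]
    exact mul_le_mul' (hQM ℓ) le_rfl

/-! ### The scheme with modified small divisors -/

/-- The reducibility scheme with modified small divisors, defined for all frequencies. -/
def AiryOp.cut {m : ℕ} (L : AiryOp m) (κ η : ℝ) (N : ℕ → ℝ) (k : ℕ) (ω : Freq) :
    (Mode → ℝ) × (ℕ → TOp) :=
  multScheme η N (fun k r => cutMult κ η (N k) ω (L.Om0 ω + r)) (L.comp0 ω) k

/-- The generators of the scheme with modified small divisors. -/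
def AiryOp.cutGen {m : ℕ} (L : AiryOp m) (κ η : ℝ) (N : ℕ → ℝ) (k : ℕ) (ω : Freq) : TOp :=
  cutMult κ η (N k) ω (L.Om0 ω + (L.cut κ η N k ω).1) * (L.cut κ η N k ω).2 k

lemma inv_dd_le_prod (ℓ : Idx) :
    (dd ℓ)⁻¹ ≤ ℓ.prod fun i n => 1 / (1 + |(n : ℝ)| ^ 2 * ((i : ℕ) : ℝ) ^ 2) := by
  rw [dd, Finsupp.prod, Finsupp.prod, ← Finset.prod_inv_distrib]
  refine Finset.prod_le_prod (fun i _ => by positivity) fun i hi => ?_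
  have hi1 : (1 : ℝ) ≤ ((i : ℕ) : ℝ) := by exact_mod_cast i.pos
  have hn : (1 : ℝ) ≤ |((ℓ i : ℤ) : ℝ)| := by
    exact_mod_cast Int.one_le_abs (Finsupp.mem_support_iff.1 hi)
  rw [one_div]
  gcongr <;> norm_num

section

variable {m : ℕ} {L : AiryOp m} {η γ γ' κ : ℝ} {N : ℕ → ℝ} {O : Set Freq}

lemma E_succ_subset (k : ℕ) : L.E η γ N O (k + 1) ⊆ L.E η γ N O k := fun _ h => h.1

lemma E_subset (k : ℕ) : L.E η γ N O k ⊆ O := by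
  induction k with
  | zero => exact subset_rfl
  | succ k ih => exact (E_succ_subset k).trans ih

/-- On the Cantor sets the small divisors are above the threshold: by the non-resonance conditions
for `j ≠ j'`, and by the Diophantine condition for `j = j'`. -/
lemma divThreshold_le (hκ : 0 < κ) (hκγ : κ ≤ γ) (hκγ' : κ ≤ γ') (hO : O ⊆ Dioph γ') {k : ℕ}
    {ω : Freq} (hω : ω ∈ L.E η γ N O (k + 1)) (ℓ : Idx) (j j' : Mode) (h : ¬ (ℓ = 0 ∧ j = j'))
    (hN : wt η ℓ ≤ N k) :
    divThreshold κ ℓ j j' ≤ |dot ω ℓ + L.Om η N k ω j - L.Om η N k ω j'| := by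
  have hd := one_le_dd ℓ
  by_cases hj : j = j'
  · subst hj
    have hℓ : ℓ ≠ 0 := fun h' => h ⟨h', rfl⟩
    have h1 := (hO (E_subset _ hω)).2 ℓ hℓ
    rw [add_sub_cancel_right]
    refine le_trans ?_ h1.le
    have e : divThreshold κ ℓ j j = κ * (dd ℓ)⁻¹ := by
      simp [divThreshold, cubeGap, div_eq_mul_inv]
    rw [e]
    exact mul_le_mul hκγ' (inv_dd_le_prod ℓ) (by positivity) (by linarith)
  · refine le_trans ?_ (hω.2 ℓ j j' h hN)
    rw [divThreshold, cubeGap, max_eq_left (one_le_abs_cube_sub hj)]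
    gcongr

lemma cut_eq_scheme (hκ : 0 < κ) (hκγ : κ ≤ γ) (hκγ' : κ ≤ γ') (hO : O ⊆ Dioph γ') {k : ℕ}
    {ω : Freq} (hω : ω ∈ L.E η γ N O k) :
    L.cut κ η N k ω = scheme η N ω (L.Om0 ω) (L.comp0 ω) k := by
  induction k with
  | zero => rfl
  | succ k ih =>
    have ih' := ih (E_succ_subset k hω)
    have hh := fun P => homSol_eq_cutMult_mul hκ
      (fun ℓ j j' => divThreshold_le hκ hκγ hκγ' hO hω ℓ j j') P
    rw [AiryOp.cut, multScheme, scheme]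
    rw [AiryOp.cut] at ih'
    rw [ih']
    have h1 : L.Om η N k ω = L.Om0 ω + (scheme η N ω (L.Om0 ω) (L.comp0 ω) k).1 := rfl
    rw [h1] at hh
    simp only [hh]

lemma cutGen_eq_Psi (hκ : 0 < κ) (hκγ : κ ≤ γ) (hκγ' : κ ≤ γ') (hO : O ⊆ Dioph γ') {k : ℕ}
    {ω : Freq} (hω : ω ∈ L.E η γ N O (k + 1)) : L.cutGen κ η N k ω = L.Psi η N k ω := by
  rw [AiryOp.cutGen, cut_eq_scheme hκ hκγ hκγ' hO (E_succ_subset k hω), AiryOp.Psi,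
    homSol_eq_cutMult_mul hκ (fun ℓ j j' => divThreshold_le hκ hκγ hκγ' hO hω ℓ j j')]
  rfl

end

/-! ### Lipschitz norms -/

section

variable {η γ σ : ℝ} {Ω Ω' : Set Freq}

lemma lipNorm_eq_famNorm {Y : Type} [Sub Y] (n : Y → ℝ≥0∞) (f : Freq → Y) :
    lipNorm γ Ω n f
      = famNorm (ENNReal.ofReal γ) (fun x y : Ω => supDist x.1 y.1) n fun x => f x.1 := by
  simp only [lipNorm, famNorm, iSup_subtype, ne_eq, Subtype.mk.injEq]

lemma lipNorm_mono_set {Y : Type} [Sub Y] (n : Y → ℝ≥0∞) (f : Freq → Y) (h : Ω ⊆ Ω') :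
    lipNorm γ Ω n f ≤ lipNorm γ Ω' n f := by
  rw [lipNorm, lipNorm]
  gcongr ?_ + _ * ?_
  · exact biSup_mono fun _ h' => h h'
  · refine (biSup_mono fun _ h' => h h').trans (iSup₂_mono fun _ _ => ?_)
    exact biSup_mono fun _ h' => h h'

lemma opLip_eq (T : Freq → TOp) :
    opLip η γ σ Ω T = (lipScale η γ Ω).nrm σ fun x => T x.1.1 :=
  lipNorm_eq_famNorm _ _

lemma scalarLip_eq (η : ℝ) (f : Freq → ℝ) :
    scalarLip γ Ω f = (lipScale η γ Ω).scl fun x => f x.1.1 :=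
  lipNorm_eq_famNorm _ _

lemma opLip_congr {T T' : Freq → TOp} (h : ∀ ω ∈ Ω, T ω = T' ω) :
    opLip η γ σ Ω T = opLip η γ σ Ω T' := by
  rw [opLip_eq, opLip_eq]
  congr 1
  funext x
  exact h _ x.1.2

lemma scalarLip_add_le (f g : Freq → ℝ) :
    scalarLip γ Ω (fun ω => f ω + g ω) ≤ scalarLip γ Ω f + scalarLip γ Ω g := by
  rw [scalarLip_eq 1, scalarLip_eq 1, scalarLip_eq 1]
  exact (lipScale 1 γ Ω).scl_add _ _

lemma opLip_zero : opLip η γ σ Ω (fun _ => 0) = 0 := by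
  rw [opLip_eq]
  exact (lipScale η γ Ω).nrm_zero σ

lemma opLip_add_le (S T : Freq → TOp) :
    opLip η γ σ Ω (fun ω => S ω + T ω) ≤ opLip η γ σ Ω S + opLip η γ σ Ω T := by
  rw [opLip_eq, opLip_eq, opLip_eq]
  exact (lipScale η γ Ω).nrm_add σ _ _

lemma opLip_neg_le (T : Freq → TOp) : opLip η γ σ Ω (fun ω => -T ω) ≤ opLip η γ σ Ω T := by
  rw [opLip_eq, opLip_eq]
  exact (lipScale η γ Ω).nrm_neg σ _

lemma opLip_mono {σ' : ℝ} (h : σ ≤ σ') (T : Freq → TOp) :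
    opLip η γ σ Ω T ≤ opLip η γ σ' Ω T := by
  rw [opLip_eq, opLip_eq]
  exact (lipScale η γ Ω).nrm_mono h _

lemma opLip_sum_le {ι : Type*} (s : Finset ι) (T : ι → Freq → TOp) :
    opLip η γ σ Ω (fun ω => ∑ i ∈ s, T i ω) ≤ ∑ i ∈ s, opLip η γ σ Ω (T i) := by
  classical
  induction s using Finset.induction_on with
  | empty => simp [opLip_zero]
  | insert i s hi ih =>
    simp only [Finset.sum_insert hi]
    exact (opLip_add_le _ _).trans (add_le_add le_rfl ih)

end

lemma famNorm_pair_le {Y : Type} [AddCommGroup Y] {n : Y → ℝ≥0∞} (hn : ∀ y, n (-y) ≤ n y) {s : ℝ}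
    {f : Bool → Y} {a c : ℝ≥0∞} (ha : ∀ b, n (f b) ≤ a)
    (hc : n (f true - f false) ≤ c * ENNReal.ofReal s) :
    famNorm 1 (fun _ _ => ENNReal.ofReal s) n f ≤ a + c := by
  refine famNorm_le ha fun b b' hb => ?_
  rw [one_mul]
  refine ENNReal.div_le_of_le_mul ?_
  cases b <;> cases b' <;> simp only [ne_eq, not_true_eq_false] at hb
  · rw [← neg_sub]
    exact (hn _).trans hc
  · exact hc

section

variable {η γ s σ : ℝ} {Ω : Set Freq}

lemma opLip_le_pairScale (f : Bool → Freq → TOp) (b : Bool) :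
    opLip η γ σ Ω (f b) ≤ (pairScale η γ s Ω).nrm σ fun x => f x.1 x.2.1.1 := by
  rw [opLip_eq]
  exact le_famNorm ((lipScale η γ Ω).nrm σ) (fun b x => f b x.1.1) b

lemma opLip_diff_le_of_pairScale (hs : 0 < s) {f : Bool → Freq → TOp} {c : ℝ≥0∞}
    (h : (pairScale η γ s Ω).nrm σ (fun x => f x.1 x.2.1.1) ≤ c) :
    opLip η γ σ Ω (fun ω => f true ω - f false ω) ≤ c * ENNReal.ofReal s := by
  rw [opLip_eq]
  exact famNorm_pair_diff_le (f := fun b (x : Ω × Unit) => f b x.1.1) hs h (b := true)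
    (b' := false) (by simp)

lemma scalarLip_diff_le_of_pairScale (hs : 0 < s) {f : Bool → Freq → ℝ} {c : ℝ≥0∞}
    (h : (pairScale η γ s Ω).scl (fun x => f x.1 x.2.1.1) ≤ c) :
    scalarLip γ Ω (fun ω => f true ω - f false ω) ≤ c * ENNReal.ofReal s := by
  rw [scalarLip_eq η]
  exact famNorm_pair_diff_le (f := fun b (x : Ω × Unit) => f b x.1.1) hs h (b := true)
    (b' := false) (by simp)

lemma pairScale_nrm_le {f : Bool → Freq → TOp} {a c : ℝ≥0∞} (ha : ∀ b, opLip η γ σ Ω (f b) ≤ a)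
    (hc : opLip η γ σ Ω (fun ω => f true ω - f false ω) ≤ c * ENNReal.ofReal s) :
    (pairScale η γ s Ω).nrm σ (fun x => f x.1 x.2.1.1) ≤ a + c := by
  simp only [opLip_eq] at ha hc
  exact famNorm_pair_le (n := (lipScale η γ Ω).nrm σ) (f := fun b (x : Ω × Unit) => f b x.1.1)
    ((lipScale η γ Ω).nrm_neg σ) ha hc

lemma pairScale_scl_le {f : Bool → Freq → ℝ} {a c : ℝ≥0∞} (ha : ∀ b, scalarLip γ Ω (f b) ≤ a)
    (hc : scalarLip γ Ω (fun ω => f true ω - f false ω) ≤ c * ENNReal.ofReal s) :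
    (pairScale η γ s Ω).scl (fun x => f x.1 x.2.1.1) ≤ a + c := by
  simp only [scalarLip_eq η] at ha hc
  refine famNorm_pair_le (n := (lipScale η γ Ω).scl) (f := fun b (x : Ω × Unit) => f b x.1.1)
    (fun y => ?_) ha hc
  have := (lipScale η γ Ω).scl_smul (-1) y
  simp only [neg_mul, one_mul, enorm_neg, enorm_one] at this
  exact this

end

/-- Bounds on the scheme with modified small divisors for two operators at distance `s`, uniformly
on the whole parameter set: sizes of the remainders, and distances of the eigenvalue corrections,
of the remainders and of the generators. -/
theorem cut_pair_bounds {η μ κ γ s C ε : ℝ} {ρ δ N β a c : ℕ → ℝ} (hκ : 0 < κ) (hκ1 : κ ≤ 1)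
    (hγ1 : γ ≤ 1) (hs : 0 < s) (hC0 : 0 ≤ C)
    (hC : ∀ Δ > (0 : ℝ), ∀ ℓ : Idx,
      Real.exp (-Δ * wt η ℓ) * dd ℓ ^ 4 ≤ Real.exp (C * Δ ^ (-μ)))
    (hS : Scales μ C ε ρ δ N) (hε : 0 < ε) (hεκ : 516 * (4672 / κ ^ 4) * ε ≤ 1)
    {m : ℕ} (hβ : ∀ i, δ i ≤ β i) (hβ' : ∀ i ≤ m, β i = δ i) {Ω : Set Freq}
    (Λ : Bool → Σ n, AiryOp n)
    (h3 : ∀ b, scalarLip γ Ω (fun ω => (Λ b).2.lam3 ω - 1) ≤ 2)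
    (h3' : scalarLip γ Ω (fun ω => (Λ true).2.lam3 ω - (Λ false).2.lam3 ω) ≤ ENNReal.ofReal s)
    (h1 : ∀ b, scalarLip γ Ω (Λ b).2.lam1 ≤ 2)
    (h1' : scalarLip γ Ω (fun ω => (Λ true).2.lam1 ω - (Λ false).2.lam1 ω) ≤ ENNReal.ofReal s)
    (ha : ∀ i, 0 ≤ a i) (hc : ∀ i, 0 ≤ c i) (hac : ∀ i, a i + c i ≤ 4 * β i)
    (hP : ∀ b i, opLip η γ (ρ i) Ω (fun ω => (Λ b).2.comp0 ω i) ≤ ENNReal.ofReal (a i))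
    (hP' : ∀ i, opLip η γ (ρ i) Ω (fun ω => (Λ true).2.comp0 ω i - (Λ false).2.comp0 ω i)
      ≤ ENNReal.ofReal (c i * s)) :
    (∀ k ≤ m + 1, ∀ j, scalarLip γ Ω (fun ω =>
      ((Λ true).2.cut κ η N k ω).1 j - ((Λ false).2.cut κ η N k ω).1 j) ≤ ENNReal.ofReal s) ∧
    (∀ k ≤ m + 1, ∀ i ≥ k, ∀ b, opLip η γ (ρ i) Ω (fun ω => ((Λ b).2.cut κ η N k ω).2 i)
      ≤ ENNReal.ofReal (8 * β i)) ∧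
    (∀ k ≤ m + 1, ∀ i ≥ k, opLip η γ (ρ i) Ω (fun ω =>
      ((Λ true).2.cut κ η N k ω).2 i - ((Λ false).2.cut κ η N k ω).2 i)
        ≤ ENNReal.ofReal (8 * β i * s)) ∧
    (∀ k ≤ m, opLip η γ (ρ (k + 1)) Ω (fun ω =>
      (Λ true).2.cutGen κ η N k ω - (Λ false).2.cutGen κ η N k ω) ≤ ENNReal.ofReal s) := by
  have hβ0 : ∀ i, 0 ≤ 8 * β i := fun i => by linarith [(hS.delta_pos i).le.trans (hβ i)]
  set S := pairScale η γ s Ω with hSdef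
  have e3 : (3 : ℝ≥0∞) = 2 + 1 := by norm_num
  have i3 : S.scl (fun x => (Λ x.1).2.lam3 x.2.1.1 - 1) ≤ 3 := by
    rw [e3]
    refine pairScale_scl_le (f := fun b ω => (Λ b).2.lam3 ω - 1) h3 ?_
    simpa only [one_mul, sub_sub_sub_cancel_right] using h3'
  have i1 : S.scl (fun x => (Λ x.1).2.lam1 x.2.1.1) ≤ 3 := by
    rw [e3]
    refine pairScale_scl_le (f := fun b ω => (Λ b).2.lam1 ω) h1 ?_
    rwa [one_mul]
  have iP : ∀ i, S.nrm (ρ i) (fun x => (Λ x.1).2.comp0 x.2.1.1 i) ≤ ENNReal.ofReal (4 * β i) := by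
    intro i
    refine (pairScale_nrm_le (f := fun b ω => (Λ b).2.comp0 ω i) (c := ENNReal.ofReal (c i))
      (fun b => hP b i) ?_).trans ?_
    · rw [← ENNReal.ofReal_mul (hc i)]
      exact hP' i
    · rw [← ENNReal.ofReal_add (ha i) (hc i)]
      exact ENNReal.ofReal_le_ofReal (hac i)
  have hA : 1 ≤ 4672 / κ ^ 4 := by
    rw [one_le_div (by positivity)]
    exact (pow_le_one₀ hκ.le hκ1).trans (by norm_num)
  obtain ⟨c1, c2, c3⟩ := S.multScheme_bounds hS hC0 hA hε hεκ hβ hβ'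
    (fun x k r => cutMult κ η (N k) x.2.1.1 ((Λ x.1).2.Om0 x.2.1.1 + r))
    (fun x => (Λ x.1).2.comp0 x.2.1.1) iP
    (fun k r hr => pairScale_mlt_cutMult_le hκ hκ1 hγ1 hs hC i3 i1 hr (N k) (hS.gap_pos k))
  have c1' : ∀ k ≤ m + 1, ∀ j, S.scl (fun x => ((Λ x.1).2.cut κ η N k x.2.1.1).1 j) ≤ 1 := c1
  have c2' : ∀ k ≤ m + 1, ∀ i ≥ k, S.nrm (ρ i) (fun x => ((Λ x.1).2.cut κ η N k x.2.1.1).2 i)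
    ≤ ENNReal.ofReal (8 * β i) := c2
  have c3' : ∀ k ≤ m, S.nrm (ρ (k + 1)) (fun x => (Λ x.1).2.cutGen κ η N k x.2.1.1) ≤ 1 := c3
  refine ⟨fun k hk j => ?_, fun k hk i hi b => ?_, fun k hk i hi => ?_, fun k hk => ?_⟩
  · rw [← one_mul (ENNReal.ofReal s)]
    exact scalarLip_diff_le_of_pairScale (f := fun b ω => ((Λ b).2.cut κ η N k ω).1 j) hs
      (c1' k hk j)
  · exact (opLip_le_pairScale (fun b ω => ((Λ b).2.cut κ η N k ω).2 i) b).trans (c2' k hk i hi)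
  · rw [ENNReal.ofReal_mul (hβ0 i)]
    exact opLip_diff_le_of_pairScale (f := fun b ω => ((Λ b).2.cut κ η N k ω).2 i) hs
      (c2' k hk i hi)
  · rw [← one_mul (ENNReal.ofReal s)]
    exact opLip_diff_le_of_pairScale (f := fun b ω => (Λ b).2.cutGen κ η N k ω) hs (c3' k hk)

/-! ### Corrections and variations of the operators -/

lemma scalarLip_im_le {η γ σ : ℝ} {Ω : Set Freq} (hσ : 0 ≤ σ) (T : Freq → TOp) (ℓ : Idx)
    (j j' : Mode) : scalarLip γ Ω (fun ω => (T ω ℓ j j').im) ≤ opLip η γ σ Ω T := by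
  rw [scalarLip_eq η, opLip_eq]
  exact (lipScale η γ Ω).scl_im σ hσ _ _ _ _

lemma opLip_mono_set {η γ σ : ℝ} {Ω Ω' : Set Freq} (h : Ω ⊆ Ω') (T : Freq → TOp) :
    opLip η γ σ Ω T ≤ opLip η γ σ Ω' T := lipNorm_mono_set _ _ h

lemma scalarLip_mono_set {γ : ℝ} {Ω Ω' : Set Freq} (h : Ω ⊆ Ω') (f : Freq → ℝ) :
    scalarLip γ Ω f ≤ scalarLip γ Ω' f := lipNorm_mono_set _ _ h

lemma Scales.sum_delta_le {μ C ε : ℝ} {ρ δ N : ℕ → ℝ} (h : Scales μ C ε ρ δ N) (hC : 0 ≤ C)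
    (hε : 0 ≤ ε) (n : ℕ) : ∑ i ∈ Finset.range n, δ i ≤ 2 * ε := by
  have key : ∑ i ∈ Finset.range n, δ i ≤ 2 * ε * (1 - (1 / 2) ^ n) := by
    induction n with
    | zero => simp
    | succ n ih =>
      rw [Finset.sum_range_succ, pow_succ]
      linarith [h.delta_le hC hε n]
  have : 0 ≤ 2 * ε * (1 / 2) ^ n := by positivity
  linarith

/-- The eigenvalue corrections of the scheme with modified small divisors extend those of the
scheme to the whole parameter set. -/
lemma isCorrection_cut {m : ℕ} {L : AiryOp m} {η γ γ' w κ K : ℝ} {N ρ δ : ℕ → ℝ} {O : Set Freq}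
    (hκ : 0 < κ) (hκγ : κ ≤ γ) (hκγ' : κ ≤ γ') (hO : O ⊆ Dioph γ') {M : ℕ}
    (hρ : ∀ k, 0 ≤ ρ k)
    (h : ∀ k < M, opLip η w (ρ k) O (fun ω => (L.cut κ η N k ω).2 k)
      ≤ ENNReal.ofReal (K * δ k)) :
    L.IsCorrection η γ w N O K δ M fun k j ω => (L.cut κ η N k ω).1 j := by
  refine ⟨fun j ω _ => rfl, fun k _ j ω hω => ?_, fun k hk j => ?_⟩
  · have h1 := cut_eq_scheme hκ hκγ hκγ' hO hω
    have h2 : (L.cut κ η N (k + 1) ω).1 j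
        = (L.cut κ η N k ω).1 j + ((L.cut κ η N k ω).2 k 0 j j).im := rfl
    exact h2.trans (by rw [h1]; rfl)
  · refine le_trans (le_of_eq ?_) ((scalarLip_im_le (hρ k)
      (fun ω => (L.cut κ η N k ω).2 k) 0 j j).trans (h k hk))
    congr 1
    funext ω
    exact add_sub_cancel_left _ _

lemma comp0_of_le {m : ℕ} (L : AiryOp m) {i : ℕ} (hi : i ≤ m) (ω : Freq) :
    L.comp0 ω i = L.comp ⟨i, Nat.lt_succ_of_le hi⟩ ω := dif_pos _

lemma comp0_of_lt {m : ℕ} (L : AiryOp m) {i : ℕ} (hi : m < i) (ω : Freq) : L.comp0 ω i = 0 :=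
  dif_neg (by omega)

/-- The last component of a variation is small, as the difference of the totals and of the
matched components. -/
lemma opLip_last_le {η γ μ C ε : ℝ} {ρ δ N : ℕ → ℝ} {O' : Set Freq} {m : ℕ} {L : AiryOp m}
    {L' : AiryOp (m + 1)} (hS : Scales μ C ε ρ δ N) (hC : 0 ≤ C) (hε : 0 ≤ ε) (hε1 : 2 * ε ≤ 1)
    (hV : L.IsVariation L' η γ O' ρ δ) :
    opLip η γ (ρ (m + 1)) O' (L'.comp (Fin.last (m + 1)))
      ≤ ENNReal.ofReal (2 * δ (m + 1)) := by
  have hd := hS.delta_pos (m + 1)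
  have e : L'.comp (Fin.last (m + 1)) = fun ω => (L'.total ω - L.total ω)
      + -∑ i, (L'.comp (Fin.castSucc i) ω - L.comp i ω) := by
    funext ω
    rw [AiryOp.total, AiryOp.total, Fin.sum_univ_castSucc, Finset.sum_sub_distrib]
    abel
  have hsum : opLip η γ (ρ (m + 1)) O' (fun ω => ∑ i, (L'.comp (Fin.castSucc i) ω - L.comp i ω))
      ≤ ENNReal.ofReal (δ (m + 1)) := by
    calc _ ≤ ∑ i : Fin (m + 1), opLip η γ (ρ (m + 1)) O'
            (fun ω => L'.comp (Fin.castSucc i) ω - L.comp i ω) :=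
          opLip_sum_le Finset.univ fun i ω => L'.comp (Fin.castSucc i) ω - L.comp i ω
      _ ≤ ∑ i : Fin (m + 1), ENNReal.ofReal (δ i * δ (m + 1)) :=
          Finset.sum_le_sum fun i _ =>
            (opLip_mono (hS.rho_anti.antitone (by omega)) _).trans (hV.comp i)
      _ = ENNReal.ofReal ((∑ i ∈ Finset.range (m + 1), δ i) * δ (m + 1)) := by
          rw [← ENNReal.ofReal_sum_of_nonneg fun i _ =>
            mul_nonneg (hS.delta_pos _).le hd.le, ← Finset.sum_mul,
            Fin.sum_univ_eq_sum_range fun i => δ i]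
      _ ≤ ENNReal.ofReal (δ (m + 1)) := by
          refine ENNReal.ofReal_le_ofReal (mul_le_of_le_one_left hd.le ?_)
          exact (hS.sum_delta_le hC hε _).trans hε1
  rw [e, two_mul, ENNReal.ofReal_add hd.le hd.le]
  exact (opLip_add_le _ _).trans (add_le_add hV.total ((opLip_neg_le _).trans hsum))

lemma opLip_le_add_diff {η γ σ : ℝ} {Ω : Set Freq} {S T : Freq → TOp} {a b : ℝ} (ha : 0 ≤ a)
    (hb : 0 ≤ b) (hS : opLip η γ σ Ω S ≤ ENNReal.ofReal a)
    (hT : opLip η γ σ Ω (fun ω => T ω - S ω) ≤ ENNReal.ofReal b) :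
    opLip η γ σ Ω T ≤ ENNReal.ofReal (a + b) := by
  have e : T = fun ω => S ω + (T ω - S ω) := by funext ω; abel
  rw [e, ENNReal.ofReal_add ha hb]
  exact (opLip_add_le _ _).trans (add_le_add hS hT)

lemma scalarLip_le_add_diff {γ : ℝ} {Ω : Set Freq} {f g : Freq → ℝ} {a b : ℝ} (ha : 0 ≤ a)
    (hb : 0 ≤ b) (hf : scalarLip γ Ω f ≤ ENNReal.ofReal a)
    (hg : scalarLip γ Ω (fun ω => g ω - f ω) ≤ ENNReal.ofReal b) :
    scalarLip γ Ω g ≤ ENNReal.ofReal (a + b) := by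
  have e : g = fun ω => f ω + (g ω - f ω) := by funext ω; ring
  rw [e, ENNReal.ofReal_add ha hb]
  exact (scalarLip_add_le _ _).trans (add_le_add hf hg)

lemma scalarLip_const_zero {γ : ℝ} {Ω : Set Freq} : scalarLip γ Ω (fun _ => 0) = 0 := by
  rw [scalarLip_eq 1]
  exact (lipScale 1 γ Ω).scl_zero

/-- Bounds for a single operator, seen as a pair of equal operators. -/
lemma cut_bounds {η μ κ γ C ε : ℝ} {ρ δ N : ℕ → ℝ} (hκ : 0 < κ) (hκ1 : κ ≤ 1) (hγ1 : γ ≤ 1)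
    (hC0 : 0 ≤ C)
    (hC : ∀ Δ > (0 : ℝ), ∀ ℓ : Idx,
      Real.exp (-Δ * wt η ℓ) * dd ℓ ^ 4 ≤ Real.exp (C * Δ ^ (-μ)))
    (hS : Scales μ C ε ρ δ N) (hε : 0 < ε) (hε1 : 2 * ε ≤ 1)
    (hεκ : 516 * (4672 / κ ^ 4) * ε ≤ 1) {m : ℕ} {L : AiryOp m} {O : Set Freq}
    (hL : L.Small η γ O ρ δ) {k : ℕ} (hk : k ≤ m) :
    opLip η γ (ρ k) O (fun ω => (L.cut κ η N k ω).2 k) ≤ ENNReal.ofReal (8 * δ k) := by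
  have hδ1 : ∀ i, δ i ≤ 1 := fun i => by
    have h1 := hS.delta_le hC0 hε.le i
    have h2 : ε * (1 / 2) ^ i ≤ ε :=
      mul_le_of_le_one_right hε.le (pow_le_one₀ (by norm_num) (by norm_num))
    linarith
  have h2 : ENNReal.ofReal (δ 0) ≤ 2 :=
    (ENNReal.ofReal_le_one.2 (hδ1 0)).trans (by norm_num)
  have := (cut_pair_bounds (s := 1) (β := fun i => if i ≤ m then δ i else 1)
    (a := fun i => if i ≤ m then δ i else 0) (c := fun _ => 0) hκ hκ1 hγ1 one_pos hC0 hC hS hε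
    hεκ (m := m) (Ω := O) (fun i => by split_ifs; exacts [le_rfl, hδ1 i])
    (fun i hi => if_pos hi) (fun _ => ⟨m, L⟩) (fun _ => hL.lam3.trans h2)
    (by simp only [sub_self, scalarLip_const_zero, zero_le]) (fun _ => hL.lam1.trans h2)
    (by simp only [sub_self, scalarLip_const_zero, zero_le])
    (fun i => by split_ifs; exacts [(hS.delta_pos i).le, le_rfl])
    (fun _ => le_rfl)
    (fun i => by split_ifs <;> linarith [hS.delta_pos i])
    (fun _ i => ?_) (fun i => ?_)).2.1 k (by omega) k le_rfl true
  · simpa only [if_pos hk] using this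
  · by_cases hi : i ≤ m
    · simp only [comp0_of_le L hi, if_pos hi]
      exact hL.comp ⟨i, Nat.lt_succ_of_le hi⟩
    · simp only [comp0_of_lt L (not_le.1 hi), opLip_zero, zero_le]
  · simp only [sub_self, opLip_zero, zero_le]

/-- Bounds for an operator and a variation of it. -/
lemma cut_variation_bounds {η μ κ γ C ε : ℝ} {ρ δ N : ℕ → ℝ} (hκ : 0 < κ) (hκ1 : κ ≤ 1)
    (hγ1 : γ ≤ 1)
    (hC0 : 0 ≤ C)
    (hC : ∀ Δ > (0 : ℝ), ∀ ℓ : Idx,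
      Real.exp (-Δ * wt η ℓ) * dd ℓ ^ 4 ≤ Real.exp (C * Δ ^ (-μ)))
    (hS : Scales μ C ε ρ δ N) (hε : 0 < ε) (hε1 : 2 * ε ≤ 1)
    (hεκ : 516 * (4672 / κ ^ 4) * ε ≤ 1) {m : ℕ} {L : AiryOp m} {O : Set Freq}
    (hL : L.Small η γ O ρ δ)
    {Op : Set Freq} (hOp : Op ⊆ O) {L' : AiryOp (m + 1)}
    (hV : L.IsVariation L' η γ Op ρ δ) :
    (∀ k ≤ m + 1, ∀ j, scalarLip γ Op (fun ω =>
      (L'.cut κ η N k ω).1 j - (L.cut κ η N k ω).1 j) ≤ ENNReal.ofReal (δ (m + 1))) ∧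
    (∀ k ≤ m, opLip η γ (ρ k) Op (fun ω => (L'.cut κ η N k ω).2 k)
      ≤ ENNReal.ofReal (8 * δ k)) ∧
    (∀ k ≤ m + 1, ∀ i ≥ k, opLip η γ (ρ i) Op (fun ω =>
      (L'.cut κ η N k ω).2 i - (L.cut κ η N k ω).2 i)
        ≤ ENNReal.ofReal (8 * (if i ≤ m then δ i else 1) * δ (m + 1))) ∧
    (∀ k ≤ m, opLip η γ (ρ (k + 1)) Op (fun ω =>
      L'.cutGen κ η N k ω - L.cutGen κ η N k ω) ≤ ENNReal.ofReal (δ (m + 1))) := by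
  have hδ1 : ∀ i, δ i ≤ 1 := fun i => by
    have h1 := hS.delta_le hC0 hε.le i
    have h2 : ε * (1 / 2) ^ i ≤ ε :=
      mul_le_of_le_one_right hε.le (pow_le_one₀ (by norm_num) (by norm_num))
    linarith
  have hδ0 : ∀ i, 0 ≤ δ i := fun i => (hS.delta_pos i).le
  have hlast := opLip_last_le hS hC0 hε.le hε1 hV
  have h2 : ENNReal.ofReal (δ 0) ≤ 2 :=
    (ENNReal.ofReal_le_one.2 (hδ1 0)).trans (by norm_num)
  have h2' : ENNReal.ofReal (δ 0 + δ (m + 1)) ≤ 2 := by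
    rw [← ENNReal.ofReal_ofNat 2]
    exact ENNReal.ofReal_le_ofReal (by linarith [hδ1 0, hδ1 (m + 1)])
  have l3 := (scalarLip_mono_set hOp _).trans hL.lam3
  have l1 := (scalarLip_mono_set hOp _).trans hL.lam1
  have hc : ∀ i : Fin (m + 1), opLip η γ (ρ i) Op (L.comp i) ≤ ENNReal.ofReal (δ i) := fun i =>
    (opLip_mono_set hOp _).trans (hL.comp i)
  have := cut_pair_bounds (s := δ (m + 1)) (β := fun i => if i ≤ m then δ i else 1)
    (a := fun i => if i ≤ m then 2 * δ i else if i = m + 1 then 2 * δ (m + 1) else 0)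
    (c := fun i => if i ≤ m then δ i else if i = m + 1 then 2 else 0)
    hκ hκ1 hγ1 (hS.delta_pos _) hC0 hC hS hε
    hεκ (m := m) (Ω := Op) (fun i => by split_ifs; exacts [le_rfl, hδ1 i])
    (fun i hi => if_pos hi) (fun b => bif b then ⟨m + 1, L'⟩ else ⟨m, L⟩)
    (fun b => ?_) hV.lam3 (fun b => ?_) hV.lam1
    (fun i => by split_ifs <;> linarith [hδ0 i, hδ0 (m + 1)])
    (fun i => by split_ifs <;> linarith [hδ0 i])
    (fun i => by split_ifs <;> linarith [hδ0 i, hδ1 (m + 1)])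
    (fun b i => ?_) (fun i => ?_)
  · obtain ⟨t1, t2, t3, t4⟩ := this
    refine ⟨t1, fun k hk => ?_, t3, t4⟩
    have h : opLip η γ (ρ k) Op (fun ω => (L'.cut κ η N k ω).2 k)
        ≤ ENNReal.ofReal (8 * if k ≤ m then δ k else 1) := t2 k (by omega) k le_rfl true
    rwa [if_pos hk] at h
  · cases b
    · exact l3.trans h2
    · have h : scalarLip γ Op (fun ω => (L'.lam3 ω - 1) - (L.lam3 ω - 1))
          ≤ ENNReal.ofReal (δ (m + 1)) := by
        simpa only [sub_sub_sub_cancel_right] using hV.lam3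
      exact (scalarLip_le_add_diff (hδ0 0) (hδ0 (m + 1)) l3 h).trans h2'
  · cases b
    · exact l1.trans h2
    · exact (scalarLip_le_add_diff (hδ0 0) (hδ0 (m + 1)) l1 hV.lam1).trans h2'
  · cases b
    · change opLip η γ (ρ i) Op (fun ω => L.comp0 ω i) ≤ _
      by_cases hi : i ≤ m
      · simp only [if_pos hi, comp0_of_le L hi]
        exact (hc ⟨i, Nat.lt_succ_of_le hi⟩).trans
          (ENNReal.ofReal_le_ofReal (by linarith [hδ0 i]))
      · simp only [comp0_of_lt L (not_le.1 hi), opLip_zero, zero_le]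
    · change opLip η γ (ρ i) Op (fun ω => L'.comp0 ω i) ≤ _
      by_cases hi : i ≤ m
      · simp only [if_pos hi, comp0_of_le L' (hi.trans (Nat.le_succ m))]
        refine (opLip_le_add_diff (hδ0 i) (mul_nonneg (hδ0 i) (hδ0 (m + 1)))
          (hc ⟨i, Nat.lt_succ_of_le hi⟩) (hV.comp ⟨i, Nat.lt_succ_of_le hi⟩)).trans
          (ENNReal.ofReal_le_ofReal ?_)
        nlinarith [hδ0 i, hδ1 (m + 1)]
      · by_cases hi' : i = m + 1
        · subst hi'
          simp only [if_neg hi, if_true, comp0_of_le L' le_rfl]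
          exact hlast
        · simp only [comp0_of_lt L' (show m + 1 < i by omega), opLip_zero, zero_le]
  · change opLip η γ (ρ i) Op (fun ω => L'.comp0 ω i - L.comp0 ω i) ≤ _
    by_cases hi : i ≤ m
    · simp only [if_pos hi, comp0_of_le L hi, comp0_of_le L' (hi.trans (Nat.le_succ m))]
      exact hV.comp ⟨i, Nat.lt_succ_of_le hi⟩
    · simp only [if_neg hi, comp0_of_lt L (not_le.1 hi), sub_zero]
      by_cases hi' : i = m + 1
      · subst hi'
        simp only [if_true, comp0_of_le L' le_rfl]
        exact hlast
      · simp only [comp0_of_lt L' (show m + 1 < i by omega), opLip_zero, zero_le]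

end AiryKAM
end

theorem lemma5p6 (η μ γ₀ : ℝ) (hη : 0 < η) (hμ : max 1 (1 / η) < μ)
    (hγ₀ : 0 < γ₀) (hγ₀' : γ₀ < 1 / 2) :
    ∃ C > (0 : ℝ), ∃ ε > (0 : ℝ), ∃ K > (0 : ℝ),
      ∀ (ρ δ N : ℕ → ℝ), AiryKAM.Scales μ C ε ρ δ N →
      ∀ (γ γp : ℝ), γ₀ / 2 ≤ γp → γp < γ → γ ≤ 2 * γ₀ →
      ∀ (O Op : Set AiryKAM.Freq), O ⊆ AiryKAM.Dioph γ → Op ⊆ O →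
      ∀ (m : ℕ) (L : AiryKAM.AiryOp m) (Lp : AiryKAM.AiryOp (m + 1)),
        L.Small η γ O ρ δ → L.IsVariation Lp η γ Op ρ δ →
        -- the remainders, component by component and as a whole
        (∀ k ∈ Finset.Icc 1 (m + 1),
          (∀ i ∈ Finset.Icc k (m + 1),
            AiryKAM.opLip η γ (ρ i) (L.E η γ N O k ∩ Lp.E η γp N Op k)
              (fun ω => Lp.P η N k i ω - L.P η N k i ω) ≤ ENNReal.ofReal (K * δ (m + 1))) ∧
          AiryKAM.opLip η γ (ρ (m + 1)) (L.E η γ N O k ∩ Lp.E η γp N Op k)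
            (fun ω => Lp.remainder η N (m + 1) k ω - L.remainder η N (m + 1) k ω)
              ≤ ENNReal.ofReal (K * δ (m + 1))) ∧
        -- the generators
        (∀ k ∈ Finset.Icc 1 (m + 1),
          AiryKAM.opLip η γ (ρ k) (L.E η γ N O k ∩ Lp.E η γp N Op k)
            (fun ω => Lp.Psi η N (k - 1) ω - L.Psi η N (k - 1) ω)
              ≤ ENNReal.ofReal (K * δ (m + 1))) ∧
        -- the eigenvalue corrections, extended to the whole parameter sets
        (∃ R Rp : ℕ → AiryKAM.Mode → AiryKAM.Freq → ℝ,
          L.IsCorrection η γ γ N O K δ (m + 1) R ∧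
          Lp.IsCorrection η γp γ N Op K δ (m + 1) Rp ∧
          ∀ k ∈ Finset.Icc 1 (m + 1), ∀ j,
            AiryKAM.scalarLip γ (O ∩ Op) (fun ω => Rp k j ω - R k j ω)
              ≤ ENNReal.ofReal (δ (m + 1))) := by
  open AiryKAM in
  obtain ⟨C, hC0, hC⟩ := exists_dd_pow_le hη ((le_max_right _ _).trans_lt hμ)
  -- the modification of the divisors stays below both non-resonance constants `γ` and `γp`
  set κ := γ₀ / 2 with hκdef
  have hκ : 0 < κ := by positivity
  have hκ1 : κ ≤ 1 := by linarith
  have hκ4 : 0 < κ ^ 4 := by positivity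
  have hκ4' : κ ^ 4 ≤ 1 := pow_le_one₀ hκ.le hκ1
  -- `4672 / κ ^ 4` is the constant in the bound of the multipliers; `516 = 4 * 129` makes the
  -- relative growth of the remainders at the `k`-th step at most `2 ^ (-k) / 4`
  set ε := κ ^ 4 / (516 * 4672) with hεdef
  have hε : 0 < ε := by positivity
  have hε1 : 2 * ε ≤ 1 := by rw [hεdef]; linarith
  have hεκ : 516 * (4672 / κ ^ 4) * ε ≤ 1 := by
    rw [hεdef]
    apply le_of_eq
    field_simp
  refine ⟨C, hC0, ε, hε, 16, by norm_num, ?_⟩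
  intro ρ δ N hS γ γp hγp hlt hγ O Op hO hOp m L Lp hL hV
  have hγ1 : γ ≤ 1 := by linarith
  have hκγ : κ ≤ γ := by linarith
  have hδ0 : 0 ≤ δ (m + 1) := (hS.delta_pos _).le
  obtain ⟨d1, d2, d3, d4⟩ :=
    cut_variation_bounds hκ hκ1 hγ1 hC0.le hC hS hε hε1 hεκ hL hOp hV
  -- the weights of the components add up to a bounded constant
  have hβ0 : ∀ i, 0 ≤ if i ≤ m then δ i else 1 := fun i => by
    split_ifs; exacts [(hS.delta_pos i).le, zero_le_one]
  have hβsum : ∑ i ∈ Finset.range (m + 2), (if i ≤ m then δ i else 1) ≤ 2 := by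
    rw [Finset.sum_range_succ, if_neg (by omega), Finset.sum_congr rfl
      (fun i hi => if_pos (Nat.lt_succ_iff.1 (Finset.mem_range.1 hi)))]
    linarith [hS.sum_delta_le hC0.le hε.le (m + 1)]
  have hsubE : ∀ k, L.E η γ N O k ∩ Lp.E η γp N Op k ⊆ Op := fun k =>
    Set.inter_subset_right.trans (E_subset k)
  have hP : ∀ k ≤ m + 1, ∀ i ≥ k, opLip η γ (ρ i) (L.E η γ N O k ∩ Lp.E η γp N Op k)
      (fun ω => Lp.P η N k i ω - L.P η N k i ω)
        ≤ ENNReal.ofReal (8 * (if i ≤ m then δ i else 1) * δ (m + 1)) := by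
    intro k hk i hi
    refine le_trans (le_of_eq (opLip_congr fun ω hω => ?_))
      ((opLip_mono_set (hsubE k) _).trans (d3 k hk i hi))
    rw [cut_eq_scheme hκ hκγ hκγ hO hω.1, cut_eq_scheme hκ hγp hκγ (hOp.trans hO) hω.2]
    rfl
  refine ⟨fun k hk => ⟨fun i hi => ?_, ?_⟩, fun k hk => ?_, ?_⟩
  · rw [Finset.mem_Icc] at hk hi
    refine (hP k hk.2 i hi.1).trans (ENNReal.ofReal_le_ofReal ?_)
    have : (if i ≤ m then δ i else 1) ≤ 2 :=
      (Finset.single_le_sum (fun i _ => hβ0 i)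
        (Finset.mem_range.2 (Nat.lt_succ_of_le hi.2))).trans hβsum
    exact mul_le_mul_of_nonneg_right (by linarith) hδ0
  · rw [Finset.mem_Icc] at hk
    have e : (fun ω => Lp.remainder η N (m + 1) k ω - L.remainder η N (m + 1) k ω)
        = fun ω => ∑ i ∈ Finset.Icc k (m + 1), (Lp.P η N k i ω - L.P η N k i ω) := by
      funext ω
      rw [AiryOp.remainder, AiryOp.remainder, Finset.sum_sub_distrib]
    rw [e]
    calc _ ≤ ∑ i ∈ Finset.Icc k (m + 1), opLip η γ (ρ (m + 1))
            (L.E η γ N O k ∩ Lp.E η γp N Op k) (fun ω => Lp.P η N k i ω - L.P η N k i ω) :=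
          opLip_sum_le _ fun i ω => Lp.P η N k i ω - L.P η N k i ω
      _ ≤ ∑ i ∈ Finset.Icc k (m + 1),
            ENNReal.ofReal (8 * (if i ≤ m then δ i else 1) * δ (m + 1)) := by
          refine Finset.sum_le_sum fun i hi => ?_
          rw [Finset.mem_Icc] at hi
          exact (opLip_mono (hS.rho_anti.antitone hi.2) _).trans (hP k hk.2 i hi.1)
      _ ≤ ∑ i ∈ Finset.range (m + 2),
            ENNReal.ofReal (8 * (if i ≤ m then δ i else 1) * δ (m + 1)) := by
          refine Finset.sum_le_sum_of_subset fun i hi => ?_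
          rw [Finset.mem_Icc] at hi
          exact Finset.mem_range.2 (Nat.lt_succ_of_le hi.2)
      _ = ENNReal.ofReal (8 * (∑ i ∈ Finset.range (m + 2), if i ≤ m then δ i else 1)
            * δ (m + 1)) := by
          rw [← ENNReal.ofReal_sum_of_nonneg fun i _ =>
            mul_nonneg (mul_nonneg (by norm_num) (hβ0 i)) hδ0, ← Finset.sum_mul, ← Finset.mul_sum]
      _ ≤ _ := ENNReal.ofReal_le_ofReal (mul_le_mul_of_nonneg_right (by linarith) hδ0)
  · rw [Finset.mem_Icc] at hk
    obtain ⟨n, rfl⟩ : ∃ n, k = n + 1 := ⟨k - 1, by omega⟩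
    rw [Nat.add_sub_cancel]
    refine le_trans (le_of_eq (opLip_congr fun ω hω => ?_))
      (((opLip_mono_set (hsubE (n + 1)) _).trans (d4 n (by omega))).trans
        (ENNReal.ofReal_le_ofReal (by linarith)))
    rw [cutGen_eq_Psi hκ hκγ hκγ hO hω.1, cutGen_eq_Psi hκ hγp hκγ (hOp.trans hO) hω.2]
  · refine ⟨fun k j ω => (L.cut κ η N k ω).1 j, fun k j ω => (Lp.cut κ η N k ω).1 j,
      isCorrection_cut hκ hκγ hκγ hO (fun k => (hS.rho_pos k).le) fun k hk => ?_,
      isCorrection_cut hκ hγp hκγ (hOp.trans hO) (fun k => (hS.rho_pos k).le) fun k hk => ?_,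
      fun k hk j => ?_⟩
    · refine (cut_bounds hκ hκ1 hγ1 hC0.le hC hS hε hε1 hεκ hL (by omega)).trans
        (ENNReal.ofReal_le_ofReal ?_)
      linarith [hS.delta_pos k]
    · refine (d2 k (by omega)).trans (ENNReal.ofReal_le_ofReal ?_)
      linarith [hS.delta_pos k]
    · rw [Finset.mem_Icc] at hk
      rw [Set.inter_eq_right.2 hOp]
      exact d1 k hk.2 j
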